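/- Let $k\ge 2$ be an integer and let $F$ be a finite $k$-uniform hypergraph with $v$ vertices and $h$ hyperedges. For a hypergraph $H$, write $|H|$ and $e(H)$ for its numbers of vertices and hyperedges, and let $\Delta_{k-1}(H)$ be the maximum, over all $(k-1)$-subsets $U$ of its vertex set, of the number of hyperedges of $H$ containing $U$. Suppose that $F$ is strictly $k$-balanced, i.e. $|F|\ge k+1$ and every proper subgraph $F'\subsetneq F$ with $|F'|\ge k+1$ satisfies $$\frac{e(F)-1}{|F|-k}>\frac{e(F')-1}{|F'|-k},$$ that $h\ge v-k+1$, and that $\Delta_{k-1}(F)\ge 2$. The random greedy $F$-free process on $[n]$ is defined as follows. Assign to the hyperedges of the complete $k$-uniform hypergraph on $[n]$ independent birthtimes, uniformly distributed in $[0,1]$. Start with the hypergraph on $[n]$ without hyperedges, consider the hyperedges in increasing order of their birthtimes (ties being broken in any way), and add each hyperedge to the current hypergraph provided that this does not create a (not necessarily induced) copy of $F$. Let $R_{n,1}$ be the final hypergraph, obtained when all hyperedges have been considered. Then there is a constant $c$ (independent of $n$) such that, with $$t=t(n):=c\,n^{1-\frac{v-k}{h-1}}(\log n)^{\frac{3}{\Delta_{k-1}(F)-1}-\frac1{h-1}},$$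 the probability that $\Delta_{k-1}(R_{n,1})<t$ tends to $1$ as $n\to\infty$. In particular, the probability that $R_{n,1}$ has at most $t\,n^{k-1}$ hyperedges also tends to $1$ as $n\to\infty$. -/

import Mathlib

namespace Hypergraph

/-- Every hyperedge has exactly `k` vertices. -/
def IsUniform {α : Type*} (H : Hypergraph α) (k : ℕ) : Prop :=
  ∀ e ∈ H.edgeSet, e.ncard = k

/-- `H'` is a (not necessarily induced) subgraph of `H`. -/
def IsSubgraph {α : Type*} (H' H : Hypergraph α) : Prop :=
  H'.vertexSet ⊆ H.vertexSet ∧ H'.edgeSet ⊆ H.edgeSet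

/-- `F` is strictly `k`-balanced: `|F| ≥ k + 1` and every proper subgraph `F'` with
`|F'| ≥ k + 1` satisfies `(e(F') - 1) / (|F'| - k) < (e(F) - 1) / (|F| - k)`. -/
def IsStrictlyBalanced {α : Type*} (F : Hypergraph α) (k : ℕ) : Prop :=
  k + 1 ≤ F.vertexSet.ncard ∧
    ∀ F' : Hypergraph α, F'.IsSubgraph F → F' ≠ F → k + 1 ≤ F'.vertexSet.ncard →
      ((F'.edgeSet.ncard : ℝ) - 1) / ((F'.vertexSet.ncard : ℝ) - k) <
        ((F.edgeSet.ncard : ℝ) - 1) / ((F.vertexSet.ncard : ℝ) - k)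

/-- The number of hyperedges of `H` that contain `U`. -/
noncomputable def degree {α : Type*} (H : Hypergraph α) (U : Set α) : ℕ :=
  {e | e ∈ H.edgeSet ∧ U ⊆ e}.ncard

/-- The maximum `i`-degree of a finite hypergraph `H` (`0` if `H` has fewer than `i` vertices). -/
noncomputable def maxDegree {α : Type*} (H : Hypergraph α) (i : ℕ) : ℕ :=
  sSup {d | ∃ U ⊆ H.vertexSet, U.ncard = i ∧ H.degree U = d}

/-- `H` contains a copy of `F` as a (not necessarily induced) subgraph. -/
def ContainsCopy {α β : Type*} (F : Hypergraph α) (H : Hypergraph β) : Prop :=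
  ∃ φ : α → β, Set.InjOn φ F.vertexSet ∧ (F.image φ).IsSubgraph H

/-- `H` with the hyperedge `e` added. -/
def addEdge {α : Type*} (H : Hypergraph α) (e : Set α) : Hypergraph α where
  vertexSet := H.vertexSet ∪ e
  edgeSet := insert e H.edgeSet
  subset_vertexSet_of_mem_edgeSet' := by
    rintro f (rfl | hf)
    · exact Set.subset_union_right
    · exact (H.subset_vertexSet_of_mem_edgeSet' hf).trans Set.subset_union_left

end Hypergraph

namespace GreedyFree

/-- The hyperedges of the complete `k`-uniform hypergraph on the vertex set `Fin n`. -/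
abbrev Edge (n k : ℕ) : Type := Set.powersetCard (Fin n) k

open Classical in
/-- One step of the greedy process: add `e` unless this creates a copy of `F`. -/
noncomputable def step {α : Type*} {n k : ℕ} (F : Hypergraph α)
    (H : Hypergraph (Fin n)) (e : Edge n k) : Hypergraph (Fin n) :=
  if F.ContainsCopy (H.addEdge ((e : Finset (Fin n)) : Set (Fin n))) then H
  else H.addEdge ((e : Finset (Fin n)) : Set (Fin n))

/-- Start with no hyperedges on the vertex set `Fin n` and consider the hyperedges in the list
`l` one after the other. -/
noncomputable def run {α : Type*} {n k : ℕ} (F : Hypergraph α)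
    (l : List (Edge n k)) : Hypergraph (Fin n) :=
  l.foldl (step F) (Hypergraph.trivialOn Set.univ)

/-- `l` lists the hyperedges born up to time `p` in order of their birthtimes, ties being broken
in an arbitrary way. -/
def IsBirthOrder {n k : ℕ} (b : Edge n k → unitInterval) (p : unitInterval)
    (l : List (Edge n k)) : Prop :=
  l.Nodup ∧ (∀ e, e ∈ l ↔ b e ≤ p) ∧ l.Pairwise (fun e f => b e ≤ b f)

/-- `R` is the hypergraph `R_{n,p}` of the greedy `F`-free process with birthtimes `b`, for some
way of breaking ties. It is unique if the birthtimes are distinct. -/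
def IsProcessAt {α : Type*} {n k : ℕ} (F : Hypergraph α)
    (b : Edge n k → unitInterval) (p : unitInterval) (R : Hypergraph (Fin n)) : Prop :=
  ∃ l : List (Edge n k), IsBirthOrder b p l ∧ R = run F l

/-- The process always has an outcome. -/
theorem exists_isProcessAt {α : Type*} {n k : ℕ} (F : Hypergraph α)
    (b : Edge n k → unitInterval) (p : unitInterval) :
    ∃ R : Hypergraph (Fin n), IsProcessAt F b p R := by
  classical
  let r : Edge n k → Edge n k → Prop := fun e f => b e ≤ b f
  have : Std.Total r := ⟨fun e f => le_total (b e) (b f)⟩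
  have : IsTrans (Edge n k) r := ⟨fun _ _ _ h h' => le_trans (α := unitInterval) h h'⟩
  let s : Finset (Edge n k) := Set.toFinset {e | b e ≤ p}
  have hp := List.perm_insertionSort r s.toList
  refine ⟨_, s.toList.insertionSort r, ⟨?_, ?_, ?_⟩, rfl⟩
  · exact hp.nodup_iff.2 s.nodup_toList
  · intro e
    rw [hp.mem_iff]
    simp [s]
  · exact List.pairwise_insertionSort r _

/-- The bound `c n^{1 - (v - k) / (h - 1)} (log n)^{3 / (d - 1) - 1 / (h - 1)}`. -/
noncomputable def bound (k v h d : ℕ) (c : ℝ) (n : ℕ) : ℝ :=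
  c * (n : ℝ) ^ (1 - ((v : ℝ) - k) / ((h : ℝ) - 1)) *
    Real.log n ^ (3 / ((d : ℝ) - 1) - 1 / ((h : ℝ) - 1))

end GreedyFree

/-! Write `L = log n`. Fix a `(k-1)`-set `U₀` of maximum degree `d` in `F`. Let `D` be the set of
the `d` vertices completing `U₀` to a hyperedge, and let `S` be the set of hyperedges of `F` that do
not contain `U₀`. Suppose that a `(k-1)`-set `U` has degree at least `t` in the final hypergraph,
and let `T` consist of `⌈t⌉` of its neighbours. Compare with the binomial random hypergraph `H` of
all hyperedges born up to time `p`. If an embedding sends `U₀` onto `U`, `D` into `T`, and `S` to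
hyperedges of `H` lying in no copy of `F` in `H`, then the process accepts all these hyperedges
(`mem_edgeSet_run`). Together with the star from `U` to `T` they form a copy of `F`, which is
impossible (`maxDegree_lt`). So it suffices that with high probability every pair `(U, T)` has such
a good copy.

There are about `n ^ (k - 1 + τ)` pairs, where `τ = ⌈t⌉`, so the failure probability per pair must
be below `exp (-3 τ L)`. For one pair, let `λ` be the expected number of copies of `S` in a suitable
partite family. Strict balancedness makes overlaps negligible, and a Janson argument
(`prob_not_exists_isPacking_le`) gives about `λ / 16` edge-disjoint copies in `H`, with failure
probability at most `exp (-λ / 4)`. If all of them met copies of `F` in `H`, there would be many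
disjoint clusters, a cluster being a copy of `S` joined with a copy of `F` meeting it
(`exists_isPacking_union`). A first-moment bound (`prob_exists_isPacking_le`) excludes this. Passing
to disjoint clusters costs a factor of order `L`, because with high probability no hyperedge lies in
more than `O(L)` copies of `F` in `H` (`prob_edge_in_many_copies_le_div`).

The probability is chosen so that `n ^ (v - k) * p ^ (h - 1)` is a small constant divided by `L`.
Then `λ` has order at least `τ * (t / (n p)) ^ (d - 1) / L`. One factor `L` is needed for the union
bound over `T`, one for the clusters, and one to offset this `1 / L`; hence the exponent `3 / (d -
1)`.

The argument needs density below one, that is `v - k < h - 1`. In the boundary case `F` consists of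
two hyperedges sharing `k - 1` vertices, `S` is empty and no randomness is needed. -/

namespace RandomSubset

/-! ### The binomial random subset and its link to independent uniform birthtimes. -/

open Finset MeasureTheory

variable {E : Type*} [Fintype E] [DecidableEq E]

/-- The probability that the random subset of `E` that contains each element independently with
probability `p` is equal to `A`. -/
noncomputable def weight (p : ℝ) (A : Finset E) : ℝ := p ^ #A * (1 - p) ^ #Aᶜ

open Classical in
/-- The probability that the random subset of `E` that contains each element independently with
probability `p` satisfies `Q`. -/
noncomputable def prob (p : ℝ) (Q : Finset E → Prop) : ℝ := ∑ A with Q A, weight p A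

lemma weight_nonneg {p : ℝ} (hp0 : 0 ≤ p) (hp1 : p ≤ 1) (A : Finset E) : 0 ≤ weight p A :=
  mul_nonneg (pow_nonneg hp0 _) (pow_nonneg (sub_nonneg.2 hp1) _)

lemma prob_nonneg {p : ℝ} (hp0 : 0 ≤ p) (hp1 : p ≤ 1) (Q : Finset E → Prop) : 0 ≤ prob p Q :=
  sum_nonneg fun A _ => weight_nonneg hp0 hp1 A

lemma prob_mono {p : ℝ} (hp0 : 0 ≤ p) (hp1 : p ≤ 1) {Q Q' : Finset E → Prop}
    (h : ∀ A, Q A → Q' A) : prob p Q ≤ prob p Q' := by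
  classical
  refine sum_le_sum_of_subset_of_nonneg ?_ fun A _ _ => weight_nonneg hp0 hp1 A
  intro A
  simpa using h A

lemma prob_congr {p : ℝ} {Q Q' : Finset E → Prop} (h : ∀ A, Q A ↔ Q' A) :
    prob p Q = prob p Q' := by
  rw [funext fun A => propext (h A)]

lemma prob_eq_zero {p : ℝ} {Q : Finset E → Prop} (h : ∀ A, ¬ Q A) : prob p Q = 0 := by
  classical
  exact sum_eq_zero fun A hA => absurd (mem_filter.1 hA).2 (h A)

lemma prob_or_le {p : ℝ} (hp0 : 0 ≤ p) (hp1 : p ≤ 1) (Q Q' : Finset E → Prop) :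
    prob p (fun A => Q A ∨ Q' A) ≤ prob p Q + prob p Q' := by
  classical
  unfold prob
  rw [← sum_union_inter]
  refine (le_of_eq (sum_congr (by ext; simp) fun _ _ => rfl)).trans
    (le_add_of_nonneg_right (sum_nonneg fun A _ => weight_nonneg hp0 hp1 A))

lemma prob_exists_le {ι : Type*} {p : ℝ} (hp0 : 0 ≤ p) (hp1 : p ≤ 1) (s : Finset ι)
    (Q : ι → Finset E → Prop) :
    prob p (fun A => ∃ i ∈ s, Q i A) ≤ ∑ i ∈ s, prob p (Q i) := by
  classical
  induction s using Finset.induction_on with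
  | empty => simp [prob]
  | insert i s hi ih =>
    rw [sum_insert hi]
    calc prob p (fun A => ∃ j ∈ insert i s, Q j A)
        ≤ prob p (fun A => Q i A ∨ ∃ j ∈ s, Q j A) :=
          prob_mono hp0 hp1 fun A => by simp
      _ ≤ _ := (prob_or_le hp0 hp1 _ _).trans (by gcongr)

lemma prob_split {p : ℝ} (Q Q' : Finset E → Prop) :
    prob p Q = prob p (fun A => Q' A ∧ Q A) + prob p (fun A => ¬ Q' A ∧ Q A) := by
  classical
  unfold prob
  rw [← sum_filter_add_sum_filter_not _ Q']
  simp only [filter_filter, and_comm]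

lemma sum_eq_sum_powerset_erase {R : Type*} [AddCommMonoid R] (f : Finset E → R) (e : E) :
    ∑ A, f A = ∑ A ∈ (univ.erase e).powerset, (f A + f (insert e A)) := by
  rw [sum_add_distrib, ← sum_powerset_insert (by simp), insert_erase (mem_univ e), powerset_univ]

/-- The two weights on the right add up to the weight of `A` as a subset of `E` without `e`, and a
fraction `p` of it goes to the set containing `e`. -/
lemma weight_insert {p : ℝ} {e : E} {A : Finset E} (he : e ∉ A) :
    weight p (insert e A) = p * (weight p A + weight p (insert e A)) := by
  have h1 : #Aᶜ = #(insert e A)ᶜ + 1 := by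
    have := card_compl_add_card A
    have := card_compl_add_card (insert e A)
    rw [card_insert_of_notMem he] at this
    omega
  unfold weight
  rw [h1, card_insert_of_notMem he]
  ring

lemma prob_mem_and {p : ℝ} (e : E) (Q : Finset E → Prop) :
    prob p (fun A => e ∈ A ∧ Q A) = p * prob p (fun A => Q (insert e A)) := by
  classical
  unfold prob
  rw [sum_filter, sum_filter, sum_eq_sum_powerset_erase _ e, sum_eq_sum_powerset_erase _ e, mul_sum]
  refine sum_congr rfl fun A hA => ?_
  have he : e ∉ A := fun h => by simpa using mem_powerset.1 hA h
  by_cases hQ : Q (insert e A)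
  · simp only [he, hQ, false_and, if_false, mem_insert_self, true_and, if_true, insert_idem,
      zero_add]
    exact weight_insert he
  · simp [he, hQ]

/-- Conditioning on the presence of `B` amounts to adding `B`. -/
lemma prob_subset_and {p : ℝ} (B : Finset E) (Q : Finset E → Prop) :
    prob p (fun A => B ⊆ A ∧ Q A) = p ^ #B * prob p (fun A => Q (A ∪ B)) := by
  induction B using Finset.induction_on generalizing Q with
  | empty => simp
  | insert e B he ih =>
    rw [card_insert_of_notMem he, pow_succ', mul_assoc]
    calc prob p (fun A => insert e B ⊆ A ∧ Q A)
        = prob p (fun A => e ∈ A ∧ (B ⊆ A ∧ Q A)) :=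
          prob_congr fun A => by rw [insert_subset_iff, and_assoc]
      _ = p * prob p (fun A => B ⊆ A ∧ Q (insert e A)) := by
          rw [prob_mem_and]
          congr 1
          exact prob_congr fun A => by rw [subset_insert_iff_of_notMem he]
      _ = p * (p ^ #B * prob p (fun A => Q (A ∪ insert e B))) := by
          rw [ih]
          simp only [union_insert]

lemma prob_true (p : ℝ) : prob p (fun _ : Finset E => True) = 1 := by
  simp only [prob, filter_true, weight]
  rw [← powerset_univ]
  simp only [card_compl, ← card_univ (α := E)]
  rw [sum_pow_mul_eq_add_pow]
  simp

lemma prob_not {p : ℝ} (Q : Finset E → Prop) : prob p (fun A => ¬ Q A) = 1 - prob p Q := by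
  have := prob_split (p := p) (fun _ : Finset E => True) Q
  simp only [and_true, prob_true] at this
  linarith

lemma prob_subset {p : ℝ} (B : Finset E) : prob p (fun A => B ⊆ A) = p ^ #B := by
  have := prob_subset_and (p := p) B fun _ => True
  simpa only [and_true, prob_true, mul_one] using this

/-- The distribution of the set of coordinates that are at most `p`, for independent uniformly
distributed coordinates. -/
lemma volume_setOf_le (p : unitInterval) (Q : Finset E → Prop) :
    volume {b : E → unitInterval | Q (univ.filter fun e => b e ≤ p)} =
      ENNReal.ofReal (prob (p : ℝ) Q) := by
  classical
  have h1 : ∀ A : Finset E, {b : E → unitInterval | univ.filter (fun e => b e ≤ p) = A} =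
      Set.univ.pi fun e => if e ∈ A then Set.Iic p else Set.Ioi p := by
    intro A
    ext b
    simp only [Set.mem_ofPred_eq, Set.mem_univ_pi, Finset.ext_iff, mem_filter, mem_univ, true_and]
    refine forall_congr' fun e => ?_
    by_cases he : e ∈ A <;> simp [he]
  have h2 : ∀ A : Finset E, volume {b : E → unitInterval | univ.filter (fun e => b e ≤ p) = A} =
      ENNReal.ofReal (weight (p : ℝ) A) := by
    intro A
    rw [h1, volume_pi_pi, weight, ENNReal.ofReal_mul (pow_nonneg p.2.1 _),
      ENNReal.ofReal_pow p.2.1, ENNReal.ofReal_pow (sub_nonneg.2 p.2.2)]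
    have : ∀ e, volume (if e ∈ A then Set.Iic p else Set.Ioi p) =
        if e ∈ A then ENNReal.ofReal (p : ℝ) else ENNReal.ofReal (1 - p) := by
      intro e
      split_ifs <;> simp
    simp only [this, prod_ite, prod_const]
    congr 3
    · simp
    · ext; simp
  have h3 : {b : E → unitInterval | Q (univ.filter fun e => b e ≤ p)} =
      ⋃ A ∈ univ.filter Q, {b : E → unitInterval | univ.filter (fun e => b e ≤ p) = A} := by
    ext b
    simp
  rw [h3, measure_biUnion_finset, prob, ENNReal.ofReal_sum_of_nonneg
    fun A _ => weight_nonneg p.2.1 p.2.2 A]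
  · exact sum_congr rfl fun A _ => h2 A
  · intro A _ B _ hAB
    refine Set.disjoint_left.2 fun b hb hb' => hAB ?_
    exact hb.symm.trans hb'
  · intro A _
    rw [h1]
    refine MeasurableSet.univ_pi fun e => ?_
    split_ifs
    · exact measurableSet_Iic
    · exact measurableSet_Ioi

end RandomSubset

/-! ### Janson's inequality and packings of disjoint present sets. -/

namespace RandomSubset

open Finset MeasureTheory

variable {E : Type*} [Fintype E] [DecidableEq E] {ι : Type*}

lemma _root_.Finset.sum_biUnion_le_sum_sum {ι κ : Type*} [DecidableEq κ] (s : Finset ι)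
    (t : ι → Finset κ) (f : κ → ℝ) (hf : ∀ x, 0 ≤ f x) :
    ∑ x ∈ s.biUnion t, f x ≤ ∑ i ∈ s, ∑ x ∈ t i, f x := by
  classical
  induction s using Finset.induction_on with
  | empty => simp
  | insert i s hi ih =>
    rw [biUnion_insert, sum_insert hi]
    have := sum_union_inter (s₁ := t i) (s₂ := s.biUnion t) (f := f)
    have : 0 ≤ ∑ x ∈ t i ∩ s.biUnion t, f x := sum_nonneg fun x _ => hf x
    linarith

/-- The conditional probability of `B` given that no set of a family is present. -/
lemma le_prob_subset_and_none {p : ℝ} (hp0 : 0 ≤ p) (hp1 : p ≤ 1) (s : Finset ι)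
    (A : ι → Finset E) (B : Finset E) :
    prob p (fun H => ∀ i ∈ s, ¬ A i ⊆ H) *
        (p ^ #B - ∑ j ∈ s with ¬ Disjoint B (A j), p ^ #(B ∪ A j)) ≤
      prob p (fun H => B ⊆ H ∧ ∀ i ∈ s, ¬ A i ⊆ H) := by
  -- Members disjoint from `B` are independent of it, so only those meeting `B` cost anything. Each
  -- of these is charged by a union bound, relative to the probability `q` that nothing in `s₀` is
  -- present.
  set s₀ := s.filter fun j => Disjoint B (A j)
  set s₁ := s.filter fun j => ¬ Disjoint B (A j)
  set q := prob p (fun H => ∀ i ∈ s₀, ¬ A i ⊆ H)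
  have hsq : prob p (fun H => ∀ i ∈ s, ¬ A i ⊆ H) ≤ q :=
    prob_mono hp0 hp1 fun H h i hi => h i (filter_subset _ _ hi)
  have h1 : prob p (fun H => B ⊆ H ∧ ∀ i ∈ s₀, ¬ A i ⊆ H) = p ^ #B * q := by
    rw [prob_subset_and]
    congr 1
    refine prob_congr fun H => forall₂_congr fun i hi => ?_
    have hd : Disjoint (A i) B := (mem_filter.1 hi).2.symm
    rw [not_iff_not]
    exact ⟨fun h => hd.left_le_of_le_sup_right h, fun h => h.trans subset_union_left⟩
  have h2 : ∀ j, prob p (fun H => B ∪ A j ⊆ H ∧ ∀ i ∈ s₀, ¬ A i ⊆ H) ≤ p ^ #(B ∪ A j) * q := by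
    intro j
    rw [prob_subset_and]
    gcongr
    exact prob_mono hp0 hp1 fun H h i hi hH => h i hi (hH.trans subset_union_left)
  have h3 : prob p (fun H => B ⊆ H ∧ ∀ i ∈ s₀, ¬ A i ⊆ H) ≤
      prob p (fun H => B ⊆ H ∧ ∀ i ∈ s, ¬ A i ⊆ H) +
        ∑ j ∈ s₁, prob p (fun H => B ∪ A j ⊆ H ∧ ∀ i ∈ s₀, ¬ A i ⊆ H) := by
    refine le_trans ?_ (add_le_add_right (prob_exists_le hp0 hp1 _ _) _)
    refine (prob_mono hp0 hp1 ?_).trans (prob_or_le hp0 hp1 _ _)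
    rintro H ⟨hB, hH⟩
    by_cases h : ∃ j ∈ s₁, A j ⊆ H
    · obtain ⟨j, hj, hjH⟩ := h
      exact Or.inr ⟨j, hj, union_subset hB hjH, hH⟩
    · push Not at h
      refine Or.inl ⟨hB, fun i hi => ?_⟩
      by_cases hd : Disjoint B (A i)
      · exact hH i (mem_filter.2 ⟨hi, hd⟩)
      · exact h i (mem_filter.2 ⟨hi, hd⟩)
  have h4 : q * (p ^ #B - ∑ j ∈ s₁, p ^ #(B ∪ A j)) ≤
      prob p (fun H => B ⊆ H ∧ ∀ i ∈ s, ¬ A i ⊆ H) := by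
    have := h3.trans (add_le_add_right (sum_le_sum fun j _ => h2 j) _)
    rw [h1, ← sum_mul] at this
    linarith
  -- Replacing `q` by the smaller probability for `s` is legitimate only if the bracket is
  -- nonnegative; otherwise the claim is trivial.
  rcases le_total 0 (p ^ #B - ∑ j ∈ s₁, p ^ #(B ∪ A j)) with h | h
  · exact (mul_le_mul_of_nonneg_right hsq h).trans h4
  · exact (mul_nonpos_of_nonneg_of_nonpos (prob_nonneg hp0 hp1 _) h).trans
      (prob_nonneg hp0 hp1 _)

/-- Janson's inequality. -/
theorem prob_none_le_exp [DecidableEq ι] {p : ℝ} (hp0 : 0 ≤ p) (hp1 : p ≤ 1) (s : Finset ι)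
    (A : ι → Finset E) :
    prob p (fun H => ∀ i ∈ s, ¬ A i ⊆ H) ≤
      Real.exp (-(∑ i ∈ s, p ^ #(A i)) +
        ∑ i ∈ s, ∑ j ∈ s with j ≠ i ∧ ¬ Disjoint (A i) (A j), p ^ #(A i ∪ A j)) := by
  induction s using Finset.induction_on with
  | empty => simp [prob_true]
  | insert i s hi ih =>
    -- Only overlaps with earlier members appear here. The sum in the statement runs over ordered
    -- pairs, which is weaker but symmetric.
    set y := ∑ j ∈ s with ¬ Disjoint (A i) (A j), p ^ #(A i ∪ A j) with hy
    have h1 := le_prob_subset_and_none hp0 hp1 s A (A i)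
    have h2 := prob_split (p := p) (fun H => ∀ i ∈ s, ¬ A i ⊆ H) fun H => A i ⊆ H
    have h3 : prob p (fun H => ∀ j ∈ insert i s, ¬ A j ⊆ H) =
        prob p (fun H => ¬ A i ⊆ H ∧ ∀ i ∈ s, ¬ A i ⊆ H) :=
      prob_congr fun H => by simp
    have h4 : prob p (fun H => ∀ j ∈ insert i s, ¬ A j ⊆ H) ≤
        prob p (fun H => ∀ i ∈ s, ¬ A i ⊆ H) * (-(p ^ #(A i)) + y + 1) := by
      rw [h3]
      linarith
    refine h4.trans ((mul_le_mul ih (Real.add_one_le_exp _) ?_ (Real.exp_pos _).le).trans ?_)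
    · by_contra hneg
      push Not at hneg
      have h5 : p ^ #(A i) ≤ 1 := pow_le_one₀ hp0 hp1
      have h6 : 0 ≤ y := sum_nonneg fun j _ => pow_nonneg hp0 _
      linarith
    · rw [← Real.exp_add, Real.exp_le_exp, sum_insert hi, sum_insert hi]
      have h5 : ∑ i ∈ s, ∑ j ∈ s with j ≠ i ∧ ¬ Disjoint (A i) (A j), p ^ #(A i ∪ A j) ≤
          ∑ k ∈ s, ∑ j ∈ insert i s with j ≠ k ∧ ¬ Disjoint (A k) (A j), p ^ #(A k ∪ A j) :=
        sum_le_sum fun k _ => sum_le_sum_of_subset_of_nonneg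
          (filter_subset_filter _ (subset_insert i s)) fun j _ _ => pow_nonneg hp0 _
      have h6 : y ≤ ∑ j ∈ insert i s with j ≠ i ∧ ¬ Disjoint (A i) (A j), p ^ #(A i ∪ A j) := by
        refine sum_le_sum_of_subset_of_nonneg ?_ fun j _ _ => pow_nonneg hp0 _
        intro j hj
        rw [mem_filter] at hj ⊢
        exact ⟨mem_insert_of_mem hj.1, fun h => hi (h ▸ hj.1), hj.2⟩
      linarith

/-- The members of `A` indexed by `t` are pairwise disjoint and contained in `H`. -/
def IsPacking (A : ι → Finset E) (t : Finset ι) (H : Finset E) : Prop :=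
  (t : Set ι).PairwiseDisjoint A ∧ ∀ i ∈ t, A i ⊆ H

omit [Fintype E] [DecidableEq E] in
lemma IsPacking.mono {A : ι → Finset E} {t t' : Finset ι} {H : Finset E}
    (h : IsPacking A t H) (ht : t' ⊆ t) : IsPacking A t' H :=
  ⟨h.1.subset (coe_subset.2 ht), fun i hi => h.2 i (ht hi)⟩

-- A packing of maximum cardinality works: a present member disjoint from its union could be added.
-- Nonemptiness ensures that this member is not already in the packing.
omit [Fintype E] in
lemma exists_isPacking_maximal (s : Finset ι) (A : ι → Finset E) (H : Finset E)
    (hne : ∀ i ∈ s, (A i).Nonempty) :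
    ∃ t ⊆ s, IsPacking A t H ∧ ∀ i ∈ s, A i ⊆ H → ¬ Disjoint (A i) (t.biUnion A) := by
  classical
  obtain ⟨t, ht, hmax⟩ := exists_max_image (s.powerset.filter fun t => IsPacking A t H) card
    ⟨∅, mem_filter.2 ⟨empty_mem_powerset s, by simp [IsPacking]⟩⟩
  rw [mem_filter, mem_powerset] at ht
  refine ⟨t, ht.1, ht.2, fun i his hiH hi => ?_⟩
  rw [disjoint_biUnion_right] at hi
  have hit : i ∉ t := fun h => (hne i his).ne_empty (disjoint_self.1 (hi i h))
  have := hmax (insert i t) (mem_filter.2 ⟨mem_powerset.2 (insert_subset his ht.1), ?_, ?_⟩)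
  · rw [card_insert_of_notMem hit] at this
    omega
  · rw [coe_insert]
    exact ht.2.1.insert fun j hj _ => hi j hj
  · intro j hj
    rcases mem_insert.1 hj with rfl | hj
    · exact hiH
    · exact ht.2.2 j hj

omit [Fintype E] in
lemma pow_card_biUnion {p : ℝ} {A : ι → Finset E} {t : Finset ι}
    (h : (t : Set ι).PairwiseDisjoint A) : p ^ #(t.biUnion A) = ∏ i ∈ t, p ^ #(A i) := by
  rw [card_biUnion h, prod_pow_eq_pow_sum]

lemma prob_isPacking_le {p : ℝ} (hp0 : 0 ≤ p) (hp1 : p ≤ 1) (A : ι → Finset E) (t : Finset ι) :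
    prob p (IsPacking A t) ≤ ∏ i ∈ t, p ^ #(A i) := by
  by_cases h : (t : Set ι).PairwiseDisjoint A
  · rw [← pow_card_biUnion h, ← prob_subset]
    exact prob_mono hp0 hp1 fun H hH => biUnion_subset.2 hH.2
  · refine le_trans (le_of_eq ?_) (prod_nonneg fun i _ => pow_nonneg hp0 _)
    classical
    simp [prob, IsPacking, h]

/-- The left side expands the product of the `1 + x i`. -/
lemma sum_powerset_prod_le_exp (s : Finset ι) (x : ι → ℝ) (hx : ∀ i, 0 ≤ x i) :
    ∑ t ∈ s.powerset, ∏ i ∈ t, x i ≤ Real.exp (∑ i ∈ s, x i) := by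
  classical
  rw [← prod_one_add, Real.exp_sum]
  refine prod_le_prod (fun i _ => by linarith [hx i]) fun i _ => ?_
  rw [add_comm]
  exact Real.add_one_le_exp _

/-- It is unlikely that many pairwise disjoint members of a family are present. -/
theorem prob_exists_isPacking_le {p : ℝ} (hp0 : 0 ≤ p) (hp1 : p ≤ 1) (s : Finset ι)
    (A : ι → Finset E) (m : ℕ) {z : ℝ} (hz : 0 < z) :
    prob p (fun H => ∃ t ⊆ s, #t = m ∧ IsPacking A t H) ≤
      Real.exp (z * ∑ i ∈ s, p ^ #(A i)) / z ^ m := by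
  classical
  have hx : ∀ i, 0 ≤ z * p ^ #(A i) := fun i => mul_nonneg hz.le (pow_nonneg hp0 _)
  -- A union bound over the packings of size `m`; the factor `z ^ m` is distributed over the `m`
  -- members, after which the sum may be extended to all subsets.
  rw [le_div_iff₀ (pow_pos hz m), mul_sum]
  refine le_trans ?_ (sum_powerset_prod_le_exp s _ hx)
  calc prob p (fun H => ∃ t ⊆ s, #t = m ∧ IsPacking A t H) * z ^ m
      ≤ (∑ t ∈ s.powersetCard m, prob p (IsPacking A t)) * z ^ m := by
        gcongr
        refine le_trans (prob_mono hp0 hp1 ?_) (prob_exists_le hp0 hp1 _ _)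
        rintro H ⟨t, hts, htm, h⟩
        exact ⟨t, mem_powersetCard.2 ⟨hts, htm⟩, h⟩
    _ ≤ (∑ t ∈ s.powersetCard m, ∏ i ∈ t, p ^ #(A i)) * z ^ m := by
        gcongr with t
        exact prob_isPacking_le hp0 hp1 A t
    _ = ∑ t ∈ s.powersetCard m, ∏ i ∈ t, z * p ^ #(A i) := by
        rw [sum_mul]
        refine sum_congr rfl fun t ht => ?_
        rw [prod_mul_distrib, prod_const, (mem_powersetCard.1 ht).2, mul_comm]
    _ ≤ ∑ t ∈ s.powerset, ∏ i ∈ t, z * p ^ #(A i) :=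
        sum_le_sum_of_subset_of_nonneg
          (fun t ht => mem_powerset.2 (mem_powersetCard.1 ht).1)
          fun t _ _ => prod_nonneg fun i _ => hx i

/-- A family of large expected size and with few overlaps is likely to have many pairwise disjoint
members present. -/
theorem prob_not_exists_isPacking_le [DecidableEq ι] {p : ℝ} (hp0 : 0 ≤ p) (hp1 : p ≤ 1)
    (s : Finset ι) (A : ι → Finset E) (m r : ℕ) {lam η : ℝ} (hlam : ∑ i ∈ s, p ^ #(A i) = lam)
    (hne : ∀ i ∈ s, (A i).Nonempty) (hr : ∀ i ∈ s, #(A i) ≤ r)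
    (hη0 : 0 ≤ η) (hη : ∀ f : E, ∑ i ∈ s with f ∈ A i, p ^ #(A i) ≤ η)
    (hΔ : ∑ i ∈ s, ∑ j ∈ s with j ≠ i ∧ ¬ Disjoint (A i) (A j), p ^ #(A i ∪ A j) ≤ lam / 8)
    (hm : (m : ℝ) ≤ lam / 16) (hmη : (m : ℝ) * r * η ≤ lam / 8) :
    prob p (fun H => ¬ ∃ t ⊆ s, #t = m ∧ IsPacking A t H) ≤ Real.exp (-(lam / 4)) := by
  have hx : ∀ i, 0 ≤ (1 / 8 : ℝ) * p ^ #(A i) := fun i => by positivity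
  set s' : Finset ι → Finset ι := fun t => s.filter fun i => Disjoint (A i) (t.biUnion A)
  classical
  -- The union bound runs over the possible maximal packings `t`. Given that `t` is present, no
  -- member disjoint from its union is present, and Janson's inequality applies independently to
  -- those members.
  set 𝒯 := s.powerset.filter fun t => #t ≤ m ∧ (t : Set ι).PairwiseDisjoint A
  have hcover : ∀ H, (¬ ∃ t ⊆ s, #t = m ∧ IsPacking A t H) →
      ∃ t ∈ 𝒯, t.biUnion A ⊆ H ∧ ∀ i ∈ s' t, ¬ A i ⊆ H := by
    intro H hH
    obtain ⟨t, hts, ht, hmax⟩ := exists_isPacking_maximal s A H hne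
    refine ⟨t, mem_filter.2 ⟨mem_powerset.2 hts, ?_, ht.1⟩, biUnion_subset.2 ht.2, ?_⟩
    · by_contra hlt
      push Not at hlt
      obtain ⟨t', ht', hc⟩ := exists_subset_card_eq hlt.le
      exact hH ⟨t', ht'.trans hts, hc, ht.mono ht'⟩
    · exact fun i hi hiH => hmax i (mem_filter.1 hi).1 hiH (mem_filter.1 hi).2
  have hterm : ∀ t ∈ 𝒯, prob p (fun H => t.biUnion A ⊆ H ∧ ∀ i ∈ s' t, ¬ A i ⊆ H) ≤
      (∏ i ∈ t, p ^ #(A i)) * Real.exp (-(3 * lam / 4)) := by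
    intro t ht
    obtain ⟨hts, htm, htd⟩ := mem_filter.1 ht
    rw [mem_powerset] at hts
    have h1 : prob p (fun H => t.biUnion A ⊆ H ∧ ∀ i ∈ s' t, ¬ A i ⊆ H) =
        (∏ i ∈ t, p ^ #(A i)) * prob p (fun H => ∀ i ∈ s' t, ¬ A i ⊆ H) := by
      rw [prob_subset_and, pow_card_biUnion htd]
      congr 1
      refine prob_congr fun H => forall₂_congr fun i hi => ?_
      rw [not_iff_not]
      exact ⟨fun h => (mem_filter.1 hi).2.left_le_of_le_sup_right h,
        fun h => h.trans subset_union_left⟩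
    rw [h1]
    refine mul_le_mul_of_nonneg_left ?_ (prod_nonneg fun i _ => pow_nonneg hp0 _)
    refine (prob_none_le_exp hp0 hp1 (s' t) A).trans (Real.exp_le_exp.2 ?_)
    have h2 : ∑ i ∈ s' t, ∑ j ∈ s' t with j ≠ i ∧ ¬ Disjoint (A i) (A j), p ^ #(A i ∪ A j) ≤
        lam / 8 := by
      refine le_trans ?_ hΔ
      refine (sum_le_sum fun i _ => sum_le_sum_of_subset_of_nonneg (filter_subset_filter _
        (filter_subset _ s)) fun j _ _ => pow_nonneg hp0 _).trans ?_
      exact sum_le_sum_of_subset_of_nonneg (filter_subset _ s)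
        fun i _ _ => sum_nonneg fun j _ => pow_nonneg hp0 _
    -- The members lost by removing everything that meets `t` carry at most an eighth of the
    -- expectation, and the overlap sum another eighth, which leaves the exponent `-3 λ / 4`.
    have h3 : ∑ i ∈ s with ¬ Disjoint (A i) (t.biUnion A), p ^ #(A i) ≤ lam / 8 := by
      have hsub : (s.filter fun i => ¬ Disjoint (A i) (t.biUnion A)) ⊆
          (t.biUnion A).biUnion fun f => s.filter fun i => f ∈ A i := by
        intro i hi
        rw [mem_filter, not_disjoint_iff] at hi
        obtain ⟨his, f, hf, hf'⟩ := hi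
        exact mem_biUnion.2 ⟨f, hf', mem_filter.2 ⟨his, hf⟩⟩
      have hcard : #(t.biUnion A) ≤ m * r :=
        card_biUnion_le_card_mul t A r (fun i hi => hr i (hts hi)) |>.trans
          (Nat.mul_le_mul_right r htm)
      calc ∑ i ∈ s with ¬ Disjoint (A i) (t.biUnion A), p ^ #(A i)
          ≤ ∑ i ∈ (t.biUnion A).biUnion fun f => s.filter fun i => f ∈ A i, p ^ #(A i) :=
            sum_le_sum_of_subset_of_nonneg hsub fun i _ _ => pow_nonneg hp0 _
        _ ≤ ∑ f ∈ t.biUnion A, ∑ i ∈ s with f ∈ A i, p ^ #(A i) :=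
            sum_biUnion_le_sum_sum _ _ _ fun i => pow_nonneg hp0 _
        _ ≤ ∑ f ∈ t.biUnion A, η := sum_le_sum fun f _ => hη f
        _ = #(t.biUnion A) * η := by rw [sum_const, nsmul_eq_mul]
        _ ≤ m * r * η := by
            gcongr
            exact_mod_cast hcard
        _ ≤ lam / 8 := hmη
    have h4 := sum_filter_add_sum_filter_not s (fun i => Disjoint (A i) (t.biUnion A))
      fun i => p ^ #(A i)
    have h5 : ∑ i ∈ s' t, p ^ #(A i) =
      ∑ i ∈ s with Disjoint (A i) (t.biUnion A), p ^ #(A i) := rfl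
    linarith
  -- Since `#t ≤ m`, every term can be scaled by `8 ^ m * (1 / 8) ^ #t ≥ 1`. Then the exponential
  -- bound gives `exp (λ / 8)`, and `8 ≤ e ^ 3` with `m ≤ λ / 16` controls `8 ^ m`.
  have hweight : ∑ t ∈ 𝒯, ∏ i ∈ t, p ^ #(A i) ≤ Real.exp (5 * lam / 16) := by
    have h8 : (8 : ℝ) ≤ Real.exp 3 := by
      have h1 := Real.exp_one_gt_d9
      have h2 : Real.exp 3 = Real.exp 1 ^ 3 := by rw [← Real.exp_nat_mul]; norm_num
      rw [h2]
      calc (8 : ℝ) = 2 ^ 3 := by norm_num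
        _ ≤ Real.exp 1 ^ 3 := by gcongr; linarith
    have h8m : (8 : ℝ) ^ m ≤ Real.exp (3 * lam / 16) := by
      calc (8 : ℝ) ^ m ≤ Real.exp 3 ^ m := by gcongr
        _ = Real.exp (m * 3) := (Real.exp_nat_mul _ _).symm
        _ ≤ _ := Real.exp_le_exp.2 (by linarith)
    calc ∑ t ∈ 𝒯, ∏ i ∈ t, p ^ #(A i)
        ≤ ∑ t ∈ 𝒯, 8 ^ m * ∏ i ∈ t, (1 / 8 : ℝ) * p ^ #(A i) := by
          refine sum_le_sum fun t ht => ?_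
          obtain ⟨-, htm, -⟩ := mem_filter.1 ht
          rw [prod_mul_distrib, prod_const, ← mul_assoc]
          refine le_mul_of_one_le_left (prod_nonneg fun i _ => pow_nonneg hp0 _) ?_
          rw [one_div, inv_pow, ← div_eq_mul_inv, one_le_div (by positivity)]
          exact pow_le_pow_right₀ (by norm_num) htm
      _ = 8 ^ m * ∑ t ∈ 𝒯, ∏ i ∈ t, (1 / 8 : ℝ) * p ^ #(A i) := (mul_sum _ _ _).symm
      _ ≤ 8 ^ m * Real.exp (lam / 8) := by
          gcongr
          calc ∑ t ∈ 𝒯, ∏ i ∈ t, (1 / 8 : ℝ) * p ^ #(A i)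
              ≤ ∑ t ∈ s.powerset, ∏ i ∈ t, (1 / 8 : ℝ) * p ^ #(A i) :=
                sum_le_sum_of_subset_of_nonneg (filter_subset _ _)
                  fun t _ _ => prod_nonneg fun i _ => hx i
            _ ≤ Real.exp (∑ i ∈ s, (1 / 8 : ℝ) * p ^ #(A i)) := sum_powerset_prod_le_exp s _ hx
            _ = Real.exp (lam / 8) := by rw [← mul_sum, hlam]; congr 1; ring
      _ ≤ Real.exp (3 * lam / 16) * Real.exp (lam / 8) := by gcongr
      _ = Real.exp (5 * lam / 16) := by rw [← Real.exp_add]; congr 1; ring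
  have hlam0 : 0 ≤ lam := hlam ▸ sum_nonneg fun i _ => pow_nonneg hp0 _
  calc prob p (fun H => ¬ ∃ t ⊆ s, #t = m ∧ IsPacking A t H)
      ≤ ∑ t ∈ 𝒯, prob p (fun H => t.biUnion A ⊆ H ∧ ∀ i ∈ s' t, ¬ A i ⊆ H) :=
        (prob_mono hp0 hp1 hcover).trans (prob_exists_le hp0 hp1 _ _)
    _ ≤ ∑ t ∈ 𝒯, (∏ i ∈ t, p ^ #(A i)) * Real.exp (-(3 * lam / 4)) := sum_le_sum hterm
    _ = (∑ t ∈ 𝒯, ∏ i ∈ t, p ^ #(A i)) * Real.exp (-(3 * lam / 4)) := (sum_mul _ _ _).symm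
    _ ≤ Real.exp (5 * lam / 16) * Real.exp (-(3 * lam / 4)) := by gcongr
    _ ≤ Real.exp (-(lam / 4)) := by
        rw [← Real.exp_add]
        exact Real.exp_le_exp.2 (by linarith)

end RandomSubset

/-! ### Deterministic counting from the absence of large packings. -/

namespace RandomSubset

open Finset

variable {E : Type*} [DecidableEq E] {ι : Type*}

/-- If there is no packing of size `m`, then the number of members present is controlled by the
maximum number of members present that contain a given element. -/
lemma card_filter_subset_le_of_not_exists_isPacking (s : Finset ι) (A : ι → Finset E)
    (H : Finset E) (m r N : ℕ) (hne : ∀ i ∈ s, (A i).Nonempty) (hr : ∀ i ∈ s, #(A i) ≤ r)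
    (hm : ¬ ∃ t ⊆ s, #t = m ∧ IsPacking A t H)
    (hN : ∀ f : E, #{i ∈ s | A i ⊆ H ∧ f ∈ A i} ≤ N) :
    #{i ∈ s | A i ⊆ H} ≤ m * r * N := by
  classical
  obtain ⟨t, hts, ht, hmax⟩ := exists_isPacking_maximal s A H hne
  have htm : #t ≤ m := by
    by_contra hlt
    push Not at hlt
    obtain ⟨t', ht', hc⟩ := exists_subset_card_eq hlt.le
    exact hm ⟨t', ht'.trans hts, hc, ht.mono ht'⟩
  have hsub : {i ∈ s | A i ⊆ H} ⊆
      (t.biUnion A).biUnion fun f => {i ∈ s | A i ⊆ H ∧ f ∈ A i} := by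
    intro i hi
    rw [mem_filter] at hi
    obtain ⟨f, hf, hf'⟩ := not_disjoint_iff.1 (hmax i hi.1 hi.2)
    exact mem_biUnion.2 ⟨f, hf', mem_filter.2 ⟨hi.1, hi.2, hf⟩⟩
  calc #{i ∈ s | A i ⊆ H} ≤ #(t.biUnion A) * N :=
        (card_le_card hsub).trans (card_biUnion_le_card_mul _ _ _ fun f _ => hN f)
    _ ≤ #t * r * N := by
        gcongr
        exact card_biUnion_le_card_mul _ _ _ fun i hi => hr i (hts hi)
    _ ≤ m * r * N := by gcongr

/-- The previous count applied to the links `G \ J`. It reduces the number of present extensions of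
`J` to that of sets with one more element. -/
lemma card_filter_superset_le (𝒢 : Finset (Finset E)) (H J : Finset E) (m r N : ℕ)
    (hr : ∀ G ∈ 𝒢, #G = r) (hJ : #J < r)
    (hm : ¬ ∃ t ⊆ {G ∈ 𝒢 | J ⊆ G}, #t = m ∧ IsPacking (· \ J) t H)
    (hN : ∀ f ∉ J, #{G ∈ 𝒢 | insert f J ⊆ G ∧ G ⊆ H} ≤ N) :
    #{G ∈ 𝒢 | J ⊆ G ∧ G ⊆ H} ≤ m * r * N := by
  by_cases hJH : J ⊆ H
  swap
  · rw [filter_eq_empty_iff.2 fun G _ h => hJH (h.1.trans h.2)]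
    simp
  have hiff : ∀ G, J ⊆ G → (G \ J ⊆ H ↔ G ⊆ H) := fun G hG =>
    ⟨fun h x hx => if hxJ : x ∈ J then hJH hxJ else h (mem_sdiff.2 ⟨hx, hxJ⟩),
      fun h => sdiff_subset.trans h⟩
  have := card_filter_subset_le_of_not_exists_isPacking {G ∈ 𝒢 | J ⊆ G} (· \ J) H m r N ?_ ?_ hm ?_
  · refine le_trans (card_le_card ?_) this
    intro G hG
    rw [mem_filter] at hG
    exact mem_filter.2 ⟨mem_filter.2 ⟨hG.1, hG.2.1⟩, (hiff G hG.2.1).2 hG.2.2⟩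
  · intro G hG
    rw [mem_filter] at hG
    rw [sdiff_nonempty]
    intro h
    have := card_le_card h
    rw [hr G hG.1] at this
    omega
  · intro G hG
    rw [mem_filter] at hG
    exact (card_le_card sdiff_subset).trans (hr G hG.1).le
  · intro f
    by_cases hf : f ∈ J
    · rw [filter_eq_empty_iff.2 fun G _ h => (mem_sdiff.1 h.2).2 hf]
      simp
    · refine le_trans (card_le_card ?_) (hN f hf)
      intro G hG
      simp only [mem_filter, mem_sdiff] at hG ⊢
      obtain ⟨⟨hG1, hG2⟩, hG3, hG4, -⟩ := hG
      exact ⟨hG1, insert_subset hG4 hG2, (hiff G hG2).1 hG3⟩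

/-- Downward induction on the size of `J`, starting at size `r`, where `J` itself is the only
candidate. -/
lemma card_filter_superset_le_pow (𝒢 : Finset (Finset E)) (H : Finset E) (m r : ℕ)
    (hr : ∀ G ∈ 𝒢, #G = r)
    (hm : ∀ J : Finset E, 2 ≤ #J → #J < r →
      ¬ ∃ t ⊆ {G ∈ 𝒢 | J ⊆ G}, #t = m ∧ IsPacking (· \ J) t H)
    (j : ℕ) (J : Finset E) (hJ2 : 2 ≤ #J) (hJ : #J + j = r) :
    #{G ∈ 𝒢 | J ⊆ G ∧ G ⊆ H} ≤ (m * r) ^ j := by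
  induction j generalizing J with
  | zero =>
    rw [pow_zero, card_le_one]
    have : ∀ G ∈ {G ∈ 𝒢 | J ⊆ G ∧ G ⊆ H}, G = J := by
      intro G hG
      rw [mem_filter] at hG
      exact (eq_of_subset_of_card_le hG.2.1 (by rw [hr G hG.1]; omega)).symm
    intro G hG G' hG'
    rw [this G hG, this G' hG']
  | succ j ih =>
    rw [pow_succ']
    refine card_filter_superset_le 𝒢 H J m r _ hr (by omega) (hm J hJ2 (by omega)) ?_
    intro f hf
    exact ih (insert f J) (by rw [card_insert_of_notMem hf]; omega)
      (by rw [card_insert_of_notMem hf]; omega)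

/-- The number of members of a uniform family that are present and contain a given element. -/
lemma card_filter_mem_le (𝒢 : Finset (Finset E)) (H : Finset E) (m m₁ r : ℕ) (hr2 : 2 ≤ r)
    (hr : ∀ G ∈ 𝒢, #G = r)
    (hm : ∀ J : Finset E, 2 ≤ #J → #J < r →
      ¬ ∃ t ⊆ {G ∈ 𝒢 | J ⊆ G}, #t = m ∧ IsPacking (· \ J) t H)
    (hm₁ : ∀ e : E, ¬ ∃ t ⊆ {G ∈ 𝒢 | {e} ⊆ G}, #t = m₁ ∧ IsPacking (· \ {e}) t H) (e : E) :
    #{G ∈ 𝒢 | e ∈ G ∧ G ⊆ H} ≤ m₁ * r * (m * r) ^ (r - 2) := by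
  have := card_filter_superset_le 𝒢 H {e} m₁ r ((m * r) ^ (r - 2)) hr (by simp; omega) (hm₁ e) ?_
  · simpa only [singleton_subset_iff] using this
  · intro f hf
    have hc : #(insert f {e}) = 2 := by
      rw [card_insert_of_notMem hf, card_singleton]
    exact card_filter_superset_le_pow 𝒢 H m r hr hm (r - 2) _ hc.ge (by omega)

/-- An element of `G` lies in at most one member of a disjoint family. -/
lemma card_filter_not_disjoint_le {A : ι → Finset E} {t : Finset ι}
    (h : (t : Set ι).PairwiseDisjoint A) (G : Finset E) :
    #{i ∈ t | ¬ Disjoint (A i) G} ≤ #G := by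
  classical
  have hsub : {i ∈ t | ¬ Disjoint (A i) G} ⊆ G.biUnion fun g => {i ∈ t | g ∈ A i} := by
    intro i hi
    rw [mem_filter, not_disjoint_iff] at hi
    obtain ⟨hit, g, hg, hgG⟩ := hi
    exact mem_biUnion.2 ⟨g, hgG, mem_filter.2 ⟨hit, hg⟩⟩
  refine (card_le_card hsub).trans ((card_biUnion_le_card_mul _ _ 1 fun g _ => ?_).trans
    (mul_one _).le)
  rw [card_le_one]
  intro i hi j hj
  rw [mem_filter] at hi hj
  by_contra hij
  exact disjoint_left.1 (h hi.1 hj.1 hij) hi.2 hj.2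

/-- If every member of a packing meets some present member of `𝒢`, then there is also a large
packing of unions of a member of the family and a member of `𝒢` that meets it. -/
lemma exists_isPacking_union (s : Finset ι) (A : ι → Finset E) (𝒢 : Finset (Finset E))
    (H : Finset E) (t : Finset ι) (hts : t ⊆ s) (ht : IsPacking A t H) (r B : ℕ)
    (hA : ∀ i ∈ s, (A i).Nonempty) (hAr : ∀ i ∈ s, #(A i) ≤ r) (hGr : ∀ G ∈ 𝒢, #G ≤ r)
    (hB : ∀ e : E, #{G ∈ 𝒢 | e ∈ G ∧ G ⊆ H} ≤ B)
    (hbad : ∀ i ∈ t, ∃ G ∈ 𝒢, G ⊆ H ∧ ¬ Disjoint (A i) G) :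
    ∃ t' ⊆ {x ∈ s ×ˢ 𝒢 | ¬ Disjoint (A x.1) x.2},
      IsPacking (fun x : ι × Finset E => A x.1 ∪ x.2) t' H ∧ #t ≤ #t' * (2 * r) * (1 + B * r) := by
  classical
  have hex : ∀ i, ∃ G, i ∈ t → G ∈ 𝒢 ∧ G ⊆ H ∧ ¬ Disjoint (A i) G := by
    intro i
    by_cases hi : i ∈ t
    · obtain ⟨G, hG⟩ := hbad i hi
      exact ⟨G, fun _ => hG⟩
    · exact ⟨∅, fun h => absurd h hi⟩
  choose G hG using hex
  set C : ι → Finset E := fun i => A i ∪ G i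
  -- By maximality every cluster `C i` meets one of the at most `#t' * 2 r` elements covered by
  -- `t'`, so it remains to bound how many clusters contain a given element.
  obtain ⟨t', ht't, ht', hmax⟩ := exists_isPacking_maximal t C H
    fun i hi => (hA i (hts hi)).mono subset_union_left
  have hcard : #(t'.image fun i => (i, G i)) = #t' :=
    card_image_of_injective _ fun i j h => (Prod.ext_iff.1 h).1
  refine ⟨t'.image fun i => (i, G i), ?_, ⟨?_, ?_⟩, ?_⟩
  · intro x hx
    obtain ⟨i, hi, rfl⟩ := mem_image.1 hx
    exact mem_filter.2 ⟨mem_product.2 ⟨hts (ht't hi), (hG i (ht't hi)).1⟩, (hG i (ht't hi)).2.2⟩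
  · intro x hx y hy hxy
    obtain ⟨i, hi, rfl⟩ := mem_image.1 (mem_coe.1 hx)
    obtain ⟨j, hj, rfl⟩ := mem_image.1 (mem_coe.1 hy)
    exact ht'.1 hi hj fun h => hxy (by rw [h])
  · intro x hx
    obtain ⟨i, hi, rfl⟩ := mem_image.1 hx
    exact ht'.2 i hi
  · rw [hcard]
    have hsub : t ⊆ (t'.biUnion C).biUnion fun f => {i ∈ t | f ∈ C i} := by
      intro i hi
      obtain ⟨f, hf, hf'⟩ := not_disjoint_iff.1
        (hmax i hi (union_subset (ht.2 i hi) (hG i hi).2.1))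
      exact mem_biUnion.2 ⟨f, hf', mem_filter.2 ⟨hi, hf⟩⟩
    -- At most one disjoint `A i` contains `f`. Otherwise `f` lies in the chosen `G i`, which is one
    -- of at most `B` present sets, each meeting at most `r` of the disjoint `A i`.
    have hf : ∀ f, #{i ∈ t | f ∈ C i} ≤ 1 + B * r := by
      intro f
      have hsub' : {i ∈ t | f ∈ C i} ⊆ {i ∈ t | ¬ Disjoint (A i) {f}} ∪
          ({G ∈ 𝒢 | f ∈ G ∧ G ⊆ H}).biUnion fun G' => {i ∈ t | ¬ Disjoint (A i) G'} := by
        intro i hi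
        obtain ⟨hit, hfi⟩ := mem_filter.1 hi
        rcases mem_union.1 hfi with hfi | hfi
        · exact mem_union_left _ (mem_filter.2 ⟨hit, by simpa using hfi⟩)
        · exact mem_union_right _ (mem_biUnion.2 ⟨G i,
            mem_filter.2 ⟨(hG i hit).1, hfi, (hG i hit).2.1⟩, mem_filter.2 ⟨hit, (hG i hit).2.2⟩⟩)
      refine (card_le_card hsub').trans ((card_union_le _ _).trans (add_le_add ?_ ?_))
      · simpa using card_filter_not_disjoint_le ht.1 {f}
      · refine (card_biUnion_le_card_mul _ _ r fun G' hG' => ?_).trans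
          (Nat.mul_le_mul_right r (hB f))
        exact (card_filter_not_disjoint_le ht.1 G').trans (hGr G' (mem_filter.1 hG').1)
    refine (card_le_card hsub).trans ((card_biUnion_le_card_mul _ _ _ fun f _ => hf f).trans ?_)
    refine Nat.mul_le_mul_right _ (card_biUnion_le_card_mul _ _ _ fun i hi => ?_)
    have hit := ht't hi
    refine (card_union_le _ _).trans ?_
    have := hAr i (hts hit)
    have := hGr _ (hG i hit).1
    omega

end RandomSubset

/-! ### Copies of a hypergraph and the expected number of their extensions. -/

namespace GreedyFree

open Finset RandomSubset

variable {V : Type*} {k n : ℕ}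

lemma powersetCard_map_injective {β γ : Type*} (k : ℕ) (φ : β ↪ γ) :
    Function.Injective (Set.powersetCard.map k φ) := by
  intro e e' h
  have := congrArg Subtype.val h
  simp only [Set.powersetCard.val_map, map_inj] at this
  exact Subtype.ext this

/-- The image of a set of hyperedges under an embedding of the vertices. -/
def copy (φ : V ↪ Fin n) (J : Finset (Set.powersetCard V k)) : Finset (Edge n k) :=
  J.map ⟨Set.powersetCard.map k φ, powersetCard_map_injective k φ⟩

/-- The vertices covered by a set of hyperedges. -/
def support {β : Type*} [DecidableEq β] (J : Finset (Set.powersetCard β k)) : Finset β :=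
  J.biUnion Subtype.val

lemma mem_copy {φ : V ↪ Fin n} {J : Finset (Set.powersetCard V k)} {f : Edge n k} :
    f ∈ copy φ J ↔ ∃ e ∈ J, Set.powersetCard.map k φ e = f := by
  simp [copy]

@[simp]
lemma card_copy (φ : V ↪ Fin n) (J : Finset (Set.powersetCard V k)) : #(copy φ J) = #J :=
  card_map _

lemma mem_support {β : Type*} [DecidableEq β] {J : Finset (Set.powersetCard β k)} {x : β} :
    x ∈ support J ↔ ∃ e ∈ J, x ∈ e.val := by
  simp [support]

lemma card_support_le {β : Type*} [DecidableEq β] (J : Finset (Set.powersetCard β k)) :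
    #(support J) ≤ #J * k :=
  card_biUnion_le_card_mul _ _ _ fun e _ => e.2.le

variable [Fintype V] [DecidableEq V]

/-- The copies in the complete hypergraph of the hypergraph with hyperedges `EF`. -/
noncomputable def copies (n : ℕ) (EF : Finset (Set.powersetCard V k)) :
    Finset (Finset (Edge n k)) :=
  (univ : Finset (V ↪ Fin n)).image fun ψ => copy ψ EF

omit [DecidableEq V] in
lemma card_of_mem_copies {EF : Finset (Set.powersetCard V k)} {G : Finset (Edge n k)}
    (hG : G ∈ copies n EF) : #G = #EF := by
  obtain ⟨ψ, -, rfl⟩ := mem_image.1 hG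
  exact card_copy ψ EF

lemma card_embedding_filter_le (X : Finset (Fin n)) (W : Finset V) :
    #{ψ : V ↪ Fin n | ∀ x ∈ W, ψ x ∈ X} ≤ #X ^ #W * n ^ (Fintype.card V - #W) := by
  have h : #{ψ : V ↪ Fin n | ∀ x ∈ W, ψ x ∈ X} ≤
      #(Fintype.piFinset fun x : V => if x ∈ W then X else univ) := by
    refine card_le_card_of_injOn (fun ψ => (ψ : V → Fin n)) ?_ DFunLike.coe_injective.injOn
    intro ψ hψ
    simp only [coe_filter, mem_univ, true_and, Set.mem_ofPred_eq] at hψ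
    rw [mem_coe, Fintype.mem_piFinset]
    intro x
    split_ifs with hx
    · exact hψ x hx
    · exact mem_univ _
  refine h.trans (le_of_eq ?_)
  rw [Fintype.card_piFinset]
  have : ∀ x : V, #(if x ∈ W then X else univ) = if x ∈ W then #X else n := by
    intro x
    split_ifs <;> simp
  simp only [this]
  rw [prod_ite]
  simp only [prod_const]
  congr 2
  · simp
  · rw [filter_not, card_sdiff]
    simp [card_univ]

lemma sum_image_filter_le {β γ : Type*} [DecidableEq γ] (s : Finset β) (f : β → γ) (P : γ → Prop)
    [DecidablePred P] (g : γ → ℝ) (hg : ∀ c, 0 ≤ g c) :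
    ∑ c ∈ s.image f with P c, g c ≤ ∑ b ∈ s with P (f b), g (f b) := by
  rw [filter_image, ← biUnion_singleton]
  refine (sum_biUnion_le_sum_sum _ _ _ hg).trans ?_
  simp

/-- The expected number of copies that extend a given set `Y` of hyperedges. -/
lemma sum_copies_filter_le (EF : Finset (Set.powersetCard V k)) {p β : ℝ} (hp0 : 0 ≤ p)
    (hβ0 : 0 ≤ β) (Y : Finset (Edge n k)) (j c : ℕ) (hc : 1 ≤ c) (hY : #Y * k ≤ c)
    (hβ : ∀ J ⊆ EF, j ≤ #J → #J < #EF →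
      (n : ℝ) ^ (Fintype.card V - #(support J)) * p ^ (#EF - #J) ≤ β) :
    ∑ G ∈ copies n EF with j ≤ #(G ∩ Y) ∧ #(G ∩ Y) < #EF, p ^ #(G \ Y) ≤
      2 ^ #EF * (c : ℝ) ^ Fintype.card V * β := by
  -- Embeddings are classified by the set `I` of hyperedges they send into `Y`. The vertices of `I`
  -- then have at most `c` images each and the others at most `n`; there are at most `2 ^ #EF`
  -- patterns.
  set J : (V ↪ Fin n) → Finset (Set.powersetCard V k) :=
    fun ψ => EF.filter fun e => Set.powersetCard.map k ψ e ∈ Y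
  have hJ : ∀ ψ, copy ψ EF ∩ Y = copy ψ (J ψ) := by
    intro ψ
    ext f
    simp only [mem_inter, mem_copy, J, mem_filter]
    constructor
    · rintro ⟨⟨e, he, rfl⟩, hf⟩
      exact ⟨e, ⟨he, hf⟩, rfl⟩
    · rintro ⟨e, ⟨he, hf⟩, rfl⟩
      exact ⟨⟨e, he, rfl⟩, hf⟩
  have hJc : ∀ ψ, #(copy ψ EF ∩ Y) = #(J ψ) := fun ψ => by rw [hJ, card_copy]
  have hJd : ∀ ψ, #(copy ψ EF \ Y) = #EF - #(J ψ) := fun ψ => by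
    rw [card_sdiff, inter_comm, hJc, card_copy]
  set 𝒥 := EF.powerset.filter fun I => j ≤ #I ∧ #I < #EF
  have hcover : (univ.filter fun ψ : V ↪ Fin n => j ≤ #(J ψ) ∧ #(J ψ) < #EF) ⊆
      𝒥.biUnion fun I => univ.filter fun ψ : V ↪ Fin n => J ψ = I := by
    intro ψ hψ
    simp only [mem_filter, mem_univ, true_and] at hψ
    exact mem_biUnion.2 ⟨J ψ, mem_filter.2 ⟨mem_powerset.2 (filter_subset _ _), hψ⟩,
      mem_filter.2 ⟨mem_univ _, rfl⟩⟩
  have hcount : ∀ I, #{ψ : V ↪ Fin n | J ψ = I} ≤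
      c ^ Fintype.card V * n ^ (Fintype.card V - #(support I)) := by
    intro I
    calc #{ψ : V ↪ Fin n | J ψ = I}
        ≤ #{ψ : V ↪ Fin n | ∀ x ∈ support I, ψ x ∈ support Y} := by
          refine card_le_card fun ψ hψ => ?_
          simp only [mem_filter, mem_univ, true_and] at hψ ⊢
          intro x hx
          obtain ⟨e, he, hxe⟩ := mem_support.1 hx
          rw [← hψ] at he
          refine mem_support.2 ⟨_, (mem_filter.1 he).2, ?_⟩
          rw [Set.powersetCard.val_map]
          exact mem_map_of_mem _ hxe
      _ ≤ #(support Y) ^ #(support I) * n ^ (Fintype.card V - #(support I)) :=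
          card_embedding_filter_le _ _
      _ ≤ c ^ Fintype.card V * n ^ (Fintype.card V - #(support I)) := by
          refine Nat.mul_le_mul_right _ ?_
          calc #(support Y) ^ #(support I) ≤ c ^ #(support I) := by
                gcongr
                exact (card_support_le Y).trans hY
            _ ≤ c ^ Fintype.card V := pow_le_pow_right₀ hc (card_le_univ _)
  calc ∑ G ∈ copies n EF with j ≤ #(G ∩ Y) ∧ #(G ∩ Y) < #EF, p ^ #(G \ Y)
      ≤ ∑ ψ : V ↪ Fin n with j ≤ #(J ψ) ∧ #(J ψ) < #EF, p ^ (#EF - #(J ψ)) := by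
        refine (sum_image_filter_le _ _ _ _ fun G => pow_nonneg hp0 _).trans (le_of_eq ?_)
        simp only [hJc, hJd]
    _ ≤ ∑ I ∈ 𝒥, ∑ ψ : V ↪ Fin n with J ψ = I, p ^ (#EF - #(J ψ)) :=
        (sum_le_sum_of_subset_of_nonneg hcover fun ψ _ _ => pow_nonneg hp0 _).trans
          (sum_biUnion_le_sum_sum _ _ _ fun ψ => pow_nonneg hp0 _)
    _ ≤ ∑ I ∈ 𝒥, (c : ℝ) ^ Fintype.card V * β := by
        refine sum_le_sum fun I hI => ?_
        obtain ⟨hI1, hI2, hI3⟩ := mem_filter.1 hI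
        calc ∑ ψ : V ↪ Fin n with J ψ = I, p ^ (#EF - #(J ψ))
            = #{ψ : V ↪ Fin n | J ψ = I} * p ^ (#EF - #I) := by
              rw [← nsmul_eq_mul, ← sum_const]
              refine sum_congr rfl fun ψ hψ => ?_
              rw [(mem_filter.1 hψ).2]
          _ ≤ (c ^ Fintype.card V * n ^ (Fintype.card V - #(support I)) : ℕ) * p ^ (#EF - #I) := by
              gcongr
              exact hcount I
          _ = (c : ℝ) ^ Fintype.card V *
              ((n : ℝ) ^ (Fintype.card V - #(support I)) * p ^ (#EF - #I)) := by
              push_cast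
              ring
          _ ≤ _ := by
              gcongr
              exact hβ I (mem_powerset.1 hI1) hI2 hI3
    _ = #𝒥 * ((c : ℝ) ^ Fintype.card V * β) := by rw [sum_const, nsmul_eq_mul]
    _ ≤ 2 ^ #EF * (c : ℝ) ^ Fintype.card V * β := by
        rw [mul_assoc]
        gcongr
        have := card_filter_le EF.powerset fun I => j ≤ #I ∧ #I < #EF
        rw [card_powerset] at this
        exact_mod_cast this

end GreedyFree

/-! ### Few copies through a hyperedge. -/

namespace GreedyFree

open Finset RandomSubset

variable {V : Type*} {k n : ℕ} [Fintype V] [DecidableEq V]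

lemma card_edge_le (n k : ℕ) : Fintype.card (Edge n k) ≤ n ^ k := by
  have h := Set.powersetCard.card (Fin n) k
  rw [Nat.card_eq_fintype_card, Nat.card_eq_fintype_card, Fintype.card_fin] at h
  rw [h]
  exact Nat.choose_le_pow n k

lemma card_filter_card_lt_le {E : Type*} [Fintype E] (h N : ℕ) (hN : Fintype.card E ≤ N) :
    #{J : Finset E | #J < h} ≤ h * (N + 1) ^ h := by
  classical
  have hsub : ({J : Finset E | #J < h} : Finset (Finset E)) ⊆
      (range h).biUnion fun j => powersetCard j univ := by
    intro J hJ
    simp only [mem_filter, mem_univ, true_and] at hJ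
    exact mem_biUnion.2 ⟨#J, mem_range.2 hJ, mem_powersetCard.2 ⟨subset_univ _, rfl⟩⟩
  refine (card_le_card hsub).trans ?_
  have := card_biUnion_le_card_mul (range h) (fun j => powersetCard j (univ : Finset E))
    ((N + 1) ^ h) ?_
  · simpa using this
  · intro j hj
    rw [card_powersetCard, card_univ]
    calc (Fintype.card E).choose j ≤ Fintype.card E ^ j := Nat.choose_le_pow _ _
      _ ≤ (N + 1) ^ j := by gcongr; omega
      _ ≤ (N + 1) ^ h := pow_le_pow_right₀ (by omega) (mem_range.1 hj).le

/-- For copies containing `J` the intersection with `J` is `J` itself, so the general estimate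
applies with `Y = J` and `j = #J`. -/
lemma sum_copies_superset_le (EF : Finset (Set.powersetCard V k)) {p β : ℝ} (hp0 : 0 ≤ p)
    (hβ0 : 0 ≤ β) (hk : 1 ≤ k) (J : Finset (Edge n k)) (hJ : #J < #EF)
    (hβ : ∀ I ⊆ EF, #J ≤ #I → #I < #EF →
      (n : ℝ) ^ (Fintype.card V - #(support I)) * p ^ (#EF - #I) ≤ β) :
    ∑ G ∈ copies n EF with J ⊆ G, p ^ #(G \ J) ≤
      2 ^ #EF * ((#EF * k : ℕ) : ℝ) ^ Fintype.card V * β := by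
  have h1 : 1 ≤ #EF * k := Nat.mul_pos (by omega) hk
  refine le_trans (sum_le_sum_of_subset_of_nonneg ?_ fun _ _ _ => pow_nonneg hp0 _)
    (sum_copies_filter_le EF hp0 hβ0 J #J (#EF * k) h1 (Nat.mul_le_mul_right k hJ.le) hβ)
  intro G hG
  rw [mem_filter] at hG ⊢
  rw [inter_eq_right.2 hG.2]
  exact ⟨hG.1, le_rfl, hJ⟩

/-- With high probability no hyperedge is contained in many copies. -/
lemma prob_edge_in_many_copies_le (EF : Finset (Set.powersetCard V k)) {p β₁ β₂ z₁ z₂ : ℝ}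
    (hp0 : 0 ≤ p) (hp1 : p ≤ 1) (hβ₁0 : 0 ≤ β₁) (hβ₂0 : 0 ≤ β₂) (hz₁ : 0 < z₁) (hz₂ : 0 < z₂)
    (hk : 1 ≤ k) (hEF : 2 ≤ #EF) (m₁ m₂ : ℕ)
    (hβ₁ : ∀ I ⊆ EF, 1 ≤ #I → #I < #EF →
      (n : ℝ) ^ (Fintype.card V - #(support I)) * p ^ (#EF - #I) ≤ β₁)
    (hβ₂ : ∀ I ⊆ EF, 2 ≤ #I → #I < #EF →
      (n : ℝ) ^ (Fintype.card V - #(support I)) * p ^ (#EF - #I) ≤ β₂) :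
    prob p (fun H : Finset (Edge n k) => ¬ ∀ e : Edge n k,
        #{G ∈ copies n EF | e ∈ G ∧ G ⊆ H} ≤ m₁ * #EF * (m₂ * #EF) ^ (#EF - 2)) ≤
      #EF * ((n : ℝ) ^ k + 1) ^ #EF *
        (Real.exp (z₂ * (2 ^ #EF * ((#EF * k : ℕ) : ℝ) ^ Fintype.card V * β₂)) / z₂ ^ m₂) +
      (n : ℝ) ^ k *
        (Real.exp (z₁ * (2 ^ #EF * ((#EF * k : ℕ) : ℝ) ^ Fintype.card V * β₁)) / z₁ ^ m₁) := by
  set 𝒢 := copies n EF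
  set Q : ℕ → Finset (Edge n k) → Finset (Edge n k) → Prop := fun m J H =>
    ∃ t ⊆ {G ∈ 𝒢 | J ⊆ G}, #t = m ∧ IsPacking (· \ J) t H
  have hQ : ∀ (m : ℕ) (J : Finset (Edge n k)) (z β : ℝ), 0 < z → 0 ≤ β → #J < #EF →
      (∀ I ⊆ EF, #J ≤ #I → #I < #EF →
        (n : ℝ) ^ (Fintype.card V - #(support I)) * p ^ (#EF - #I) ≤ β) →
      prob p (Q m J) ≤
        Real.exp (z * (2 ^ #EF * ((#EF * k : ℕ) : ℝ) ^ Fintype.card V * β)) / z ^ m := by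
    intro m J z β hz hβ0 hJ hβ
    refine (prob_exists_isPacking_le hp0 hp1 {G ∈ 𝒢 | J ⊆ G} (· \ J) m hz).trans ?_
    gcongr
    exact sum_copies_superset_le EF hp0 hβ0 hk J hJ hβ
  -- Single hyperedges are treated apart from larger `J`: the expected number of extensions is of a
  -- different order, so the packing sizes `m₁` and `m₂` are chosen differently.
  have hsub : ∀ H : Finset (Edge n k), (¬ ∀ e : Edge n k,
      #{G ∈ 𝒢 | e ∈ G ∧ G ⊆ H} ≤ m₁ * #EF * (m₂ * #EF) ^ (#EF - 2)) →
      (∃ J ∈ ({J | 2 ≤ #J ∧ #J < #EF} : Finset (Finset (Edge n k))), Q m₂ J H) ∨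
        ∃ e ∈ (univ : Finset (Edge n k)), Q m₁ {e} H := by
    intro H hH
    by_contra hno
    push Not at hno
    refine hH (card_filter_mem_le 𝒢 H m₂ m₁ #EF hEF (fun G hG => card_of_mem_copies hG) ?_ ?_)
    · exact fun J hJ2 hJ => hno.1 J (by simp [hJ2, hJ])
    · exact fun e => hno.2 e (mem_univ e)
  refine (prob_mono hp0 hp1 hsub).trans ((prob_or_le hp0 hp1 _ _).trans (add_le_add ?_ ?_))
  · refine (prob_exists_le hp0 hp1 _ _).trans ?_
    refine (sum_le_card_nsmul _ _ (Real.exp (z₂ * (2 ^ #EF *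
      ((#EF * k : ℕ) : ℝ) ^ Fintype.card V * β₂)) / z₂ ^ m₂) fun J hJ => ?_).trans ?_
    · simp only [mem_filter, mem_univ, true_and] at hJ
      exact hQ m₂ J z₂ β₂ hz₂ hβ₂0 hJ.2 fun I hI hIJ hI' => hβ₂ I hI (hJ.1.trans hIJ) hI'
    · rw [nsmul_eq_mul]
      refine mul_le_mul_of_nonneg_right ?_ (by positivity)
      have h1 : #({J | 2 ≤ #J ∧ #J < #EF} : Finset (Finset (Edge n k))) ≤
          #({J | #J < #EF} : Finset (Finset (Edge n k))) :=
        card_le_card fun J hJ => by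
          simp only [mem_filter, mem_univ, true_and] at hJ ⊢
          exact hJ.2
      have h2 := h1.trans (card_filter_card_lt_le (E := Edge n k) #EF (n ^ k) (card_edge_le n k))
      exact_mod_cast h2
  · refine (prob_exists_le hp0 hp1 _ _).trans ?_
    refine (sum_le_card_nsmul _ _ (Real.exp (z₁ * (2 ^ #EF *
      ((#EF * k : ℕ) : ℝ) ^ Fintype.card V * β₁)) / z₁ ^ m₁) fun e _ => ?_).trans ?_
    · refine hQ m₁ {e} z₁ β₁ hz₁ hβ₁0 (by simp; omega) ?_
      simpa using hβ₁
    · rw [nsmul_eq_mul]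
      refine mul_le_mul_of_nonneg_right ?_ (by positivity)
      rw [card_univ]
      exact_mod_cast card_edge_le n k

end GreedyFree

/-! ### Partite copies: first moments, overlaps and clusters. -/

namespace GreedyFree

open Finset RandomSubset

variable {V : Type*} {k n : ℕ} [Fintype V]

/-- The embeddings that map each vertex `x` into `A x`. -/
noncomputable def partite (A : V → Finset (Fin n)) : Finset (V ↪ Fin n) :=
  {φ | ∀ x, φ x ∈ A x}

lemma mem_partite {A : V → Finset (Fin n)} {φ : V ↪ Fin n} : φ ∈ partite A ↔ ∀ x, φ x ∈ A x := by
  simp [partite]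

/-- Because the classes are disjoint, an image vertex determines its preimage. Hence two partite
copies can share a hyperedge only as the image of the same hyperedge under embeddings agreeing on
it. -/
lemma partite_map_eq {A : V → Finset (Fin n)} (hA : Pairwise fun x y => Disjoint (A x) (A y))
    {φ ψ : V ↪ Fin n} (hφ : φ ∈ partite A) (hψ : ψ ∈ partite A) {e e' : Set.powersetCard V k}
    (h : Set.powersetCard.map k φ e = Set.powersetCard.map k ψ e') :
    e = e' ∧ ∀ x ∈ e.val, φ x = ψ x := by
  rw [mem_partite] at hφ hψ
  have h' : e.val.map φ = e'.val.map ψ := congrArg Subtype.val h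
  have key : ∀ x ∈ e.val, x ∈ e'.val ∧ φ x = ψ x := by
    intro x hx
    have hx' : φ x ∈ e'.val.map ψ := h' ▸ mem_map_of_mem φ hx
    obtain ⟨y, hy, hxy⟩ := mem_map.1 hx'
    have : x = y := by
      by_contra hne
      exact disjoint_left.1 (hA hne) (hφ x) (hxy ▸ hψ y)
    subst this
    exact ⟨hy, hxy.symm⟩
  exact ⟨Set.powersetCard.eq_iff_subset.2 fun x hx => (key x hx).1, fun x hx => (key x hx).2⟩

variable [DecidableEq V]

lemma prod_card_le_card_partite {A : V → Finset (Fin n)}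
    (hA : Pairwise fun x y => Disjoint (A x) (A y)) : ∏ x, #(A x) ≤ #(partite A) := by
  rw [← Fintype.card_piFinset]
  have hsub : Fintype.piFinset A ⊆ (partite A).image fun φ : V ↪ Fin n => (φ : V → Fin n) := by
    intro f hf
    rw [Fintype.mem_piFinset] at hf
    refine mem_image.2 ⟨⟨f, fun x y hxy => ?_⟩, mem_partite.2 hf, rfl⟩
    by_contra hne
    exact disjoint_left.1 (hA hne) (hf x) (hxy ▸ hf y)
  exact (card_le_card hsub).trans card_image_le

lemma card_partite_agree_le (A : V → Finset (Fin n)) (φ : V ↪ Fin n) (W : Finset V) :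
    #{ψ ∈ partite A | ∀ x ∈ W, ψ x = φ x} ≤ ∏ x ∈ Wᶜ, #(A x) := by
  have h : #{ψ ∈ partite A | ∀ x ∈ W, ψ x = φ x} ≤
      #(Fintype.piFinset fun x : V => if x ∈ W then {φ x} else A x) := by
    refine card_le_card_of_injOn (fun ψ => (ψ : V → Fin n)) ?_ DFunLike.coe_injective.injOn
    intro ψ hψ
    rw [mem_coe, mem_filter, mem_partite] at hψ
    rw [mem_coe, Fintype.mem_piFinset]
    intro x
    split_ifs with hx
    · exact mem_singleton.2 (hψ.2 x hx)
    · exact hψ.1 x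
  refine h.trans (le_of_eq ?_)
  rw [Fintype.card_piFinset, ← prod_mul_prod_compl W, prod_congr rfl fun x hx => by rw [if_pos hx]]
  simp only [card_singleton, prod_const_one, one_mul]
  exact prod_congr rfl fun x hx => by rw [if_neg (mem_compl.1 hx)]

lemma card_partite {A : V → Finset (Fin n)} (hA : Pairwise fun x y => Disjoint (A x) (A y)) :
    #(partite A) = ∏ x, #(A x) := by
  refine le_antisymm ?_ (prod_card_le_card_partite hA)
  rcases (partite A).eq_empty_or_nonempty with h | ⟨φ, -⟩
  · simp [h]
  · simpa using card_partite_agree_le A φ ∅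

/-- The contribution of one copy to the overlap term in Janson's inequality. If `J` is the set of
shared hyperedges, the embeddings agree on `support J`, and also on `U₀`, whose classes have at most
one element. Different embeddings therefore leave some vertex uncovered, and only such `J` occur. -/
lemma sum_partite_overlap_le {A : V → Finset (Fin n)}
    (hA : Pairwise fun x y => Disjoint (A x) (A y)) (S : Finset (Set.powersetCard V k))
    (U₀ : Finset V) (hU₀ : ∀ x ∈ U₀, #(A x) ≤ 1) {p a : ℝ} (hp0 : 0 ≤ p) (ha0 : 0 ≤ a)
    (ha : ∀ J ⊆ S, J.Nonempty → U₀ ∪ support J ≠ univ →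
      (∏ x ∈ (U₀ ∪ support J)ᶜ, (#(A x) : ℝ)) * p ^ (#S - #J) ≤ a)
    {φ : V ↪ Fin n} (hφ : φ ∈ partite A) :
    ∑ ψ ∈ partite A with ψ ≠ φ ∧ ¬ Disjoint (copy φ S) (copy ψ S),
      p ^ #(copy φ S ∪ copy ψ S) ≤ p ^ #S * (2 ^ #S * a) := by
  set J : (V ↪ Fin n) → Finset (Set.powersetCard V k) := fun ψ =>
    S.filter fun e => Set.powersetCard.map k φ e = Set.powersetCard.map k ψ e
  have hJ : ∀ ψ ∈ partite A, copy φ S ∩ copy ψ S = copy φ (J ψ) := by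
    intro ψ hψ
    ext f
    simp only [mem_inter, mem_copy, J, mem_filter]
    constructor
    · rintro ⟨⟨e, he, rfl⟩, e', he', h⟩
      obtain ⟨rfl, -⟩ := partite_map_eq hA hψ hφ h
      exact ⟨_, ⟨he, h.symm⟩, rfl⟩
    · rintro ⟨e, ⟨he, h⟩, rfl⟩
      exact ⟨⟨e, he, rfl⟩, e, he, h.symm⟩
  have hcard : ∀ ψ ∈ partite A, #(copy φ S ∪ copy ψ S) = #S + (#S - #(J ψ)) := by
    intro ψ hψ
    have h1 := card_union_add_card_inter (copy φ S) (copy ψ S)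
    rw [hJ ψ hψ] at h1
    simp only [card_copy] at h1
    have h2 : #(J ψ) ≤ #S := card_filter_le _ _
    omega
  have hagree : ∀ ψ ∈ partite A, ∀ x ∈ U₀ ∪ support (J ψ), ψ x = φ x := by
    intro ψ hψ x hx
    rcases mem_union.1 hx with hx | hx
    · exact card_le_one.1 (hU₀ x hx) _ (mem_partite.1 hψ x) _ (mem_partite.1 hφ x)
    · obtain ⟨e, he, hxe⟩ := mem_support.1 hx
      exact ((partite_map_eq hA hφ hψ (mem_filter.1 he).2).2 x hxe).symm
  set 𝒥 := S.powerset.filter fun I => I.Nonempty ∧ U₀ ∪ support I ≠ univ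
  have hcover : {ψ ∈ partite A | ψ ≠ φ ∧ ¬ Disjoint (copy φ S) (copy ψ S)} ⊆
      𝒥.biUnion fun I => {ψ ∈ partite A | J ψ = I} := by
    intro ψ hψ
    obtain ⟨hψA, hne, hd⟩ := mem_filter.1 hψ
    refine mem_biUnion.2 ⟨J ψ, mem_filter.2 ⟨mem_powerset.2 (filter_subset _ _), ?_, ?_⟩,
      mem_filter.2 ⟨hψA, rfl⟩⟩
    · rw [disjoint_iff_inter_eq_empty, hJ ψ hψA] at hd
      rw [nonempty_iff_ne_empty]
      intro h
      rw [h] at hd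
      exact hd rfl
    · intro h
      refine hne (DFunLike.ext _ _ fun x => hagree ψ hψA x ?_)
      rw [h]
      exact mem_univ x
  have hterm : ∀ I ∈ 𝒥, ∑ ψ ∈ partite A with J ψ = I, p ^ #(copy φ S ∪ copy ψ S) ≤
      p ^ #S * a := by
    intro I hI
    obtain ⟨hIS, hIne, hIu⟩ := mem_filter.1 hI
    calc ∑ ψ ∈ partite A with J ψ = I, p ^ #(copy φ S ∪ copy ψ S)
        = #{ψ ∈ partite A | J ψ = I} * (p ^ #S * p ^ (#S - #I)) := by
          rw [← nsmul_eq_mul, ← sum_const]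
          refine sum_congr rfl fun ψ hψ => ?_
          obtain ⟨hψA, hψI⟩ := mem_filter.1 hψ
          rw [hcard ψ hψA, hψI, pow_add]
      _ ≤ (∏ x ∈ (U₀ ∪ support I)ᶜ, #(A x) : ℕ) * (p ^ #S * p ^ (#S - #I)) := by
          gcongr
          refine le_trans (card_le_card ?_) (card_partite_agree_le A φ _)
          intro ψ hψ
          obtain ⟨hψA, hψI⟩ := mem_filter.1 hψ
          exact mem_filter.2 ⟨hψA, hψI ▸ hagree ψ hψA⟩
      _ = p ^ #S * ((∏ x ∈ (U₀ ∪ support I)ᶜ, (#(A x) : ℝ)) * p ^ (#S - #I)) := by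
          push_cast
          ring
      _ ≤ p ^ #S * a := by
          gcongr
          exact ha I (mem_powerset.1 hIS) hIne hIu
  calc ∑ ψ ∈ partite A with ψ ≠ φ ∧ ¬ Disjoint (copy φ S) (copy ψ S), p ^ #(copy φ S ∪ copy ψ S)
      ≤ ∑ I ∈ 𝒥, ∑ ψ ∈ partite A with J ψ = I, p ^ #(copy φ S ∪ copy ψ S) :=
        (sum_le_sum_of_subset_of_nonneg hcover fun ψ _ _ => pow_nonneg hp0 _).trans
          (sum_biUnion_le_sum_sum _ _ _ fun ψ => pow_nonneg hp0 _)
    _ ≤ #𝒥 * (p ^ #S * a) := by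
        rw [← nsmul_eq_mul]
        exact sum_le_card_nsmul _ _ _ hterm
    _ ≤ 2 ^ #S * (p ^ #S * a) := by
        gcongr
        have := card_filter_le S.powerset fun I => I.Nonempty ∧ U₀ ∪ support I ≠ univ
        rw [card_powerset] at this
        exact_mod_cast this
    _ = p ^ #S * (2 ^ #S * a) := by ring

/-- Once the hyperedge of `S` mapped to `f` is chosen, only the vertices outside it and `U₀` are
free. This bounds the expected number of members lost per hyperedge of a packing. -/
lemma sum_partite_mem_copy_le {A : V → Finset (Fin n)}
    (hA : Pairwise fun x y => Disjoint (A x) (A y)) (S : Finset (Set.powersetCard V k))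
    (U₀ : Finset V) (hU₀ : ∀ x ∈ U₀, #(A x) ≤ 1) {p : ℝ} (hp0 : 0 ≤ p)
    (ha : ∀ e ∈ S, (∏ x ∈ (U₀ ∪ e.val)ᶜ, (#(A x) : ℝ)) * p ^ (#S - 1) ≤ 1) (f : Edge n k) :
    ∑ φ ∈ partite A with f ∈ copy φ S, p ^ #(copy φ S) ≤ #S * p := by
  have hcover : {φ ∈ partite A | f ∈ copy φ S} ⊆
      S.biUnion fun e => {φ ∈ partite A | Set.powersetCard.map k φ e = f} := by
    intro φ hφ
    obtain ⟨hφA, hf⟩ := mem_filter.1 hφ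
    obtain ⟨e, he, hef⟩ := mem_copy.1 hf
    exact mem_biUnion.2 ⟨e, he, mem_filter.2 ⟨hφA, hef⟩⟩
  have hterm : ∀ e ∈ S, ∑ φ ∈ partite A with Set.powersetCard.map k φ e = f,
      p ^ #(copy φ S) ≤ p := by
    intro e he
    simp only [card_copy]
    rw [sum_const, nsmul_eq_mul]
    rcases Finset.eq_empty_or_nonempty {φ ∈ partite A | Set.powersetCard.map k φ e = f}
      with h | ⟨φ, hφ⟩
    · rw [h]
      simpa using hp0
    · obtain ⟨hφA, hφf⟩ := mem_filter.1 hφ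
      have hS : #S = (#S - 1) + 1 := by
        have := card_pos.2 ⟨e, he⟩
        omega
      calc (#{φ ∈ partite A | Set.powersetCard.map k φ e = f} : ℝ) * p ^ #S
          ≤ (∏ x ∈ (U₀ ∪ e.val)ᶜ, #(A x) : ℕ) * p ^ #S := by
            gcongr
            refine le_trans (card_le_card ?_) (card_partite_agree_le A φ _)
            intro ψ hψ
            obtain ⟨hψA, hψf⟩ := mem_filter.1 hψ
            refine mem_filter.2 ⟨hψA, fun x hx => ?_⟩
            rcases mem_union.1 hx with hx | hx
            · exact card_le_one.1 (hU₀ x hx) _ (mem_partite.1 hψA x) _ (mem_partite.1 hφA x)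
            · exact (partite_map_eq hA hψA hφA (hψf.trans hφf.symm)).2 x hx
        _ = (∏ x ∈ (U₀ ∪ e.val)ᶜ, (#(A x) : ℝ)) * p ^ (#S - 1) * p := by
            rw [mul_assoc, ← pow_succ, ← hS]
            push_cast
            rfl
        _ ≤ 1 * p := by
            gcongr
            exact ha e he
        _ = p := one_mul p
  calc ∑ φ ∈ partite A with f ∈ copy φ S, p ^ #(copy φ S)
      ≤ ∑ e ∈ S, ∑ φ ∈ partite A with Set.powersetCard.map k φ e = f, p ^ #(copy φ S) :=
        (sum_le_sum_of_subset_of_nonneg hcover fun ψ _ _ => pow_nonneg hp0 _).trans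
          (sum_biUnion_le_sum_sum _ _ _ fun ψ => pow_nonneg hp0 _)
    _ ≤ #S • p := sum_le_card_nsmul _ _ _ hterm
    _ = #S * p := nsmul_eq_mul _ _

/-- With very high probability there are many pairwise disjoint copies of `S` that respect a given
partition. -/
lemma prob_not_exists_packing_partite_le {A : V → Finset (Fin n)}
    (hA : Pairwise fun x y => Disjoint (A x) (A y)) (S : Finset (Set.powersetCard V k))
    (hS : S.Nonempty) (U₀ : Finset V) (hU₀ : ∀ x ∈ U₀, #(A x) ≤ 1) {p a lam : ℝ} (hp0 : 0 ≤ p)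
    (hp1 : p ≤ 1) (ha0 : 0 ≤ a)
    (ha : ∀ J ⊆ S, J.Nonempty → U₀ ∪ support J ≠ univ →
      (∏ x ∈ (U₀ ∪ support J)ᶜ, (#(A x) : ℝ)) * p ^ (#S - #J) ≤ a)
    (ha' : 2 ^ #S * a ≤ 1 / 8) (hp : (#S : ℝ) ^ 2 * p ≤ 2)
    (hlam : (#(partite A) : ℝ) * p ^ #S = lam) (m : ℕ) (hm : (m : ℝ) ≤ lam / 16) :
    prob p (fun H => ¬ ∃ t ⊆ partite A, #t = m ∧ IsPacking (copy · S) t H) ≤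
      Real.exp (-(lam / 4)) := by
  have ha1 : a ≤ 1 := by
    have : (1 : ℝ) ≤ 2 ^ #S := one_le_pow₀ (by norm_num)
    nlinarith
  refine prob_not_exists_isPacking_le hp0 hp1 (partite A) (copy · S) m #S (η := #S * p) ?_ ?_ ?_ ?_
    ?_ ?_ hm ?_
  · simp only [card_copy, sum_const, nsmul_eq_mul]
    exact hlam
  · intro φ _
    rw [← card_pos, card_copy]
    exact card_pos.2 hS
  · intro φ _
    exact (card_copy φ S).le
  · positivity
  · refine sum_partite_mem_copy_le hA S U₀ hU₀ hp0 fun e he => ?_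
    by_cases h : U₀ ∪ e.val = univ
    · rw [h]
      simpa using pow_le_one₀ hp0 hp1
    · have := ha {e} (singleton_subset_iff.2 he) (singleton_nonempty e)
      simp only [support, singleton_biUnion, card_singleton] at this
      exact (this h).trans ha1
  · refine (sum_le_sum fun φ hφ => sum_partite_overlap_le hA S U₀ hU₀ hp0 ha0 ha hφ).trans ?_
    rw [sum_const, nsmul_eq_mul, ← mul_assoc, hlam]
    have : 0 ≤ lam := by rw [← hlam]; positivity
    nlinarith
  · have h1 : 0 ≤ lam := by rw [← hlam]; positivity
    calc (m : ℝ) * #S * (#S * p) = m * ((#S : ℝ) ^ 2 * p) := by ring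
      _ ≤ lam / 16 * 2 := by gcongr
      _ = lam / 8 := by ring

/-- With very high probability there are few pairwise disjoint unions of a copy of `S` and a copy
of `EF` that meets it. -/
lemma prob_exists_packing_union_le (A : V → Finset (Fin n)) (EF S : Finset (Set.powersetCard V k))
    (hS : #S < #EF) (hk : 1 ≤ k) {p β z lam : ℝ} (hp0 : 0 ≤ p) (hp1 : p ≤ 1) (hβ0 : 0 ≤ β)
    (hz : 0 < z)
    (hβ : ∀ I ⊆ EF, 1 ≤ #I → #I < #EF →
      (n : ℝ) ^ (Fintype.card V - #(support I)) * p ^ (#EF - #I) ≤ β)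
    (hlam : (#(partite A) : ℝ) * p ^ #S = lam) (m : ℕ) :
    prob p (fun H => ∃ t ⊆ {x ∈ partite A ×ˢ copies n EF | ¬ Disjoint (copy x.1 S) x.2},
        #t = m ∧ IsPacking (fun x => copy x.1 S ∪ x.2) t H) ≤
      Real.exp (z * (lam * (2 ^ #EF * ((#EF * k : ℕ) : ℝ) ^ Fintype.card V * β))) / z ^ m := by
  refine (prob_exists_isPacking_le hp0 hp1 _ _ m hz).trans ?_
  gcongr
  have h1 : 1 ≤ #EF * k := Nat.mul_pos (by omega) hk
  rw [sum_filter, sum_product, ← hlam, mul_assoc, ← nsmul_eq_mul]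
  refine sum_le_card_nsmul _ _ _ fun φ _ => ?_
  rw [← sum_filter]
  refine le_trans (le_of_eq ?_) (mul_le_mul_of_nonneg_left
    (sum_copies_filter_le EF hp0 hβ0 (copy φ S) 1 (#EF * k) h1 ?_ hβ) (pow_nonneg hp0 #S))
  · rw [mul_sum]
    refine sum_congr ?_ fun G _ => ?_
    · refine filter_congr fun G hG => ?_
      -- As `S` has fewer hyperedges than `EF`, a copy of `EF` cannot lie inside `copy φ S`, so
      -- every cluster needs at least one new hyperedge.
      have h2 : #(G ∩ copy φ S) < #EF :=
        (card_le_card inter_subset_right).trans_lt (by rwa [card_copy])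
      rw [disjoint_iff_inter_eq_empty, inter_comm, ← ne_eq, ← nonempty_iff_ne_empty,
        ← card_pos]
      simp only [h2, and_true]
      exact Iff.rfl
    · rw [← pow_add, union_comm, ← card_copy φ S, add_comm, ← card_sdiff_add_card]
  · rw [card_copy]
    exact Nat.mul_le_mul_right k hS.le

end GreedyFree

/-! ### Good copies for all pairs `(U, T)`. -/

namespace GreedyFree

open Finset RandomSubset

variable {V : Type*} {k n : ℕ}

lemma exists_disjoint_subsets {β : Type*} [DecidableEq β] [DecidableEq V] (I : Finset V)
    (X : Finset β) (q : ℕ) (h : #I * q ≤ #X) :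
    ∃ B : V → Finset β, (∀ x ∈ I, B x ⊆ X ∧ #(B x) = q) ∧
      (I : Set V).PairwiseDisjoint B := by
  induction I using Finset.induction_on generalizing X with
  | empty => exact ⟨fun _ => ∅, by simp, by simp⟩
  | insert i I hi ih =>
    rw [card_insert_of_notMem hi, add_mul, one_mul] at h
    obtain ⟨Y, hYX, hY⟩ := exists_subset_card_eq (show q ≤ #X by omega)
    obtain ⟨B, hB, hBd⟩ := ih (X \ Y) (by rw [card_sdiff_of_subset hYX, hY]; omega)
    have hne : ∀ x ∈ I, x ≠ i := fun x hx h => hi (h ▸ hx)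
    refine ⟨Function.update B i Y, ?_, ?_⟩
    · intro x hx
      rcases mem_insert.1 hx with rfl | hx
      · simp [hYX, hY]
      · rw [Function.update_of_ne (hne x hx)]
        exact ⟨(hB x hx).1.trans sdiff_subset, (hB x hx).2⟩
    · rw [coe_insert, Set.pairwiseDisjoint_insert_of_notMem (by simpa using hi)]
      constructor
      · intro x hx y hy hxy
        simp only [Function.onFun]
        rw [Function.update_of_ne (hne x hx), Function.update_of_ne (hne y hy)]
        exact hBd hx hy hxy
      · intro x hx
        rw [Function.update_self, Function.update_of_ne (hne x hx)]
        exact disjoint_of_subset_right (hB x hx).1 disjoint_sdiff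

variable [Fintype V] [DecidableEq V]

/-- A partition of a part of `Fin n` that is adapted to `U` and `T`. -/
lemma exists_partition (U₀ D : Finset V) (hD : Disjoint U₀ D) (U T : Finset (Fin n))
    (hU : #U = #U₀) (hUT : Disjoint U T) (q₁ q₂ : ℕ) (hq₁ : Fintype.card V * q₁ ≤ #T)
    (hq₂ : Fintype.card V * q₂ + #U + #T ≤ n) :
    ∃ A : V → Finset (Fin n), (Pairwise fun x y => Disjoint (A x) (A y)) ∧
      (∀ x ∈ U₀, A x ⊆ U ∧ #(A x) = 1) ∧ (∀ x ∈ D, A x ⊆ T ∧ #(A x) = q₁) ∧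
      ∀ x ∈ (U₀ ∪ D)ᶜ, #(A x) = q₂ := by
  obtain ⟨A₀, hA₀, hd₀⟩ := exists_disjoint_subsets U₀ U 1 (by omega)
  obtain ⟨A₁, hA₁, hd₁⟩ := exists_disjoint_subsets D T q₁
    ((Nat.mul_le_mul_right q₁ (card_le_univ D)).trans hq₁)
  obtain ⟨A₂, hA₂, hd₂⟩ := exists_disjoint_subsets (U₀ ∪ D)ᶜ (U ∪ T)ᶜ q₂ (by
    refine (Nat.mul_le_mul_right q₂ (card_le_univ _)).trans ?_
    rw [card_compl, card_union_of_disjoint hUT, Fintype.card_fin]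
    omega)
  have hDU : ∀ x ∈ D, x ∉ U₀ := fun x hx hx' => disjoint_left.1 hD hx' hx
  set A : V → Finset (Fin n) := fun x => if x ∈ U₀ then A₀ x else if x ∈ D then A₁ x else A₂ x
  have e₀ : ∀ x ∈ U₀, A x = A₀ x := fun x hx => if_pos hx
  have e₁ : ∀ x ∈ D, A x = A₁ x := fun x hx => by simp [A, hDU x hx, hx]
  have e₂ : ∀ x ∈ (U₀ ∪ D)ᶜ, A x = A₂ x := fun x hx => by
    simp only [mem_compl, mem_union, not_or] at hx
    simp [A, hx.1, hx.2]
  have hcase : ∀ x, x ∈ U₀ ∨ x ∈ D ∨ x ∈ (U₀ ∪ D)ᶜ := fun x => by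
    simp only [mem_compl, mem_union]
    tauto
  have h₀₁ : ∀ x ∈ U₀, ∀ y ∈ D, Disjoint (A x) (A y) := fun x hx y hy => by
    rw [e₀ x hx, e₁ y hy]
    exact disjoint_of_subset_left (hA₀ x hx).1 (disjoint_of_subset_right (hA₁ y hy).1 hUT)
  have h₀₂ : ∀ x ∈ U₀, ∀ y ∈ (U₀ ∪ D)ᶜ, Disjoint (A x) (A y) := fun x hx y hy => by
    rw [e₀ x hx, e₂ y hy]
    refine disjoint_of_subset_left ((hA₀ x hx).1.trans subset_union_left)
      (disjoint_of_subset_right (hA₂ y hy).1 disjoint_compl_right)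
  have h₁₂ : ∀ x ∈ D, ∀ y ∈ (U₀ ∪ D)ᶜ, Disjoint (A x) (A y) := fun x hx y hy => by
    rw [e₁ x hx, e₂ y hy]
    refine disjoint_of_subset_left ((hA₁ x hx).1.trans subset_union_right)
      (disjoint_of_subset_right (hA₂ y hy).1 disjoint_compl_right)
  refine ⟨A, ?_, ?_, ?_, ?_⟩
  · intro x y hxy
    rcases hcase x with hx | hx | hx <;> rcases hcase y with hy | hy | hy
    · rw [e₀ x hx, e₀ y hy]
      exact hd₀ hx hy hxy
    · exact h₀₁ x hx y hy
    · exact h₀₂ x hx y hy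
    · exact (h₀₁ y hy x hx).symm
    · rw [e₁ x hx, e₁ y hy]
      exact hd₁ hx hy hxy
    · exact h₁₂ x hx y hy
    · exact (h₀₂ y hy x hx).symm
    · exact (h₁₂ y hy x hx).symm
    · rw [e₂ x hx, e₂ y hy]
      exact hd₂ (mem_coe.2 hx) (mem_coe.2 hy) hxy
  · exact fun x hx => e₀ x hx ▸ hA₀ x hx
  · exact fun x hx => e₁ x hx ▸ hA₁ x hx
  · exact fun x hx => e₂ x hx ▸ (hA₂ x hx).2

/-- `φ` maps `U₀` onto `U` and `D` into `T`, and the hyperedges of the copy of `S` under `φ` are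
in `H`, but not in a copy of `EF` in `H`. -/
def IsGoodCopy (EF S : Finset (Set.powersetCard V k)) (U₀ D : Finset V) (U T : Finset (Fin n))
    (H : Finset (Edge n k)) (φ : V ↪ Fin n) : Prop :=
  U₀.map φ = U ∧ (∀ x ∈ D, φ x ∈ T) ∧ copy φ S ⊆ H ∧
    ∀ G ∈ copies n EF, G ⊆ H → Disjoint (copy φ S) G

/-- Two unlikely events cover the failure: there is no packing of `m` partite copies of `S`, or
there is a packing of `m'` clusters. If `m` disjoint copies are all bad, the bound `B` on copies
through a hyperedge extracts `m'` disjoint clusters. The event defining `B` stays inside the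
probability, so that its own failure is not paid for each pair. -/
lemma prob_not_exists_isGoodCopy_le (EF S : Finset (Set.powersetCard V k)) (hS : S.Nonempty)
    (hSEF : #S < #EF) (hk : 1 ≤ k) (U₀ D : Finset V) (hD : Disjoint U₀ D) (q₁ q₂ : ℕ)
    {p a β z lam : ℝ} (hp0 : 0 ≤ p) (hp1 : p ≤ 1) (ha0 : 0 ≤ a) (hβ0 : 0 ≤ β) (hz : 0 < z)
    (U T : Finset (Fin n)) (hU : #U = #U₀) (hUT : Disjoint U T)
    (hq₁ : Fintype.card V * q₁ ≤ #T) (hq₂ : Fintype.card V * q₂ + #U + #T ≤ n)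
    (ha : ∀ J ⊆ S, J.Nonempty → U₀ ∪ support J ≠ univ →
      (#T : ℝ) ^ #(D \ support J) * (n : ℝ) ^ #(U₀ ∪ D ∪ support J)ᶜ * p ^ (#S - #J) ≤ a)
    (ha' : 2 ^ #S * a ≤ 1 / 8) (hp : (#S : ℝ) ^ 2 * p ≤ 2)
    (hβ : ∀ I ⊆ EF, 1 ≤ #I → #I < #EF →
      (n : ℝ) ^ (Fintype.card V - #(support I)) * p ^ (#EF - #I) ≤ β)
    (hlam : (q₁ : ℝ) ^ #D * (q₂ : ℝ) ^ #(U₀ ∪ D)ᶜ * p ^ #S = lam) (B m m' : ℕ)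
    (hm : (m : ℝ) ≤ lam / 16) (hm' : m' * (2 * #EF) * (1 + B * #EF) ≤ m) :
    prob p (fun H => (∀ e : Edge n k, #{G ∈ copies n EF | e ∈ G ∧ G ⊆ H} ≤ B) ∧
        ¬ ∃ φ, IsGoodCopy EF S U₀ D U T H φ) ≤
      Real.exp (-(lam / 4)) +
        Real.exp (z * (lam * (2 ^ #EF * ((#EF * k : ℕ) : ℝ) ^ Fintype.card V * β))) / z ^ m' := by
  obtain ⟨A, hA, hAU, hAD, hAR⟩ := exists_partition U₀ D hD U T hU hUT q₁ q₂ hq₁ hq₂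
  have hcardA : (#(partite A) : ℝ) * p ^ #S = lam := by
    rw [card_partite hA, ← hlam]
    congr 1
    rw [← prod_mul_prod_compl (U₀ ∪ D), prod_union hD, prod_congr rfl fun x hx => (hAU x hx).2,
      prod_congr rfl fun x hx => (hAD x hx).2, prod_congr rfl hAR]
    simp
  have hprod : ∀ J : Finset (Set.powersetCard V k),
      ∏ x ∈ (U₀ ∪ support J)ᶜ, (#(A x) : ℝ) ≤
        (#T : ℝ) ^ #(D \ support J) * (n : ℝ) ^ #(U₀ ∪ D ∪ support J)ᶜ := by
    intro J
    have hsplit : (U₀ ∪ support J)ᶜ = (D \ support J) ∪ (U₀ ∪ D ∪ support J)ᶜ := by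
      ext x
      have := fun hx : x ∈ D => fun hx' : x ∈ U₀ => disjoint_left.1 hD hx' hx
      simp only [mem_compl, mem_union, mem_sdiff]
      tauto
    have hdisj : Disjoint (D \ support J) (U₀ ∪ D ∪ support J)ᶜ := by
      rw [disjoint_left]
      intro x hx
      simp only [mem_compl, mem_union, mem_sdiff] at hx ⊢
      tauto
    rw [hsplit, prod_union hdisj, ← prod_const, ← prod_const]
    refine mul_le_mul (prod_le_prod (fun _ _ => Nat.cast_nonneg _) fun x hx => ?_)
      (prod_le_prod (fun _ _ => Nat.cast_nonneg _) fun x _ => ?_)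
      (prod_nonneg fun _ _ => Nat.cast_nonneg _) (prod_nonneg fun _ _ => Nat.cast_nonneg _)
    · exact Nat.cast_le.2 (card_le_card (hAD x (mem_sdiff.1 hx).1).1)
    · exact Nat.cast_le.2 ((card_le_univ (A x)).trans_eq (Fintype.card_fin n))
  refine (prob_mono hp0 hp1 ?_).trans ((prob_or_le hp0 hp1 _ _).trans (add_le_add
    (prob_not_exists_packing_partite_le hA S hS U₀ (fun x hx => (hAU x hx).2.le) hp0 hp1 ha0
      (fun J hJ hJne hJu => (mul_le_mul_of_nonneg_right (hprod J) (pow_nonneg hp0 _)).trans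
        (ha J hJ hJne hJu)) ha' hp hcardA m hm)
    (prob_exists_packing_union_le A EF S hSEF hk hp0 hp1 hβ0 hz hβ hcardA m')))
  rintro H ⟨hB, hno⟩
  by_contra hcon
  push Not at hcon
  obtain ⟨⟨t, htA, htm, ht⟩, hunion⟩ := hcon
  have hbad : ∀ φ ∈ t, ∃ G ∈ copies n EF, G ⊆ H ∧ ¬ Disjoint (copy φ S) G := by
    intro φ hφ
    by_contra hgood
    push Not at hgood
    have hφA := mem_partite.1 (htA hφ)
    refine hno ⟨φ, ?_, fun x hx => (hAD x hx).1 (hφA x), ht.2 φ hφ, hgood⟩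
    refine eq_of_subset_of_card_le ?_ (by rw [card_map, hU])
    intro y hy
    obtain ⟨x, hx, rfl⟩ := mem_map.1 hy
    exact (hAU x hx).1 (hφA x)
  obtain ⟨t', ht's, ht', hcard⟩ := exists_isPacking_union (partite A) (copy · S) (copies n EF) H t
    htA ht #EF B (fun φ _ => by rw [← card_pos, card_copy]; exact card_pos.2 hS)
    (fun φ _ => by rw [card_copy]; exact hSEF.le) (fun G hG => (card_of_mem_copies hG).le) hB hbad
  have hm't' : m' ≤ #t' := by
    have hpos : 0 < 2 * #EF * (1 + B * #EF) := by
      have : 0 < #EF := by omega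
      positivity
    refine Nat.le_of_mul_le_mul_right ?_ hpos
    simp only [mul_assoc] at hm' hcard ⊢
    omega
  obtain ⟨t'', ht'', hcard''⟩ := exists_subset_card_eq hm't'
  exact hunion t'' (ht''.trans ht's) hcard'' (ht'.mono ht'')

/-- The union bound over pairs. The failure of the bound `B` is added only once, since it is merely
polynomially unlikely and could not absorb the factor `n ^ τ`. -/
lemma prob_not_forall_isGoodCopy_le (EF S : Finset (Set.powersetCard V k)) (hS : S.Nonempty)
    (hSEF : #S < #EF) (hk : 1 ≤ k) (U₀ D : Finset V) (hD : Disjoint U₀ D) (τ q₁ q₂ : ℕ)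
    {p a β z lam : ℝ} (hp0 : 0 ≤ p) (hp1 : p ≤ 1) (ha0 : 0 ≤ a) (hβ0 : 0 ≤ β) (hz : 0 < z)
    (hq₁ : Fintype.card V * q₁ ≤ τ) (hq₂ : Fintype.card V * q₂ + #U₀ + τ ≤ n)
    (ha : ∀ J ⊆ S, J.Nonempty → U₀ ∪ support J ≠ univ →
      (τ : ℝ) ^ #(D \ support J) * (n : ℝ) ^ #(U₀ ∪ D ∪ support J)ᶜ * p ^ (#S - #J) ≤ a)
    (ha' : 2 ^ #S * a ≤ 1 / 8) (hp : (#S : ℝ) ^ 2 * p ≤ 2)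
    (hβ : ∀ I ⊆ EF, 1 ≤ #I → #I < #EF →
      (n : ℝ) ^ (Fintype.card V - #(support I)) * p ^ (#EF - #I) ≤ β)
    (hlam : (q₁ : ℝ) ^ #D * (q₂ : ℝ) ^ #(U₀ ∪ D)ᶜ * p ^ #S = lam) (B m m' : ℕ)
    (hm : (m : ℝ) ≤ lam / 16) (hm' : m' * (2 * #EF) * (1 + B * #EF) ≤ m) :
    prob p (fun H => ¬ ∀ U T : Finset (Fin n), #U = #U₀ → #T = τ → Disjoint U T →
        ∃ φ, IsGoodCopy EF S U₀ D U T H φ) ≤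
      prob p (fun H => ¬ ∀ e : Edge n k, #{G ∈ copies n EF | e ∈ G ∧ G ⊆ H} ≤ B) +
      (n : ℝ) ^ #U₀ * (n : ℝ) ^ τ * (Real.exp (-(lam / 4)) +
        Real.exp (z * (lam * (2 ^ #EF * ((#EF * k : ℕ) : ℝ) ^ Fintype.card V * β))) / z ^ m') := by
  set pairs := (powersetCard #U₀ (univ : Finset (Fin n)) ×ˢ
    powersetCard τ (univ : Finset (Fin n))).filter fun x => Disjoint x.1 x.2
  set Q : Finset (Edge n k) → Prop :=
    fun H => ∀ e : Edge n k, #{G ∈ copies n EF | e ∈ G ∧ G ⊆ H} ≤ B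
  have hsub : ∀ H : Finset (Edge n k), (¬ ∀ U T : Finset (Fin n), #U = #U₀ → #T = τ →
      Disjoint U T → ∃ φ, IsGoodCopy EF S U₀ D U T H φ) →
      ¬ Q H ∨ ∃ x ∈ pairs, Q H ∧ ¬ ∃ φ, IsGoodCopy EF S U₀ D x.1 x.2 H φ := by
    intro H hH
    by_cases hQ : Q H
    · right
      push Not at hH
      obtain ⟨U, T, hU, hT, hUT, hno⟩ := hH
      refine ⟨(U, T), mem_filter.2 ⟨mem_product.2 ⟨?_, ?_⟩, hUT⟩, hQ, ?_⟩
      · exact mem_powersetCard.2 ⟨subset_univ _, hU⟩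
      · exact mem_powersetCard.2 ⟨subset_univ _, hT⟩
      · rintro ⟨φ, hφ⟩
        exact hno φ hφ
    · exact Or.inl hQ
  refine (prob_mono hp0 hp1 hsub).trans ((prob_or_le hp0 hp1 _ _).trans
    (add_le_add_right ((prob_exists_le hp0 hp1 _ _).trans ?_) _))
  refine (sum_le_card_nsmul pairs _ (Real.exp (-(lam / 4)) + Real.exp (z * (lam * (2 ^ #EF *
    ((#EF * k : ℕ) : ℝ) ^ Fintype.card V * β))) / z ^ m') fun x hx => ?_).trans ?_
  · obtain ⟨hx1, hx2⟩ := mem_filter.1 hx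
    obtain ⟨hxU, hxT⟩ := mem_product.1 hx1
    replace hxU := (mem_powersetCard.1 hxU).2
    replace hxT := (mem_powersetCard.1 hxT).2
    exact prob_not_exists_isGoodCopy_le EF S hS hSEF hk U₀ D hD q₁ q₂ hp0 hp1 ha0 hβ0 hz x.1 x.2
      hxU hx2 (by omega) (by omega) (by rw [hxT]; exact ha) ha' hp hβ hlam B m m' hm hm'
  · rw [nsmul_eq_mul]
    refine mul_le_mul_of_nonneg_right ?_ (by positivity)
    have h1 : #pairs ≤ n ^ #U₀ * n ^ τ := by
      refine (card_filter_le _ _).trans ?_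
      rw [card_product, card_powersetCard, card_powersetCard, card_univ, Fintype.card_fin]
      exact Nat.mul_le_mul (Nat.choose_le_pow _ _) (Nat.choose_le_pow _ _)
    exact_mod_cast h1

end GreedyFree

/-! ### Explicit failure probabilities of order `1 / n`. -/

namespace GreedyFree

open Finset RandomSubset

variable {V : Type*} {k n : ℕ} [Fintype V] [DecidableEq V]

/-- The constant factor in the bound on the number of copies that extend a given set. -/
noncomputable def extConst (h k v : ℕ) : ℝ := 2 ^ h * ((h * k : ℕ) : ℝ) ^ v

/-- A bound, up to a factor `log n`, on the number of overlaps of clusters. -/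
def overlapConst (h k m : ℕ) : ℕ := 2 * h * (1 + (k + 2) * h * (m * h) ^ (h - 2) * h)

/-- With at least two hyperedges fixed, the expected number of extensions is `O(n ^ (-δ))`. Packings
of constant size `m₂` are therefore rare enough, with weight `z₂ = n ^ (δ / 2)`, to beat the roughly
`n ^ (k * #EF)` choices of `J`. With one hyperedge fixed the expectation is only bounded, so the
packing size is of order `log n`, with weight `e ^ 2`. -/
lemma prob_edge_in_many_copies_le_div (EF : Finset (Set.powersetCard V k)) {p β δ : ℝ}
    (hp0 : 0 ≤ p) (hp1 : p ≤ 1) (hβ0 : 0 ≤ β) (hn : 1 ≤ n)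
    (hk : 1 ≤ k) (hEF : 2 ≤ #EF) (m₂ : ℕ) (hm₂ : (k * #EF + 1 : ℝ) ≤ δ / 2 * m₂)
    (hδ : 0 < δ)
    (hβ : Real.exp 2 * (extConst #EF k (Fintype.card V) * β) ≤ 1)
    (hβ₁ : ∀ I ⊆ EF, 1 ≤ #I → #I < #EF →
      (n : ℝ) ^ (Fintype.card V - #(support I)) * p ^ (#EF - #I) ≤ β)
    (hβ₂ : ∀ I ⊆ EF, 2 ≤ #I → #I < #EF →
      (n : ℝ) ^ (Fintype.card V - #(support I)) * p ^ (#EF - #I) ≤ (n : ℝ) ^ (-δ)) :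
    prob p (fun H : Finset (Edge n k) => ¬ ∀ e : Edge n k,
        #{G ∈ copies n EF | e ∈ G ∧ G ⊆ H} ≤
          ⌈(k + 1) * Real.log n⌉₊ * #EF * (m₂ * #EF) ^ (#EF - 2)) ≤
      (#EF * 2 ^ #EF * Real.exp (extConst #EF k (Fintype.card V)) + Real.exp 1) / n := by
  have hn1 : (1 : ℝ) ≤ n := by exact_mod_cast hn
  have hn0 : (0 : ℝ) < n := by linarith
  set C := extConst #EF k (Fintype.card V) with hC
  have hC0 : 0 ≤ C := by unfold C extConst; positivity
  set z₂ : ℝ := (n : ℝ) ^ (δ / 2) with hz₂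
  have hz₂0 : 0 < z₂ := by positivity
  refine (prob_edge_in_many_copies_le EF hp0 hp1 hβ0 (by positivity) (Real.exp_pos 2) hz₂0 hk hEF
    ⌈(k + 1) * Real.log n⌉₊ m₂ hβ₁ hβ₂).trans ?_
  rw [add_div]
  change #EF * ((n : ℝ) ^ k + 1) ^ #EF * (Real.exp (z₂ * (C * (n : ℝ) ^ (-δ))) / z₂ ^ m₂) +
    (n : ℝ) ^ k * (Real.exp (Real.exp 2 * (C * β)) / Real.exp 2 ^ ⌈(k + 1) * Real.log n⌉₊) ≤ _
  refine add_le_add ?_ ?_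
  · have h1 : z₂ * (C * (n : ℝ) ^ (-δ)) ≤ C := by
      have : z₂ * (n : ℝ) ^ (-δ) ≤ 1 := by
        rw [hz₂, ← Real.rpow_add hn0]
        exact Real.rpow_le_one_of_one_le_of_nonpos hn1 (by linarith)
      calc z₂ * (C * (n : ℝ) ^ (-δ)) = C * (z₂ * (n : ℝ) ^ (-δ)) := by ring
        _ ≤ C * 1 := by gcongr
        _ = C := mul_one C
    have h2 : ((n : ℝ) ^ k + 1) ^ #EF ≤ 2 ^ #EF * (n : ℝ) ^ (k * #EF) := by
      rw [pow_mul, ← mul_pow]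
      have : (1 : ℝ) ≤ (n : ℝ) ^ k := one_le_pow₀ hn1
      gcongr
      linarith
    have h3 : (n : ℝ) ^ (k * #EF) * n ≤ z₂ ^ m₂ := by
      rw [hz₂, ← Real.rpow_natCast, ← Real.rpow_natCast, ← Real.rpow_mul hn0.le]
      nth_rewrite 2 [← Real.rpow_one (n : ℝ)]
      rw [← Real.rpow_add hn0]
      refine Real.rpow_le_rpow_of_exponent_le hn1 ?_
      push_cast
      exact hm₂
    rw [mul_div_assoc', div_le_div_iff₀ (by positivity) hn0]
    calc #EF * ((n : ℝ) ^ k + 1) ^ #EF * Real.exp (z₂ * (C * (n : ℝ) ^ (-δ))) * n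
        ≤ #EF * (2 ^ #EF * (n : ℝ) ^ (k * #EF)) * Real.exp C * n := by gcongr
      _ = #EF * 2 ^ #EF * Real.exp C * ((n : ℝ) ^ (k * #EF) * n) := by ring
      _ ≤ #EF * 2 ^ #EF * Real.exp C * z₂ ^ m₂ := by gcongr
  · have h1 : (n : ℝ) ^ k * n ≤ Real.exp 2 ^ ⌈(k + 1) * Real.log n⌉₊ := by
      rw [← pow_succ, ← Real.exp_nat_mul, ← Real.exp_log (pow_pos hn0 (k + 1)), Real.log_pow]
      refine Real.exp_le_exp.2 ?_
      have h2 := Nat.le_ceil ((k + 1) * Real.log n)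
      have h3 : 0 ≤ (k + 1) * Real.log n := mul_nonneg (by positivity) (Real.log_nonneg hn1)
      push_cast
      linarith
    rw [mul_div_assoc', div_le_div_iff₀ (by positivity) hn0]
    calc (n : ℝ) ^ k * Real.exp (Real.exp 2 * (C * β)) * n
        ≤ (n : ℝ) ^ k * Real.exp 1 * n := by gcongr
      _ = Real.exp 1 * ((n : ℝ) ^ k * n) := by ring
      _ ≤ _ := by gcongr

lemma prob_not_forall_isGoodCopy_le_div (EF S : Finset (Set.powersetCard V k)) (hS : S.Nonempty)
    (hSEF : #S < #EF) (hk : 1 ≤ k) (U₀ D : Finset V) (hD : Disjoint U₀ D) (τ q₁ q₂ : ℕ)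
    {p a β δ lam : ℝ} (hp0 : 0 ≤ p) (hp1 : p ≤ 1) (ha0 : 0 ≤ a) (hβ0 : 0 ≤ β)
    (hn : 1 ≤ n) (hL : 1 ≤ Real.log n) (m₂ : ℕ)
    (hm₂ : (k * #EF + 1 : ℝ) ≤ δ / 2 * m₂) (hδ : 0 < δ)
    (hβ : Real.exp 2 * (extConst #EF k (Fintype.card V) * β) ≤
      1 / (32 * overlapConst #EF k m₂ * Real.log n))
    (hβ₁ : ∀ I ⊆ EF, 1 ≤ #I → #I < #EF →
      (n : ℝ) ^ (Fintype.card V - #(support I)) * p ^ (#EF - #I) ≤ β)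
    (hβ₂ : ∀ I ⊆ EF, 2 ≤ #I → #I < #EF →
      (n : ℝ) ^ (Fintype.card V - #(support I)) * p ^ (#EF - #I) ≤ (n : ℝ) ^ (-δ))
    (hq₁ : Fintype.card V * q₁ ≤ τ) (hq₂ : Fintype.card V * q₂ + #U₀ + τ ≤ n)
    (ha : ∀ J ⊆ S, J.Nonempty → U₀ ∪ support J ≠ univ →
      (τ : ℝ) ^ #(D \ support J) * (n : ℝ) ^ #(U₀ ∪ D ∪ support J)ᶜ * p ^ (#S - #J) ≤ a)
    (ha' : 2 ^ #S * a ≤ 1 / 8) (hp : (#S : ℝ) ^ 2 * p ≤ 2)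
    (hlam : (q₁ : ℝ) ^ #D * (q₂ : ℝ) ^ #(U₀ ∪ D)ᶜ * p ^ #S = lam)
    (hlam' : 96 * overlapConst #EF k m₂ * τ * Real.log n ^ 2 ≤ lam)
    (hτ : #U₀ ≤ τ) (hτ1 : 1 ≤ τ) :
    prob p (fun H => ¬ ∀ U T : Finset (Fin n), #U = #U₀ → #T = τ → Disjoint U T →
        ∃ φ, IsGoodCopy EF S U₀ D U T H φ) ≤
      (#EF * 2 ^ #EF * Real.exp (extConst #EF k (Fintype.card V)) + Real.exp 1 + 2) / n := by
  have hS1 : 1 ≤ #S := card_pos.2 hS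
  set L := Real.log n
  set C := extConst #EF k (Fintype.card V)
  set B := ⌈(k + 1) * L⌉₊ * #EF * (m₂ * #EF) ^ (#EF - 2)
  set c₀ := overlapConst #EF k m₂
  set r := 2 * #EF * (1 + B * #EF)
  have hn1 : (1 : ℝ) ≤ n := by exact_mod_cast hn
  have hn0 : (0 : ℝ) < n := by linarith
  have hr0 : 0 < r := by
    have : 0 < #EF := by omega
    positivity
  have hc₀1 : (1 : ℝ) ≤ c₀ := by
    have : 1 ≤ c₀ := by
      have : 0 < #EF := by omega
      exact Nat.mul_pos (by positivity) (by positivity)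
    exact_mod_cast this
  have hτ1' : (1 : ℝ) ≤ τ := by exact_mod_cast hτ1
  have hL0 : 0 < L := by linarith
  have hrL : (r : ℝ) ≤ c₀ * L := by
    have h1 : (⌈(k + 1) * L⌉₊ : ℝ) ≤ (k + 2) * L := by
      have := Nat.ceil_lt_add_one (show 0 ≤ (k + 1) * L by positivity)
      linarith
    have h2 : (B : ℝ) ≤ (k + 2) * L * #EF * (m₂ * #EF) ^ (#EF - 2) := by
      simp only [B]
      push_cast
      gcongr
    calc (r : ℝ) = 2 * #EF * (1 + B * #EF) := by simp only [r]; push_cast; rfl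
      _ ≤ 2 * #EF * (L + (k + 2) * L * #EF * (m₂ * #EF) ^ (#EF - 2) * #EF) := by gcongr
      _ = c₀ * L := by simp only [c₀, overlapConst]; push_cast; ring
  have hlamL : 96 * c₀ * L ≤ lam := by
    refine le_trans ?_ hlam'
    calc 96 * c₀ * L = 96 * c₀ * 1 * (1 * L) := by ring
      _ ≤ 96 * c₀ * τ * (L * L) := by gcongr
      _ = 96 * c₀ * τ * L ^ 2 := by ring
  have hlam96 : 96 ≤ lam := by
    refine le_trans ?_ hlamL
    calc (96 : ℝ) = 96 * 1 * 1 := by norm_num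
      _ ≤ 96 * c₀ * L := by gcongr
  set m := ⌊lam / 16⌋₊
  set m' := m / r
  have hm : (m : ℝ) ≤ lam / 16 := Nat.floor_le (by linarith)
  have hm' : m' * (2 * #EF) * (1 + B * #EF) ≤ m := by
    rw [mul_assoc]
    exact Nat.div_mul_le_self m r
  -- The two roundings lose at most `c₀ * L` from `λ / 16`, which is at most `λ / 32` because `λ ≥
  -- 96 c₀ L`.
  have hm'lam : lam / (32 * c₀ * L) ≤ m' := by
    have h1 : lam / 16 < m + 1 := Nat.lt_floor_add_one _
    have h2 : m < (m' + 1) * r := by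
      rw [mul_comm]
      exact Nat.lt_mul_div_succ m hr0
    have h3 : (m : ℝ) + 1 ≤ (m' + 1) * r := by exact_mod_cast h2
    have h4 : ((m' : ℝ) + 1) * r ≤ (m' + 1) * (c₀ * L) := by gcongr
    rw [div_le_iff₀ (by positivity)]
    nlinarith
  have hstep : prob p (fun H => ¬ ∀ U T : Finset (Fin n), #U = #U₀ → #T = τ → Disjoint U T →
        ∃ φ, IsGoodCopy EF S U₀ D U T H φ) ≤
      prob p (fun H => ¬ ∀ e : Edge n k, #{G ∈ copies n EF | e ∈ G ∧ G ⊆ H} ≤ B) +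
      (n : ℝ) ^ #U₀ * (n : ℝ) ^ τ * (Real.exp (-(lam / 4)) +
        Real.exp (Real.exp 2 * (lam * (C * β))) / Real.exp 2 ^ m') :=
    prob_not_forall_isGoodCopy_le EF S hS hSEF hk U₀ D hD τ q₁ q₂ hp0 hp1 ha0 hβ0
      (Real.exp_pos 2) hq₁ hq₂ ha ha' hp hβ₁ hlam B m m' hm hm'
  refine hstep.trans ?_
  rw [add_div]
  have hβ' : Real.exp 2 * (C * β) ≤ 1 := by
    refine hβ.trans ?_
    rw [div_le_one (by positivity)]
    calc (1 : ℝ) ≤ 32 * 1 * 1 := by norm_num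
      _ ≤ 32 * c₀ * L := by gcongr
  refine add_le_add (prob_edge_in_many_copies_le_div EF hp0 hp1 hβ0 hn hk (by omega) m₂ hm₂ hδ hβ'
    hβ₁ hβ₂) ?_
  have hexp1 : Real.exp (-(lam / 4)) ≤ Real.exp (-(3 * τ * L)) := by
    refine Real.exp_le_exp.2 (neg_le_neg ?_)
    have : 96 * 1 * τ * (L * 1) ≤ 96 * c₀ * τ * (L * L) := by gcongr
    have : 0 ≤ τ * L := by positivity
    nlinarith
  -- The exponent is `e² λ C β - 2 m'`. Its first term is at most `m'` by the choice of `β`, and `m'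
  -- ≥ 3 τ L` by the lower bound on `λ`.
  have hexp2 : Real.exp (Real.exp 2 * (lam * (C * β))) / Real.exp 2 ^ m' ≤
      Real.exp (-(3 * τ * L)) := by
    rw [← Real.exp_nat_mul, ← Real.exp_sub]
    refine Real.exp_le_exp.2 ?_
    have h1 : Real.exp 2 * (lam * (C * β)) ≤ m' := by
      calc Real.exp 2 * (lam * (C * β)) = lam * (Real.exp 2 * (C * β)) := by ring
        _ ≤ lam * (1 / (32 * c₀ * L)) := by gcongr
        _ = lam / (32 * c₀ * L) := by ring
        _ ≤ m' := hm'lam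
    have h2 : 3 * τ * L ≤ m' := by
      refine le_trans ?_ hm'lam
      rw [le_div_iff₀ (by positivity)]
      linarith
    linarith
  have hpow : (n : ℝ) ^ #U₀ * (n : ℝ) ^ τ ≤ Real.exp (2 * τ * L) := by
    rw [← pow_add, ← Real.exp_log (pow_pos hn0 (#U₀ + τ)), Real.log_pow]
    refine Real.exp_le_exp.2 ?_
    have : ((#U₀ + τ : ℕ) : ℝ) ≤ 2 * τ := by
      have : #U₀ + τ ≤ 2 * τ := by omega
      exact_mod_cast this
    exact mul_le_mul_of_nonneg_right this hL0.le
  calc (n : ℝ) ^ #U₀ * (n : ℝ) ^ τ * (Real.exp (-(lam / 4)) +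
        Real.exp (Real.exp 2 * (lam * (C * β))) / Real.exp 2 ^ m')
      ≤ Real.exp (2 * τ * L) * (Real.exp (-(3 * τ * L)) + Real.exp (-(3 * τ * L))) := by gcongr
    _ = 2 * Real.exp (-(τ * L)) := by
        rw [← two_mul, mul_left_comm, ← Real.exp_add]
        congr 2
        ring
    _ ≤ 2 * Real.exp (-L) := by
        gcongr
        exact le_mul_of_one_le_left hL0.le hτ1'
    _ = 2 / n := by rw [Real.exp_neg, Real.exp_log hn0]; rfl

end GreedyFree

/-! ### Choice of `p` and of the constants. -/

namespace GreedyFree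

open Finset RandomSubset Filter

variable {V : Type*} {k n : ℕ} [Fintype V] [DecidableEq V]

lemma exists_pos_forall_le {ι : Type*} (s : Finset ι) (f : ι → ℝ) (hf : ∀ i ∈ s, 0 < f i) :
    ∃ δ : ℝ, 0 < δ ∧ ∀ i ∈ s, δ ≤ f i := by
  rcases s.eq_empty_or_nonempty with rfl | hs
  · exact ⟨1, one_pos, by simp⟩
  · obtain ⟨i, hi, hmin⟩ := exists_min_image s f hs
    exact ⟨f i, hf i hi, hmin⟩

lemma tendsto_log_pow_mul_rpow_neg (m : ℕ) {s : ℝ} (hs : 0 < s) :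
    Tendsto (fun n : ℕ => Real.log n ^ m * (n : ℝ) ^ (-s)) atTop (nhds 0) := by
  have h := (isLittleO_log_rpow_rpow_atTop (m : ℝ) hs).tendsto_div_nhds_zero
  refine (h.comp tendsto_natCast_atTop_atTop).congr fun n => ?_
  simp only [Function.comp, Real.rpow_natCast]
  rw [Real.rpow_neg (Nat.cast_nonneg n), div_eq_mul_inv]

/-- Rounding down costs at most a factor two. -/
lemma cast_div_le_cast_nat_div {m u w : ℕ} (hu : 0 < u) (hw : 2 * u ≤ w) (hm : 2 * u ≤ m) :
    (m : ℝ) / (w : ℕ) ≤ (m / u : ℕ) := by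
  have hq : m ≤ m / u * w := by
    have h1 : m < u * (m / u + 1) := Nat.lt_mul_div_succ m hu
    have h2 : m / u * (2 * u) ≤ m / u * w := Nat.mul_le_mul_left _ hw
    nlinarith
  exact div_le_of_le_mul₀ (Nat.cast_nonneg w) (Nat.cast_nonneg _) (by exact_mod_cast hq)

/-- The edge probability up to which the process is compared with a random hypergraph. -/
noncomputable def edgeProb (k v h : ℕ) (ε : ℝ) (n : ℕ) : ℝ :=
  ε * Real.log n ^ (-(1 / ((h : ℝ) - 1))) * (n : ℝ) ^ (-(((v : ℝ) - k) / ((h : ℝ) - 1)))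

section edgeProb

variable {v h d : ℕ} {ε : ℝ}

lemma edgeProb_pos (hε : 0 < ε) (hn : 1 ≤ n) (hL : 1 ≤ Real.log n) : 0 < edgeProb k v h ε n := by
  have hn0 : (0 : ℝ) < n := by exact_mod_cast hn
  have hL0 : 0 < Real.log n := by linarith
  unfold edgeProb
  positivity

lemma edgeProb_le (hh : 2 ≤ h) (hε1 : ε ≤ 1) (hL : 1 ≤ Real.log n) :
    edgeProb k v h ε n ≤ (n : ℝ) ^ (-(((v : ℝ) - k) / ((h : ℝ) - 1))) := by
  have hh' : (2 : ℝ) ≤ h := by exact_mod_cast hh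
  have h1 : Real.log n ^ (-(1 / ((h : ℝ) - 1))) ≤ 1 := by
    refine Real.rpow_le_one_of_one_le_of_nonpos hL ?_
    rw [neg_nonpos]
    have : (0 : ℝ) < h - 1 := by linarith
    positivity
  have h2 : 0 ≤ Real.log n ^ (-(1 / ((h : ℝ) - 1))) := Real.rpow_nonneg (by linarith) _
  unfold edgeProb
  refine mul_le_of_le_one_left (by positivity) ?_
  nlinarith

/-- This identity is what defines `edgeProb`: the expected number of copies through a fixed
hyperedge is, up to a constant factor, at most a small multiple of `1 / log n`. -/
lemma pow_mul_edgeProb_pow (hv : k ≤ v) (hh : 2 ≤ h) (hn : 1 ≤ n) (hL : 1 ≤ Real.log n) :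
    (n : ℝ) ^ (v - k) * edgeProb k v h ε n ^ (h - 1) = ε ^ (h - 1) / Real.log n := by
  have hn0 : (0 : ℝ) < n := by exact_mod_cast hn
  have hL0 : 0 < Real.log n := by linarith
  have hh' : (h : ℝ) - 1 = ((h - 1 : ℕ) : ℝ) := by push_cast [show 1 ≤ h by omega]; ring
  have hv' : (v : ℝ) - k = ((v - k : ℕ) : ℝ) := by push_cast [hv]; ring
  have hne : ((h - 1 : ℕ) : ℝ) ≠ 0 := by
    rw [Nat.cast_ne_zero]
    omega
  unfold edgeProb
  rw [mul_pow, mul_pow, hh', hv', ← Real.rpow_natCast (Real.log n ^ _), ← Real.rpow_mul hL0.le,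
    ← Real.rpow_natCast ((n : ℝ) ^ (-_)), ← Real.rpow_mul hn0.le]
  rw [neg_mul, neg_mul, one_div, inv_mul_cancel₀ hne, div_mul_cancel₀ _ hne, Real.rpow_neg_one,
    Real.rpow_neg hn0.le, Real.rpow_natCast]
  have : (n : ℝ) ^ (v - k) ≠ 0 := by positivity
  field_simp

lemma pow_mul_edgeProb_pow_le (hh : 2 ≤ h) (hε : 0 < ε) (hε1 : ε ≤ 1) (hn : 1 ≤ n)
    (hL : 1 ≤ Real.log n) {i j : ℕ} {δ : ℝ}
    (hij : δ ≤ ((v : ℝ) - k) / ((h : ℝ) - 1) * j - i) :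
    (n : ℝ) ^ i * edgeProb k v h ε n ^ j ≤ (n : ℝ) ^ (-δ) := by
  have hn1 : (1 : ℝ) ≤ n := by exact_mod_cast hn
  have hn0 : (0 : ℝ) < n := by linarith
  calc (n : ℝ) ^ i * edgeProb k v h ε n ^ j
      ≤ (n : ℝ) ^ i * ((n : ℝ) ^ (-(((v : ℝ) - k) / ((h : ℝ) - 1)))) ^ j := by
        have := (edgeProb_pos (k := k) (v := v) (h := h) hε hn hL).le
        gcongr
        exact edgeProb_le hh hε1 hL
    _ = (n : ℝ) ^ ((i : ℝ) + -(((v : ℝ) - k) / ((h : ℝ) - 1)) * j) := by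
        rw [Real.rpow_add hn0, Real.rpow_natCast, ← Real.rpow_natCast ((n : ℝ) ^ (-_)),
          ← Real.rpow_mul hn0.le]
    _ ≤ (n : ℝ) ^ (-δ) := Real.rpow_le_rpow_of_exponent_le hn1 (by linarith)

lemma bound_eq (κ : ℝ) (hn : 1 ≤ n) (hL : 1 ≤ Real.log n) :
    bound k v h d (κ * ε) n =
      κ * Real.log n ^ (3 / ((d : ℝ) - 1)) * (n * edgeProb k v h ε n) := by
  have hn0 : (0 : ℝ) < n := by exact_mod_cast hn
  have hL0 : 0 < Real.log n := by linarith
  unfold bound edgeProb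
  rw [sub_eq_add_neg, sub_eq_add_neg (3 / ((d : ℝ) - 1)), Real.rpow_add hn0, Real.rpow_add hL0,
    Real.rpow_one]
  ring

end edgeProb

/-- A lower bound on the expected number of copies of the hypergraph without a star. -/
lemma le_pow_mul_pow_mul_pow {τ n v d r s k h c₀ q₁ q₂ : ℕ} {p L κ ε t : ℝ}
    (hp0 : 0 ≤ p) (hL : 1 ≤ L) (hκ1 : 1 ≤ κ) (hε : 0 < ε) (hd : 2 ≤ d) (hv : 1 ≤ v)
    (hdr : d + r ≤ v) (hvk : v - k = (d - 1) + r) (hh : h - 1 = (d - 1) + s)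
    (ht : t = κ * L ^ (3 / ((d : ℝ) - 1)) * (n * p)) (ht0 : 0 ≤ t) (hτt : t ≤ τ)
    (hmain : (n : ℝ) ^ (v - k) * p ^ (h - 1) = ε ^ (h - 1) / L)
    (hκ : κ = 96 * c₀ * (4 * v) ^ v / ε ^ (h - 1))
    (hq₁ : (τ : ℝ) / (4 * v) ≤ q₁) (hq₂ : (n : ℝ) / (4 * v) ≤ q₂) :
    96 * c₀ * τ * L ^ 2 ≤ (q₁ : ℝ) ^ d * (q₂ : ℝ) ^ r * p ^ s := by
  have hL0 : 0 < L := by linarith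
  have hv1 : (1 : ℝ) ≤ v := by exact_mod_cast hv
  have hd1 : (1 : ℝ) ≤ (d : ℝ) - 1 := by
    have : (2 : ℝ) ≤ d := by exact_mod_cast hd
    linarith
  -- The exponent `3 / (d - 1)` turns into `L ^ 3` here. One factor `L` is then cancelled by
  -- `hmain`, leaving the required `L ^ 2`.
  have hτd : (κ * L ^ 3) * (n * p) ^ (d - 1) ≤ (τ : ℝ) ^ (d - 1) := by
    calc (κ * L ^ 3) * (n * p) ^ (d - 1)
        ≤ (κ ^ (d - 1) * (L ^ (3 / ((d : ℝ) - 1))) ^ (d - 1)) * (n * p) ^ (d - 1) := by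
          have h1 : (L ^ (3 / ((d : ℝ) - 1))) ^ (d - 1) = L ^ 3 := by
            rw [← Real.rpow_natCast, ← Real.rpow_mul hL0.le, ← Real.rpow_natCast L 3]
            congr 1
            push_cast [show 1 ≤ d by omega]
            field_simp
          rw [h1]
          gcongr
          exact le_self_pow₀ hκ1 (by omega)
      _ = t ^ (d - 1) := by rw [ht, mul_pow _ (n * p), mul_pow κ]
      _ ≤ (τ : ℝ) ^ (d - 1) := by gcongr
  have hv4 : (4 * (v : ℝ)) ^ (d + r) ≤ (4 * v) ^ v :=
    pow_le_pow_right₀ (by linarith) (by omega)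
  calc 96 * c₀ * τ * L ^ 2
      = τ * (κ * L ^ 3) * (ε ^ (h - 1) / L) / (4 * v) ^ v := by
        rw [hκ]
        have : (4 * (v : ℝ)) ^ v ≠ 0 := by positivity
        field_simp
    _ ≤ τ * (κ * L ^ 3) * (ε ^ (h - 1) / L) / (4 * v) ^ (d + r) := by gcongr
    _ = τ * ((κ * L ^ 3) * (n * p) ^ (d - 1)) * (n : ℝ) ^ r * p ^ s / (4 * v) ^ (d + r) := by
        rw [← hmain, hvk, hh]
        ring
    _ ≤ τ * (τ : ℝ) ^ (d - 1) * (n : ℝ) ^ r * p ^ s / (4 * v) ^ (d + r) := by gcongr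
    _ = (τ / (4 * v)) ^ d * ((n : ℝ) / (4 * v)) ^ r * p ^ s := by
        rw [← pow_succ', show d - 1 + 1 = d by omega, div_pow, div_pow, pow_add]
        field_simp
    _ ≤ (q₁ : ℝ) ^ d * (q₂ : ℝ) ^ r * p ^ s := by gcongr

-- The case of density below one. `hexp₁` makes extensions of two or more hyperedges polynomially
-- rare, and `hexp₂` does so for overlaps of copies of `S`. In the latter, `τ` is `n p` up to
-- logarithms, so a free vertex of `D` counts as a vertex together with a hyperedge.
set_option maxHeartbeats 400000 in
theorem exists_const_eventually_prob_le (EF S : Finset (Set.powersetCard V k)) (hS : S.Nonempty)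
    (U₀ D : Finset V) (hD : Disjoint U₀ D) (hSD : #S + #D = #EF) (hd : 2 ≤ #D) (hU₀ : #U₀ + 1 = k)
    (hkv : k + 1 ≤ Fintype.card V) (hvh : Fintype.card V + 1 < #EF + k)
    (hexp₁ : ∀ I ⊆ EF, 2 ≤ #I → #I < #EF →
      ((Fintype.card V - #(support I) : ℕ) : ℝ) <
        ((Fintype.card V : ℝ) - k) / ((#EF : ℝ) - 1) * (#EF - #I : ℕ))
    (hexp₂ : ∀ J ⊆ S, J.Nonempty → U₀ ∪ support J ≠ univ →
      ((#(D \ support J) + #(U₀ ∪ D ∪ support J)ᶜ : ℕ) : ℝ) <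
        ((Fintype.card V : ℝ) - k) / ((#EF : ℝ) - 1) * (#(D \ support J) + (#S - #J) : ℕ)) :
    ∃ c C : ℝ, ∀ᶠ n : ℕ in atTop, 0 < bound k (Fintype.card V) #EF #D c n ∧
      ∃ p : ℝ, 0 ≤ p ∧ p ≤ 1 ∧
        prob p (fun H : Finset (Edge n k) => ¬ ∀ U T : Finset (Fin n), #U = #U₀ →
          #T = ⌈bound k (Fintype.card V) #EF #D c n⌉₊ → Disjoint U T →
            ∃ φ, IsGoodCopy EF S U₀ D U T H φ) ≤ C / n := by
  set v := Fintype.card V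
  set h := #EF
  set d := #D
  set s := #S
  have hs1 : 1 ≤ s := card_pos.2 hS
  have hh : 2 ≤ h := by omega
  have hk : 1 ≤ k := by omega
  set a : ℝ := ((v : ℝ) - k) / ((h : ℝ) - 1) with ha_def
  have hvk : (1 : ℝ) ≤ (v : ℝ) - k := by
    have : (k : ℝ) + 1 ≤ v := by exact_mod_cast hkv
    linarith
  have hh1 : (v : ℝ) - k < (h : ℝ) - 1 := by
    have : (v : ℝ) + 1 < h + k := by exact_mod_cast hvh
    linarith
  have ha0 : 0 < a := div_pos (by linarith) (by linarith)
  have ha1 : a < 1 := (div_lt_one (by linarith)).2 hh1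
  obtain ⟨δ₁, hδ₁, hδ₁'⟩ := exists_pos_forall_le
    (EF.powerset.filter fun I => 2 ≤ #I ∧ #I < h)
    (fun I => a * (h - #I : ℕ) - (v - #(support I) : ℕ)) (by
      intro I hI
      obtain ⟨hI, hI2, hIh⟩ := mem_filter.1 hI
      exact sub_pos.2 (hexp₁ I (mem_powerset.1 hI) hI2 hIh))
  obtain ⟨δ₂, hδ₂, hδ₂'⟩ := exists_pos_forall_le
    (S.powerset.filter fun J => J.Nonempty ∧ U₀ ∪ support J ≠ univ)
    (fun J => a * (#(D \ support J) + (s - #J) : ℕ) -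
      (#(D \ support J) + #(U₀ ∪ D ∪ support J)ᶜ : ℕ)) (by
      intro J hJ
      obtain ⟨hJ, hJne, hJu⟩ := mem_filter.1 hJ
      exact sub_pos.2 (hexp₂ J (mem_powerset.1 hJ) hJne hJu))
  set δ := min δ₁ δ₂
  have hδ : 0 < δ := lt_min hδ₁ hδ₂
  obtain ⟨m₂, hm₂⟩ := exists_nat_ge ((k * h + 1 : ℝ) / (δ / 2))
  have hm₂' : (k * h + 1 : ℝ) ≤ δ / 2 * m₂ := by
    rw [div_le_iff₀ (by positivity)] at hm₂
    linarith
  set C := extConst h k v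
  set c₀ := overlapConst h k m₂
  have hC1 : 1 ≤ C := by
    have h1 : (1 : ℝ) ≤ (h * k : ℕ) := by exact_mod_cast Nat.mul_pos (by omega) hk
    exact one_le_mul_of_one_le_of_one_le (one_le_pow₀ (by norm_num)) (one_le_pow₀ h1)
  have hc₀1 : (1 : ℝ) ≤ c₀ := by
    have : 1 ≤ c₀ := Nat.mul_pos (by omega) (by positivity)
    exact_mod_cast this
  -- `ε` is chosen so that `e² C ε = 1 / (32 c₀)`, which bounds the expected number of clusters.
  -- Only then is `κ` chosen, large in terms of `ε`, to make `λ ≥ 96 c₀ τ L²`.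
  set ε : ℝ := 1 / (32 * Real.exp 2 * C * c₀) with hε_def
  have hε : 0 < ε := by positivity
  have hε1 : ε ≤ 1 := by
    rw [hε_def, div_le_one (by positivity)]
    calc (1 : ℝ) ≤ 32 * 1 * 1 * 1 := by norm_num
      _ ≤ 32 * Real.exp 2 * C * c₀ := by
        gcongr
        exact Real.one_le_exp (by norm_num)
  set κ : ℝ := 96 * c₀ * (4 * v) ^ v / ε ^ (h - 1) with hκ_def
  have hv1 : (1 : ℝ) ≤ v := by exact_mod_cast (show 1 ≤ v by omega)
  have hκ1 : 1 ≤ κ := by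
    rw [hκ_def, one_le_div (by positivity)]
    calc ε ^ (h - 1) ≤ 1 := pow_le_one₀ hε.le hε1
      _ ≤ 96 * 1 * 1 := by norm_num
      _ ≤ 96 * c₀ * (4 * v) ^ v := by
        gcongr
        exact one_le_pow₀ (by linarith)
  have hd1 : (1 : ℝ) ≤ (d : ℝ) - 1 := by
    have : (2 : ℝ) ≤ d := by exact_mod_cast hd
    linarith
  refine ⟨κ * ε, h * 2 ^ h * Real.exp C + Real.exp 1 + 2, ?_⟩
  -- Besides `log n ≥ 1`, the conditions serve these purposes: `E₂` brings `n ^ (-δ)` below `ε ^ (h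
  -- - 1) / L`, `E₃` makes overlaps small, `E₄` gives `s² p ≤ 2`, `E₅` gives `t ≥ 2 v + k`, and `E₆`
  -- gives `t ≤ n / 8`. `E₅` is where density below one is needed.
  have E₁ : ∀ᶠ n : ℕ in atTop, 1 ≤ Real.log n :=
    (Real.tendsto_log_atTop.comp tendsto_natCast_atTop_atTop).eventually_ge_atTop 1
  have E₂ : ∀ᶠ n : ℕ in atTop, Real.log n ^ 1 * (n : ℝ) ^ (-δ) < ε ^ (h - 1) :=
    (tendsto_log_pow_mul_rpow_neg 1 hδ).eventually_lt_const (by positivity)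
  have E₃ : ∀ᶠ n : ℕ in atTop, Real.log n ^ (3 * d) * (n : ℝ) ^ (-δ) <
      1 / 8 / (2 ^ s * (2 * κ) ^ d) :=
    (tendsto_log_pow_mul_rpow_neg _ hδ).eventually_lt_const (by positivity)
  have E₄ : ∀ᶠ n : ℕ in atTop, Real.log n ^ 0 * (n : ℝ) ^ (-a) < 2 / (s : ℝ) ^ 2 :=
    (tendsto_log_pow_mul_rpow_neg 0 ha0).eventually_lt_const
      (by have : (1 : ℝ) ≤ s := by exact_mod_cast hs1
          positivity)
  have E₅ : ∀ᶠ n : ℕ in atTop, Real.log n ^ 1 * (n : ℝ) ^ (-(1 - a)) <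
      κ * ε / (2 * v + k) :=
    (tendsto_log_pow_mul_rpow_neg 1 (by linarith)).eventually_lt_const (by positivity)
  have E₆ : ∀ᶠ n : ℕ in atTop, Real.log n ^ 3 * (n : ℝ) ^ (-a) < 1 / (8 * κ) :=
    (tendsto_log_pow_mul_rpow_neg 3 ha0).eventually_lt_const (by positivity)
  filter_upwards [E₁, E₂, E₃, E₄, E₅, E₆, eventually_ge_atTop (4 * v + 4 * k)]
    with n hL hE₂ hE₃ hE₄ hE₅ hE₆ hn4
  have hn : 1 ≤ n := by omega
  have hn1 : (1 : ℝ) ≤ n := by exact_mod_cast hn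
  have hn0 : (0 : ℝ) < n := by linarith
  have hn4' : 4 * (v : ℝ) + 4 * k ≤ n := by exact_mod_cast hn4
  set L := Real.log n with hL_def
  have hL0 : 0 < L := by linarith
  set p := edgeProb k v h ε n with hp_def
  have hp0 : 0 < p := edgeProb_pos hε hn hL
  have hpa : p ≤ (n : ℝ) ^ (-a) := edgeProb_le hh hε1 hL
  have hp1 : p ≤ 1 := hpa.trans (Real.rpow_le_one_of_one_le_of_nonpos hn1 (by linarith))
  set t := bound k v h d (κ * ε) n with ht_def
  have ht : t = κ * L ^ (3 / ((d : ℝ) - 1)) * (n * p) := bound_eq κ hn hL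
  have hnp : n * p ≤ (n : ℝ) ^ (1 - a) := by
    rw [sub_eq_add_neg, Real.rpow_add hn0, Real.rpow_one]
    gcongr
  have hL3 : L ^ (3 / ((d : ℝ) - 1)) ≤ L ^ 3 := by
    rw [← Real.rpow_natCast]
    refine Real.rpow_le_rpow_of_exponent_le hL ?_
    rw [div_le_iff₀ (by linarith)]
    push_cast
    linarith
  have htp : t ≤ κ * L ^ 3 * (n * p) := by
    rw [ht]
    gcongr
  have htn : t ≤ n / 8 := by
    calc t ≤ κ * L ^ 3 * (n * p) := htp
      _ ≤ κ * L ^ 3 * (n * (n : ℝ) ^ (-a)) := by gcongr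
      _ = κ * n * (L ^ 3 * (n : ℝ) ^ (-a)) := by ring
      _ ≤ κ * n * (1 / (8 * κ)) := by gcongr
      _ = n / 8 := by field_simp
  have htlarge : 2 * (v : ℝ) + k ≤ t := by
    have h1 : L ^ (-1 : ℝ) ≤ L ^ (-(1 / ((h : ℝ) - 1))) := by
      refine Real.rpow_le_rpow_of_exponent_le hL (neg_le_neg ?_)
      rw [div_le_one (by linarith)]
      linarith
    have h2 : (1 : ℝ) ≤ L ^ (3 / ((d : ℝ) - 1)) :=
      Real.one_le_rpow hL (div_nonneg (by norm_num) (by linarith))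
    have h3 : ε * (L ^ (-1 : ℝ) * (n : ℝ) ^ (1 - a)) ≤ n * p := by
      calc ε * (L ^ (-1 : ℝ) * (n : ℝ) ^ (1 - a))
          ≤ ε * (L ^ (-(1 / ((h : ℝ) - 1))) * (n : ℝ) ^ (1 - a)) := by gcongr
        _ = n * p := by
          rw [sub_eq_add_neg 1 a, Real.rpow_add hn0, Real.rpow_one, hp_def, edgeProb]
          ring
    have h4 : 2 * (v : ℝ) + k ≤ κ * (ε * (L ^ (-1 : ℝ) * (n : ℝ) ^ (1 - a))) := by
      rw [lt_div_iff₀ (by positivity), Real.rpow_neg hn0.le, pow_one] at hE₅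
      have h5 : 0 < (n : ℝ) ^ (1 - a) := by positivity
      rw [Real.rpow_neg_one]
      calc 2 * (v : ℝ) + k
          = L * ((n : ℝ) ^ (1 - a))⁻¹ * (2 * v + k) * (L⁻¹ * (n : ℝ) ^ (1 - a)) := by
            field_simp
        _ ≤ κ * ε * (L⁻¹ * (n : ℝ) ^ (1 - a)) := by gcongr
        _ = _ := by ring
    calc 2 * (v : ℝ) + k ≤ κ * (ε * (L ^ (-1 : ℝ) * (n : ℝ) ^ (1 - a))) := h4
      _ ≤ κ * (n * p) := by gcongr
      _ = κ * 1 * (n * p) := by ring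
      _ ≤ κ * L ^ (3 / ((d : ℝ) - 1)) * (n * p) := by gcongr
      _ = t := ht.symm
  have hkR : (1 : ℝ) ≤ k := by exact_mod_cast hk
  have ht1 : 1 ≤ t := by linarith
  set τ := ⌈t⌉₊
  have hτt : t ≤ τ := Nat.le_ceil t
  have hτt2 : (τ : ℝ) ≤ 2 * t := by
    have := Nat.ceil_lt_add_one (show 0 ≤ t by linarith)
    linarith
  refine ⟨by linarith, p, hp0.le, hp1, ?_⟩
  have hτp : (τ : ℝ) ≤ 2 * κ * L ^ 3 * (n * p) := by linarith
  have hmain : (n : ℝ) ^ (v - k) * p ^ (h - 1) = ε ^ (h - 1) / L :=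
    pow_mul_edgeProb_pow (by omega) hh hn hL
  have hβ₂ : ∀ I ⊆ EF, 2 ≤ #I → #I < #EF →
      (n : ℝ) ^ (v - #(support I)) * p ^ (#EF - #I) ≤ (n : ℝ) ^ (-δ) := by
    intro I hI hI2 hIh
    exact pow_mul_edgeProb_pow_le hh hε hε1 hn hL ((min_le_left _ _).trans
      (hδ₁' I (mem_filter.2 ⟨mem_powerset.2 hI, hI2, hIh⟩)))
  have hβ₁ : ∀ I ⊆ EF, 1 ≤ #I → #I < #EF →
      (n : ℝ) ^ (v - #(support I)) * p ^ (#EF - #I) ≤ ε ^ (h - 1) / L := by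
    intro I hI hI1 hIh
    rcases hI1.eq_or_lt with hI1 | hI2
    · obtain ⟨e, rfl⟩ := card_eq_one.1 hI1.symm
      have : #(support {e}) = k := by
        simp [support]
      rw [this, card_singleton]
      exact hmain.le
    · refine (hβ₂ I hI hI2 hIh).trans ?_
      rw [le_div_iff₀ hL0]
      rw [pow_one] at hE₂
      linarith
  have hsplit : #(U₀ ∪ D)ᶜ + d + #U₀ = v := by
    rw [card_compl, card_union_of_disjoint hD]
    have := card_le_univ (U₀ ∪ D)
    rw [card_union_of_disjoint hD] at this
    change v - (#U₀ + d) + d + #U₀ = v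
    change #U₀ + d ≤ v at this
    omega
  set r := #(U₀ ∪ D)ᶜ
  refine prob_not_forall_isGoodCopy_le_div (a := (2 * κ * L ^ 3) ^ d * (n : ℝ) ^ (-δ))
    (β := ε ^ (h - 1) / L) (δ := δ) EF S hS (show s < h by omega) hk U₀ D hD
    τ (τ / v) (n / (2 * v)) hp0.le hp1 (by positivity)
    (by positivity) hn hL m₂ hm₂' hδ ?_ hβ₁ hβ₂ (Nat.mul_div_le τ v) ?_ ?_ ?_ ?_ rfl ?_ ?_ ?_
  · calc Real.exp 2 * (C * (ε ^ (h - 1) / L)) ≤ Real.exp 2 * (C * (ε / L)) := by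
          gcongr
          exact pow_le_of_le_one hε.le hε1 (by omega)
      _ = 1 / (32 * c₀ * L) := by
          rw [hε_def]
          field_simp
  · have h1 : v * (n / (2 * v)) ≤ n / 2 := by
      rw [← Nat.div_div_eq_div_mul]
      exact Nat.mul_div_le _ _
    have h2 : ((v * (n / (2 * v)) : ℕ) : ℝ) ≤ n / 2 :=
      (Nat.cast_le.2 h1).trans (Nat.cast_div_le.trans (by norm_num))
    have h3 : ((v * (n / (2 * v)) + #U₀ + τ : ℕ) : ℝ) ≤ n := by
      have h4 : (#U₀ : ℝ) ≤ k := by exact_mod_cast (show #U₀ ≤ k by omega)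
      push_cast at h2 ⊢
      linarith
    exact_mod_cast h3
  · intro J hJ hJne hJu
    set x := #(D \ support J)
    set y := #(U₀ ∪ D ∪ support J)ᶜ
    have hxd : x ≤ d := card_le_card sdiff_subset
    have hbase : 1 ≤ 2 * κ * L ^ 3 := by
      calc (1 : ℝ) ≤ 2 * 1 * 1 := by norm_num
        _ ≤ 2 * κ * L ^ 3 := by
          gcongr
          exact one_le_pow₀ hL
    calc (τ : ℝ) ^ x * (n : ℝ) ^ y * p ^ (s - #J)
        ≤ (2 * κ * L ^ 3 * (n * p)) ^ x * (n : ℝ) ^ y * p ^ (s - #J) := by gcongr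
      _ = (2 * κ * L ^ 3) ^ x * ((n : ℝ) ^ (x + y) * p ^ (x + (s - #J))) := by ring
      _ ≤ (2 * κ * L ^ 3) ^ d * (n : ℝ) ^ (-δ) := by
          refine mul_le_mul (pow_le_pow_right₀ hbase hxd) ?_ (by positivity) (by positivity)
          exact pow_mul_edgeProb_pow_le hh hε hε1 hn hL ((min_le_right _ _).trans
            (hδ₂' J (mem_filter.2 ⟨mem_powerset.2 hJ, hJne, hJu⟩)))
  · rw [lt_div_iff₀ (by positivity)] at hE₃
    calc 2 ^ s * ((2 * κ * L ^ 3) ^ d * (n : ℝ) ^ (-δ))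
        = L ^ (3 * d) * (n : ℝ) ^ (-δ) * (2 ^ s * (2 * κ) ^ d) := by
          rw [mul_pow _ (L ^ 3), ← pow_mul]
          ring
      _ ≤ 1 / 8 := hE₃.le
  · have hs0 : (0 : ℝ) < (s : ℝ) ^ 2 := by
      have : (1 : ℝ) ≤ s := by exact_mod_cast hs1
      positivity
    rw [lt_div_iff₀ hs0, pow_zero, one_mul] at hE₄
    calc (s : ℝ) ^ 2 * p ≤ (s : ℝ) ^ 2 * (n : ℝ) ^ (-a) := by gcongr
      _ ≤ 2 := by linarith
  · have hτ2 : 2 * v ≤ τ := by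
      have : (2 * v : ℝ) ≤ τ := by linarith
      exact_mod_cast this
    have hq₁ := cast_div_le_cast_nat_div (w := 4 * v) (show 0 < v by omega) (by omega) hτ2
    have hq₂ := cast_div_le_cast_nat_div (w := 4 * v) (m := n) (u := 2 * v) (by omega) (by omega)
      (by omega)
    push_cast at hq₁ hq₂
    exact le_pow_mul_pow_mul_pow hp0.le hL hκ1 hε hd (by omega) (by omega) (by omega)
      (by omega) ht (by linarith) hτt hmain hκ_def hq₁ hq₂
  · have h1 : (#U₀ : ℝ) ≤ k := by exact_mod_cast (show #U₀ ≤ k by omega)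
    have h2 : (#U₀ : ℝ) ≤ τ := by linarith
    exact_mod_cast h2
  · have h2 : (1 : ℝ) ≤ τ := by linarith
    exact_mod_cast h2

end GreedyFree

/-! ### The greedy process and degrees. -/

namespace GreedyFree

open Finset RandomSubset

variable {α : Type*} {k n : ℕ}

open Classical in
/-- The hyperedges of size `k` of `F`, as sets of elements of the subtype of vertices. -/
noncomputable def edges (F : Hypergraph α) [Fintype F.vertexSet] (k : ℕ) :
    Finset (Set.powersetCard F.vertexSet k) :=
  {e | Subtype.val '' (e.val : Set F.vertexSet) ∈ F.edgeSet}

lemma mem_edges {F : Hypergraph α} [Fintype F.vertexSet] {e : Set.powersetCard F.vertexSet k} :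
    e ∈ edges F k ↔ Subtype.val '' (e.val : Set F.vertexSet) ∈ F.edgeSet := by
  simp [edges]

lemma injective_image_val (F : Hypergraph α) (k : ℕ) :
    Function.Injective fun e : Set.powersetCard F.vertexSet k =>
      Subtype.val '' (e.val : Set F.vertexSet) := by
  intro e e' h
  exact Subtype.ext (coe_injective (Subtype.val_injective.image_injective h))

lemma exists_edges_of_mem {F : Hypergraph α} [Fintype F.vertexSet] (hunif : F.IsUniform k)
    {f : Set α} (hf : f ∈ F.edgeSet) :
    ∃ e ∈ edges F k, Subtype.val '' (e.val : Set F.vertexSet) = f := by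
  classical
  have hsub : f ⊆ F.vertexSet := F.subset_vertexSet_of_mem_edgeSet hf
  set g : Finset F.vertexSet := (Subtype.val ⁻¹' f).toFinset
  have hg : Subtype.val '' (g : Set F.vertexSet) = f := by
    simp only [g, Set.coe_toFinset, Subtype.image_preimage_coe]
    exact Set.inter_eq_right.2 hsub
  have hcard : #g = k := by
    rw [← hunif f hf, ← hg, Set.ncard_image_of_injective _ Subtype.val_injective,
      Set.ncard_coe_finset]
  refine ⟨⟨g, hcard⟩, ?_, hg⟩
  rw [mem_edges]
  exact hg ▸ hf

lemma card_edges {F : Hypergraph α} [Fintype F.vertexSet] (hunif : F.IsUniform k) :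
    #(edges F k) = F.edgeSet.ncard := by
  have : F.edgeSet = (fun e : Set.powersetCard F.vertexSet k =>
      Subtype.val '' (e.val : Set F.vertexSet)) '' (edges F k : Set _) := by
    ext f
    constructor
    · exact fun hf => exists_edges_of_mem hunif hf
    · rintro ⟨e, he, rfl⟩
      exact mem_edges.1 he
  rw [this, Set.ncard_image_of_injective _ (injective_image_val F k), Set.ncard_coe_finset]

lemma containsCopy_iff {F : Hypergraph α} [Fintype F.vertexSet] (hne : F.vertexSet.Nonempty)
    (hunif : F.IsUniform k) {R : Hypergraph (Fin n)} (hR : R.vertexSet = Set.univ) :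
    F.ContainsCopy R ↔ ∃ ψ : F.vertexSet ↪ Fin n, ∀ e ∈ edges F k,
      ((Set.powersetCard.map k ψ e).val : Set (Fin n)) ∈ R.edgeSet := by
  classical
  constructor
  · rintro ⟨φ, hφ, -, hsub⟩
    refine ⟨⟨fun x => φ x, fun x y h => Subtype.ext (hφ x.2 y.2 h)⟩, fun e he => ?_⟩
    refine hsub ⟨_, mem_edges.1 he, ?_⟩
    ext y
    simp only [Set.mem_image, Set.powersetCard.val_map, coe_map, exists_exists_and_eq_and]
    rfl
  · rintro ⟨ψ, hψ⟩
    obtain ⟨x₀, hx₀⟩ := hne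
    set φ : α → Fin n := fun x => if hx : x ∈ F.vertexSet then ψ ⟨x, hx⟩ else ψ ⟨x₀, hx₀⟩
    have hφ : ∀ x : F.vertexSet, φ x = ψ x := fun x => by simp [φ]
    refine ⟨φ, ?_, ?_, ?_⟩
    · intro x hx y hy h
      have := ψ.injective ((hφ ⟨x, hx⟩).symm.trans (h.trans (hφ ⟨y, hy⟩)))
      exact congrArg Subtype.val this
    · rw [hR]
      exact Set.subset_univ _
    · rintro _ ⟨f, hf, rfl⟩
      obtain ⟨e, he, rfl⟩ := exists_edges_of_mem hunif hf
      convert hψ e he using 1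
      ext y
      simp only [Set.mem_image, Set.powersetCard.val_map, coe_map, exists_exists_and_eq_and, hφ]

section process

variable (F : Hypergraph α)

lemma run_append_singleton (l : List (Edge n k)) (e : Edge n k) :
    run F (l ++ [e]) = step F (run F l) e := by
  simp [run]

lemma edgeSet_subset_step (H : Hypergraph (Fin n)) (e : Edge n k) :
    H.edgeSet ⊆ (step F H e).edgeSet := by
  unfold step
  split_ifs
  · exact subset_rfl
  · exact Set.subset_insert _ _

lemma edgeSet_run_subset (l l' : List (Edge n k)) :
    (run F l).edgeSet ⊆ (run F (l ++ l')).edgeSet := by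
  induction l' using List.reverseRecOn with
  | nil => simp
  | append_singleton l' e ih =>
    rw [← List.append_assoc, run_append_singleton]
    exact ih.trans (edgeSet_subset_step F _ e)

lemma vertexSet_run (l : List (Edge n k)) : (run F l).vertexSet = Set.univ := by
  induction l using List.reverseRecOn with
  | nil => rfl
  | append_singleton l e ih =>
    rw [run_append_singleton, step]
    split_ifs
    · exact ih
    · simp [Hypergraph.addEdge, ih]

lemma exists_mem_of_mem_edgeSet_run (l : List (Edge n k)) {f : Set (Fin n)}
    (hf : f ∈ (run F l).edgeSet) : ∃ e ∈ l, (e.val : Set (Fin n)) = f := by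
  induction l using List.reverseRecOn with
  | nil => simp [run] at hf
  | append_singleton l e ih =>
    rw [run_append_singleton, step] at hf
    split_ifs at hf
    · obtain ⟨e', he', h⟩ := ih hf
      exact ⟨e', by simp [he'], h⟩
    · rcases hf with rfl | hf
      · exact ⟨e, by simp, rfl⟩
      · obtain ⟨e', he', h⟩ := ih hf
        exact ⟨e', by simp [he'], h⟩

lemma not_containsCopy_run (hF : F.edgeSet.Nonempty) (l : List (Edge n k)) :
    ¬ F.ContainsCopy (run F l) := by
  induction l using List.reverseRecOn with
  | nil =>
    rintro ⟨φ, -, -, h⟩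
    obtain ⟨f, hf⟩ := hF
    exact h ⟨f, hf, rfl⟩
  | append_singleton l e ih =>
    rw [run_append_singleton, step]
    split_ifs with h
    · exact ih
    · exact h

/-- A hyperedge born up to time `p` that is in no copy of `F` in the hypergraph of all hyperedges
born up to time `p` is accepted. -/
lemma mem_edgeSet_run [Fintype F.vertexSet] (hne : F.vertexSet.Nonempty)
    (hunif : F.IsUniform k) (hF : F.edgeSet.Nonempty) {b : Edge n k → unitInterval}
    {p : unitInterval} {l : List (Edge n k)} (hl : IsBirthOrder b 1 l) {e : Edge n k}
    (he : b e ≤ p)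
    (hgood : ∀ G ∈ copies n (edges F k), G ⊆ ({f | b f ≤ p} : Finset (Edge n k)) → e ∉ G) :
    (e.val : Set (Fin n)) ∈ (run F l).edgeSet := by
  classical
  have hel : e ∈ l := (hl.2.1 e).2 (b e).2.2
  obtain ⟨l₁, l₂, rfl⟩ := List.append_of_mem hel
  have h1 : (run F (l₁ ++ [e])).edgeSet ⊆ (run F (l₁ ++ e :: l₂)).edgeSet := by
    have := edgeSet_run_subset F (l₁ ++ [e]) l₂
    simpa using this
  refine h1 ?_
  rw [run_append_singleton, step]
  split_ifs with hcopy
  swap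
  · exact Set.mem_insert _ _
  · exfalso
    have hv : ((run F l₁).addEdge ((e : Finset (Fin n)) : Set (Fin n))).vertexSet = Set.univ := by
      simp [Hypergraph.addEdge, vertexSet_run]
    obtain ⟨ψ, hψ⟩ := (containsCopy_iff hne hunif hv).1 hcopy
    have hcase : ∀ f ∈ edges F k, Set.powersetCard.map k ψ f = e ∨
        ((Set.powersetCard.map k ψ f).val : Set (Fin n)) ∈ (run F l₁).edgeSet := by
      intro f hf
      rcases hψ f hf with h | h
      · exact Or.inl (Subtype.ext (coe_injective h))
      · exact Or.inr h
    -- Everything accepted before `e` was born no later than `e`, so a copy blocking `e` lies among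
    -- the hyperedges born up to time `p`. By `hgood` it avoids `e`, so it was already present
    -- before `e`, a contradiction.
    have hsub : copy ψ (edges F k) ⊆ ({f | b f ≤ p} : Finset (Edge n k)) := by
      intro g hg
      obtain ⟨f, hf, rfl⟩ := mem_copy.1 hg
      simp only [mem_filter, mem_univ, true_and]
      rcases hcase f hf with h | h
      · rw [h]
        exact he
      · obtain ⟨e', he', hee'⟩ := exists_mem_of_mem_edgeSet_run F l₁ h
        rw [← Subtype.ext (coe_injective hee')]
        have hpw := hl.2.2
        rw [List.pairwise_append] at hpw
        exact (hpw.2.2 e' he' e (by simp)).trans he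
    have hnot := hgood _ (mem_image.2 ⟨ψ, mem_univ _, rfl⟩) hsub
    refine not_containsCopy_run F hF l₁ ((containsCopy_iff hne hunif (vertexSet_run F l₁)).2
      ⟨ψ, fun f hf => (hcase f hf).resolve_left fun h => hnot (mem_copy.2 ⟨f, hf, h⟩)⟩)

end process

section degree

variable {R : Hypergraph (Fin n)}

lemma exists_insert_eq {U e : Set (Fin n)} (hk : 1 ≤ k) (hU : U.ncard = k - 1) (he : e.ncard = k)
    (hUe : U ⊆ e) : ∃ y ∉ U, insert y U = e := by
  have h1 : (e \ U).ncard = 1 := by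
    rw [Set.ncard_sdiff hUe, he, hU]
    omega
  obtain ⟨y, hy⟩ := Set.ncard_eq_one.1 h1
  have hyU : y ∈ e \ U := hy ▸ rfl
  refine ⟨y, hyU.2, ?_⟩
  rw [← Set.union_sdiff_cancel hUe, hy, Set.union_singleton]

lemma degree_le_maxDegree {β : Type*} {H : Hypergraph β} (hH : H.edgeSet.Finite) {i : ℕ}
    {U : Set β} (hUV : U ⊆ H.vertexSet) (hU : U.ncard = i) : H.degree U ≤ H.maxDegree i := by
  refine le_csSup ⟨H.edgeSet.ncard, ?_⟩ ⟨U, hUV, hU, rfl⟩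
  rintro _ ⟨U', -, -, rfl⟩
  exact Set.ncard_le_ncard (fun e he => he.1) hH

/-- Positivity rules out the supremum of the empty set, whose default value is `0`. -/
lemma exists_degree_eq_maxDegree {β : Type*} {H : Hypergraph β} (hH : H.edgeSet.Finite) {i : ℕ}
    (hpos : 0 < H.maxDegree i) :
    ∃ U ⊆ H.vertexSet, U.ncard = i ∧ H.degree U = H.maxDegree i := by
  have hne : {d | ∃ U ⊆ H.vertexSet, U.ncard = i ∧ H.degree U = d}.Nonempty := by
    by_contra h
    rw [Set.not_nonempty_iff_eq_empty] at h
    rw [Hypergraph.maxDegree, h] at hpos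
    simp at hpos
  refine Nat.sSup_mem hne ⟨H.edgeSet.ncard, ?_⟩
  rintro _ ⟨U', -, -, rfl⟩
  exact Set.ncard_le_ncard (fun e he => he.1) hH

/-- Every hyperedge contains some `(k - 1)`-set, and there are at most `n ^ (k - 1)` of these. -/
lemma ncard_edgeSet_le (hk : 1 ≤ k) (hR : R.vertexSet = Set.univ)
    (hunif : ∀ f ∈ R.edgeSet, f.ncard = k) :
    R.edgeSet.ncard ≤ n ^ (k - 1) * R.maxDegree (k - 1) := by
  classical
  have hfin : R.edgeSet.Finite := Set.toFinite _
  set ER := hfin.toFinset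
  have hsub : ER ⊆ (powersetCard (k - 1) (univ : Finset (Fin n))).biUnion
      fun U => ER.filter fun e => (U : Set (Fin n)) ⊆ e := by
    intro f hf
    have hfk := hunif f (hfin.mem_toFinset.1 hf)
    have : k - 1 ≤ #f.toFinset := by
      rw [← Set.ncard_eq_toFinset_card', hfk]
      omega
    obtain ⟨U, hUf, hU⟩ := exists_subset_card_eq this
    refine mem_biUnion.2 ⟨U, mem_powersetCard.2 ⟨subset_univ _, hU⟩, mem_filter.2 ⟨hf, ?_⟩⟩
    intro x hx
    simpa using hUf hx
  rw [Set.ncard_eq_toFinset_card _ hfin]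
  refine (card_le_card hsub).trans ((card_biUnion_le_card_mul _ _ (R.maxDegree (k - 1))
    fun U hU => ?_).trans ?_)
  · refine le_trans (le_of_eq ?_) (degree_le_maxDegree hfin (U := (U : Set (Fin n)))
      (hR ▸ Set.subset_univ _) (by rw [Set.ncard_coe_finset, (mem_powersetCard.1 hU).2]))
    rw [Hypergraph.degree, ← Set.ncard_coe_finset]
    congr 1
    ext e
    simp [ER]
  · refine Nat.mul_le_mul_right _ ?_
    rw [card_powersetCard, card_univ, Fintype.card_fin]
    exact Nat.choose_le_pow _ _

end degree

end GreedyFree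

/-! ### Consequences of strict balancedness. -/

namespace GreedyFree

open Finset RandomSubset

variable {V : Type*} [Fintype V] [DecidableEq V] {k n : ℕ}

/-- The hyperedges that contain `U₀`. -/
def starAt (EF : Finset (Set.powersetCard V k)) (U₀ : Finset V) :
    Finset (Set.powersetCard V k) :=
  {e ∈ EF | U₀ ⊆ e.val}

/-- The vertices that form a hyperedge together with `U₀`. -/
def neighbours (EF : Finset (Set.powersetCard V k)) (U₀ : Finset V) : Finset V :=
  {x | x ∉ U₀ ∧ ∃ e ∈ EF, e.val = insert x U₀}

/-- The weighted-density condition of strict balancedness, with the denominators cleared. -/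
def IsBalancedAt (EF : Finset (Set.powersetCard V k)) (W : Finset V)
    (J : Finset (Set.powersetCard V k)) : Prop :=
  ((Fintype.card V : ℝ) - k) * ((#J : ℝ) - 1) < ((#W : ℝ) - k) * ((#EF : ℝ) - 1)

/-- Every proper subhypergraph with at least `k + 1` vertices has smaller density. -/
def IsBalanced (EF : Finset (Set.powersetCard V k)) : Prop :=
  ∀ (W : Finset V) (J : Finset (Set.powersetCard V k)), J ⊆ EF → support J ⊆ W → k + 1 ≤ #W →
    (W ≠ univ ∨ J ≠ EF) → IsBalancedAt EF W J

variable {EF : Finset (Set.powersetCard V k)} {U₀ : Finset V}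

lemma disjoint_neighbours : Disjoint U₀ (neighbours EF U₀) := by
  rw [disjoint_left]
  intro x hx hx'
  simp only [neighbours, mem_filter] at hx'
  exact hx'.2.1 hx

lemma exists_insert_eq_of_mem_starAt (hU₀ : #U₀ + 1 = k) {e : Set.powersetCard V k}
    (he : e ∈ starAt EF U₀) : ∃ x ∈ neighbours EF U₀, insert x U₀ = e.val := by
  obtain ⟨heF, hUe⟩ := mem_filter.1 he
  have h1 : #(e.val \ U₀) = 1 := by
    rw [card_sdiff_of_subset hUe, Set.powersetCard.card_eq]
    omega
  obtain ⟨x, hx⟩ := card_eq_one.1 h1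
  have hxe : x ∈ e.val \ U₀ := hx ▸ mem_singleton_self x
  have hins : insert x U₀ = e.val := by
    rw [← union_sdiff_of_subset hUe, hx, union_comm]
    rfl
  refine ⟨x, ?_, hins⟩
  simp only [neighbours, mem_filter, mem_univ, true_and]
  exact ⟨(mem_sdiff.1 hxe).2, e, heF, hins.symm⟩

lemma card_starAt_filter (hU₀ : #U₀ + 1 = k) (W : Finset V) (hW : U₀ ⊆ W) :
    #{e ∈ starAt EF U₀ | e.val ⊆ W} = #(neighbours EF U₀ ∩ W) := by
  have h1 : #{e ∈ starAt EF U₀ | e.val ⊆ W} = #(({e ∈ starAt EF U₀ | e.val ⊆ W}).image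
      Subtype.val) := (card_image_of_injective _ Subtype.val_injective).symm
  have h2 : #(neighbours EF U₀ ∩ W) = #((neighbours EF U₀ ∩ W).image fun x => insert x U₀) := by
    refine (card_image_of_injOn ?_).symm
    intro x hx y hy hxy
    have hxU : x ∉ U₀ := fun h => disjoint_left.1 disjoint_neighbours h
      (mem_inter.1 (mem_coe.1 hx)).1
    have : x ∈ insert y U₀ := by
      rw [← show insert x U₀ = insert y U₀ from hxy]
      exact mem_insert_self x U₀
    exact (mem_insert.1 this).resolve_right hxU
  rw [h1, h2]
  congr 1
  ext f
  simp only [mem_image, mem_filter, mem_inter]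
  constructor
  · rintro ⟨e, ⟨he, heW⟩, rfl⟩
    obtain ⟨x, hx, hxe⟩ := exists_insert_eq_of_mem_starAt hU₀ he
    exact ⟨x, ⟨hx, heW (hxe ▸ mem_insert_self x U₀)⟩, hxe⟩
  · rintro ⟨x, ⟨hx, hxW⟩, rfl⟩
    simp only [neighbours, mem_filter, mem_univ, true_and] at hx
    obtain ⟨-, e, he, hex⟩ := hx
    refine ⟨e, ⟨mem_filter.2 ⟨he, ?_⟩, ?_⟩, hex⟩
    · rw [hex]
      exact subset_insert x U₀
    · rw [hex]
      exact insert_subset hxW hW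

lemma card_starAt (hU₀ : #U₀ + 1 = k) : #(starAt EF U₀) = #(neighbours EF U₀) := by
  have := card_starAt_filter (EF := EF) hU₀ univ (subset_univ _)
  simpa using this

omit [Fintype V] in
lemma succ_le_card_union {e : Finset V} {W : Finset V} (he : #e = k) (hW : ¬ W ⊆ e) :
    k + 1 ≤ #(W ∪ e) := by
  obtain ⟨x, hx, hxe⟩ := not_subset.1 hW
  rw [← he, ← card_insert_of_notMem hxe]
  exact card_le_card (insert_subset (mem_union_left _ hx) subset_union_right)

/-- Two distinct hyperedges span more than `k` vertices, so balancedness applies to `I` on its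
support. Taking complements in the cross-multiplied inequality gives the claim. -/
lemma exponent_lt_of_isBalanced (hbal : IsBalanced EF)
    (hEF : 2 ≤ #EF) (I : Finset (Set.powersetCard V k)) (hI : I ⊆ EF) (hI2 : 2 ≤ #I)
    (hIh : #I < #EF) :
    ((Fintype.card V - #(support I) : ℕ) : ℝ) <
      ((Fintype.card V : ℝ) - k) / ((#EF : ℝ) - 1) * (#EF - #I : ℕ) := by
  obtain ⟨e, he, f, hf, hef⟩ := one_lt_card.1 hI2
  have hW : k + 1 ≤ #(support I) := by
    refine (succ_le_card_union (W := e.val) f.2 fun h =>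
      hef (Set.powersetCard.eq_iff_subset.2 h)).trans (card_le_card (union_subset ?_ ?_))
    · exact fun x hx => mem_support.2 ⟨e, he, hx⟩
    · exact fun x hx => mem_support.2 ⟨f, hf, hx⟩
  have hb : IsBalancedAt EF (support I) I :=
    hbal (support I) I hI subset_rfl hW (Or.inr fun h => hIh.ne (by rw [h]))
  unfold IsBalancedAt at hb
  have hh : (2 : ℝ) ≤ #EF := by exact_mod_cast hEF
  rw [div_mul_eq_mul_div, lt_div_iff₀ (by linarith), Nat.cast_sub (card_le_univ _),
    Nat.cast_sub hIh.le]
  linarith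

/-- Balancedness is applied to `W = U₀ ∪ support J` with the hyperedges of `J` and all star
hyperedges inside `W`, one for each vertex of `D ∩ support J`. What remains outside is exactly the
vertex and hyperedge counts of the statement. `W` has more than `k` vertices because no hyperedge of
`J` contains `U₀`. -/
lemma exponent_lt_of_isBalanced_of_star (hbal : IsBalanced EF)
    (hEF : 2 ≤ #EF) (hU₀ : #U₀ + 1 = k) (J : Finset (Set.powersetCard V k))
    (hJ : J ⊆ EF \ starAt EF U₀) (hJne : J.Nonempty) (hJu : U₀ ∪ support J ≠ univ) :
    ((#(neighbours EF U₀ \ support J) + #(U₀ ∪ neighbours EF U₀ ∪ support J)ᶜ : ℕ) : ℝ) <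
      ((Fintype.card V : ℝ) - k) / ((#EF : ℝ) - 1) *
        (#(neighbours EF U₀ \ support J) + (#(EF \ starAt EF U₀) - #J) : ℕ) := by
  set D := neighbours EF U₀
  set W := U₀ ∪ support J
  set K := {e ∈ starAt EF U₀ | e.val ⊆ W}
  have hstar : starAt EF U₀ ⊆ EF := filter_subset _ _
  have hDU : Disjoint U₀ D := disjoint_neighbours
  obtain ⟨e, he⟩ := hJne
  have heU : ¬ U₀ ⊆ e.val := fun h =>
    (mem_sdiff.1 (hJ he)).2 (mem_filter.2 ⟨(mem_sdiff.1 (hJ he)).1, h⟩)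
  have hW : k + 1 ≤ #W := (succ_le_card_union e.2 heU).trans
    (card_le_card (union_subset_union_right fun x hx => mem_support.2 ⟨e, he, hx⟩))
  have hJK : Disjoint J K := by
    rw [disjoint_left]
    exact fun f hf hf' => (mem_sdiff.1 (hJ hf)).2 (mem_filter.1 hf').1
  have hb : IsBalancedAt EF W (J ∪ K) := by
    refine hbal W (J ∪ K) ?_ ?_ hW (Or.inl hJu)
    · exact union_subset (hJ.trans sdiff_subset) ((filter_subset _ _).trans hstar)
    · intro x hx
      obtain ⟨f, hf, hxf⟩ := mem_support.1 hx
      rcases mem_union.1 hf with hf | hf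
      · exact mem_union_right _ (mem_support.2 ⟨f, hf, hxf⟩)
      · exact (mem_filter.1 hf).2 hxf
  have hK : #K = #(D ∩ support J) := by
    rw [card_starAt_filter hU₀ W subset_union_left]
    congr 1
    ext x
    have := fun hx : x ∈ D => fun hx' : x ∈ U₀ => disjoint_left.1 hDU hx' hx
    simp only [W, mem_inter, mem_union]
    tauto
  have hD1 : #(D \ support J) + #(D ∩ support J) = #D := card_sdiff_add_card_inter D (support J)
  have hD2 : #D + #(EF \ starAt EF U₀) = #EF := by
    rw [← card_starAt hU₀, add_comm]
    exact card_sdiff_add_card_eq_card hstar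
  have hJS : #J ≤ #(EF \ starAt EF U₀) := card_le_card hJ
  have hV : #(D \ support J) + #(U₀ ∪ D ∪ support J)ᶜ + #W = Fintype.card V := by
    rw [← card_union_of_disjoint, ← card_union_of_disjoint, ← card_univ]
    · congr 1
      ext x
      simp only [W, mem_union, mem_sdiff, mem_compl, mem_univ]
      tauto
    · rw [disjoint_left]
      intro x hx
      have := fun hx : x ∈ D => fun hx' : x ∈ U₀ => disjoint_left.1 hDU hx' hx
      simp only [W, mem_union, mem_sdiff, mem_compl] at hx ⊢
      tauto
    · rw [disjoint_left]
      intro x hx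
      simp only [mem_union, mem_sdiff, mem_compl] at hx ⊢
      tauto
  unfold IsBalancedAt at hb
  rw [card_union_of_disjoint hJK, hK] at hb
  have hh : (2 : ℝ) ≤ #EF := by exact_mod_cast hEF
  rw [div_mul_eq_mul_div, lt_div_iff₀ (by linarith)]
  set x := #(D \ support J)
  set y := #(U₀ ∪ D ∪ support J)ᶜ
  set s := #(EF \ starAt EF U₀)
  set u := #(D ∩ support J)
  have e1 : ((x + y : ℕ) : ℝ) = Fintype.card V - #W := by
    rw [← hV]
    push_cast
    ring
  have e2 : ((x + (s - #J) : ℕ) : ℝ) = #EF - (#J + u) := by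
    rw [← hD2, ← hD1]
    push_cast [hJS]
    ring
  rw [e1, e2]
  push_cast at hb
  linarith

/-- If the density is one, then there are no hyperedges outside a star. -/
lemma sdiff_starAt_eq_empty (hbal : IsBalanced EF)
    (hU₀ : #U₀ + 1 = k) (hd : 2 ≤ #(neighbours EF U₀))
    (hvh : Fintype.card V + 1 = #EF + k) : EF \ starAt EF U₀ = ∅ ∧ #EF = 2 ∧
      #(neighbours EF U₀) = 2 := by
  rw [← card_starAt hU₀] at hd ⊢
  obtain ⟨e, he, f, hf, hef⟩ := one_lt_card.1 hd
  have hW : k + 1 ≤ #(e.val ∪ f.val) :=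
    succ_le_card_union f.2 fun h => hef (Set.powersetCard.eq_iff_subset.2 h)
  have hWle : #(e.val ∪ f.val) ≤ k + 1 := by
    have h1 := card_union_add_card_inter e.val f.val
    have h2 : #U₀ ≤ #(e.val ∩ f.val) :=
      card_le_card (subset_inter (mem_filter.1 he).2 (mem_filter.1 hf).2)
    rw [Set.powersetCard.card_eq, Set.powersetCard.card_eq] at h1
    omega
  -- Two star hyperedges span `k + 1` vertices and already have density one, so they cannot form a
  -- proper subhypergraph.
  have hEq : ({e, f} : Finset (Set.powersetCard V k)) = EF := by
    by_contra hne
    have hb : IsBalancedAt EF (e.val ∪ f.val) {e, f} := by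
      refine hbal _ _ ?_ ?_ hW (Or.inr hne)
      · intro g hg
        rcases mem_insert.1 hg with rfl | hg
        · exact (mem_filter.1 he).1
        · rw [mem_singleton.1 hg]
          exact (mem_filter.1 hf).1
      · intro x hx
        obtain ⟨g, hg, hxg⟩ := mem_support.1 hx
        rcases mem_insert.1 hg with rfl | hg
        · exact mem_union_left _ hxg
        · rw [mem_singleton.1 hg] at hxg
          exact mem_union_right _ hxg
    unfold IsBalancedAt at hb
    rw [card_pair hef, le_antisymm hWle hW] at hb
    have h1 : (Fintype.card V : ℝ) + 1 = #EF + k := by exact_mod_cast hvh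
    push_cast at hb
    linarith
  have hstar : starAt EF U₀ = EF := by
    refine subset_antisymm (filter_subset _ _) ?_
    nth_rewrite 1 [← hEq]
    exact insert_subset he (singleton_subset_iff.2 hf)
  refine ⟨sdiff_eq_empty_iff_subset.2 hstar.ge, ?_, ?_⟩
  · rw [← hEq, card_pair hef]
  · rw [hstar, ← hEq, card_pair hef]

/-- Without hyperedges outside the star, every large neighbourhood yields a copy. -/
lemma exists_isGoodCopy_of_empty (EF : Finset (Set.powersetCard V k)) (U₀ D : Finset V)
    (hD : Disjoint U₀ D) (U T : Finset (Fin n)) (hU : #U = #U₀) (hUT : Disjoint U T)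
    (hT : Fintype.card V ≤ #T) (hn : 2 * Fintype.card V + #U₀ ≤ n) (H : Finset (Edge n k)) :
    ∃ φ, IsGoodCopy EF ∅ U₀ D U T H φ := by
  obtain ⟨T', hT'T, hT'⟩ := exists_subset_card_eq hT
  obtain ⟨A, hA, hAU, hAD, hAR⟩ := exists_partition U₀ D hD U T' hU
    (disjoint_of_subset_right hT'T hUT) 1 1 (by omega) (by omega)
  have hone : ∀ x, #(A x) = 1 := by
    intro x
    by_cases hx : x ∈ U₀
    · exact (hAU x hx).2
    · by_cases hx' : x ∈ D
      · exact (hAD x hx').2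
      · exact hAR x (by simp [hx, hx'])
  have hne : (partite A).Nonempty := by
    rw [← card_pos, card_partite hA]
    simp [hone]
  obtain ⟨φ, hφ⟩ := hne
  rw [mem_partite] at hφ
  refine ⟨φ, ?_, fun x hx => hT'T ((hAD x hx).1 (hφ x)), by simp [copy], by simp [copy]⟩
  refine eq_of_subset_of_card_le ?_ (by rw [card_map, hU])
  intro y hy
  obtain ⟨x, hx, rfl⟩ := mem_map.1 hy
  exact (hAU x hx).1 (hφ x)

-- Density one is handled deterministically: `S` is empty, the bound is `log n ^ 2`, and failure is
-- impossible for large `n`, so `p = 0` suffices.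
open Filter in
theorem exists_const_eventually_prob_le_of_isBalanced (hbal : IsBalanced EF)
    (hkv : k + 1 ≤ Fintype.card V) (hU₀ : #U₀ + 1 = k) (hd : 2 ≤ #(neighbours EF U₀))
    (hvh : Fintype.card V + 1 ≤ #EF + k) :
    ∃ c C : ℝ, ∀ᶠ n : ℕ in atTop, 0 < bound k (Fintype.card V) #EF #(neighbours EF U₀) c n ∧
      ∃ p : ℝ, 0 ≤ p ∧ p ≤ 1 ∧
        prob p (fun H : Finset (Edge n k) => ¬ ∀ U T : Finset (Fin n), #U = #U₀ →
          #T = ⌈bound k (Fintype.card V) #EF #(neighbours EF U₀) c n⌉₊ → Disjoint U T →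
            ∃ φ, IsGoodCopy EF (EF \ starAt EF U₀) U₀ (neighbours EF U₀) U T H φ) ≤ C / n := by
  have hstar : starAt EF U₀ ⊆ EF := filter_subset _ _
  have hSD : #(EF \ starAt EF U₀) + #(neighbours EF U₀) = #EF := by
    rw [← card_starAt hU₀]
    exact card_sdiff_add_card_eq_card hstar
  rcases hvh.eq_or_lt with hvh | hvh
  · obtain ⟨hempty, hh2, hd2⟩ := sdiff_starAt_eq_empty hbal hU₀ hd hvh
    rw [hempty, hh2, hd2]
    refine ⟨1, 0, ?_⟩
    have hvk : (Fintype.card V : ℝ) - k = 1 := by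
      have : (Fintype.card V : ℝ) + 1 = #EF + k := by exact_mod_cast hvh
      rw [hh2] at this
      push_cast at this
      linarith
    have hbound : ∀ n : ℕ, bound k (Fintype.card V) 2 2 1 n = Real.log n ^ 2 := by
      intro n
      unfold bound
      rw [hvk, ← Real.rpow_natCast]
      norm_num
    have E : ∀ᶠ n : ℕ in atTop, (Fintype.card V : ℝ) + 1 ≤ Real.log n :=
      (Real.tendsto_log_atTop.comp tendsto_natCast_atTop_atTop).eventually_ge_atTop _
    filter_upwards [E, eventually_ge_atTop (2 * Fintype.card V + #U₀)] with n hn hn'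
    have hv0 : (0 : ℝ) ≤ Fintype.card V := Nat.cast_nonneg _
    have hlog : (Fintype.card V : ℝ) ≤ Real.log n ^ 2 := by nlinarith
    refine ⟨?_, 0, le_rfl, zero_le_one, ?_⟩
    · rw [hbound]
      exact pow_pos (by linarith) 2
    · rw [zero_div]
      refine (prob_eq_zero fun H => not_not.2 fun U T hU hT hUT => ?_).le
      refine exists_isGoodCopy_of_empty EF U₀ _ disjoint_neighbours U T hU hUT ?_ hn' H
      rw [hT, hbound]
      have := hlog.trans (Nat.le_ceil _)
      exact_mod_cast this
  -- A star at `U₀` has at most `v - k + 1` hyperedges, which is fewer than `#EF` here.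
  · have hSne : (EF \ starAt EF U₀).Nonempty := by
      rw [← card_pos]
      have h1 : #(U₀ ∪ neighbours EF U₀) ≤ Fintype.card V := card_le_univ _
      rw [card_union_of_disjoint disjoint_neighbours] at h1
      omega
    exact exists_const_eventually_prob_le EF (EF \ starAt EF U₀) hSne U₀ (neighbours EF U₀)
      disjoint_neighbours hSD hd hU₀ hkv hvh
      (fun I hI hI2 hIh => exponent_lt_of_isBalanced hbal (by omega) I hI hI2 hIh)
      (fun J hJ hJne hJu => exponent_lt_of_isBalanced_of_star hbal (by omega) hU₀ J hJ hJne hJu)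

end GreedyFree

/-! ### From good copies to the maximum degree, and conclusion. -/

namespace GreedyFree

open Finset RandomSubset

variable {α : Type*} {k n : ℕ}

lemma isBalanced_edges {F : Hypergraph α} [Fintype F.vertexSet]
    [DecidableEq F.vertexSet] (hunif : F.IsUniform k) (hbal : F.IsStrictlyBalanced k) :
    IsBalanced (edges F k) := by
  intro W J hJ hsupp hW hproper
  set F' : Hypergraph α :=
    { vertexSet := Subtype.val '' (W : Set F.vertexSet)
      edgeSet := (fun e : Set.powersetCard F.vertexSet k =>
        Subtype.val '' (e.val : Set F.vertexSet)) '' (J : Set _)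
      subset_vertexSet_of_mem_edgeSet' := by
        rintro _ ⟨e, he, rfl⟩
        refine Set.image_mono fun x hx => hsupp (mem_support.2 ⟨e, he, hx⟩) }
  have hv' : F'.vertexSet.ncard = #W := by
    rw [Set.ncard_image_of_injective _ Subtype.val_injective, Set.ncard_coe_finset]
  have he' : F'.edgeSet.ncard = #J := by
    rw [Set.ncard_image_of_injective _ (injective_image_val F k), Set.ncard_coe_finset]
  have hv : F.vertexSet.ncard = Fintype.card F.vertexSet := by
    rw [← Nat.card_coe_set_eq, Nat.card_eq_fintype_card]
  have hsub : F'.IsSubgraph F := by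
    refine ⟨?_, ?_⟩
    · rintro _ ⟨x, -, rfl⟩
      exact x.2
    · rintro _ ⟨e, he, rfl⟩
      exact mem_edges.1 (hJ he)
  have hne : F' ≠ F := by
    intro h
    have h1 : #W = Fintype.card F.vertexSet := by rw [← hv', h, hv]
    have h2 : #J = #(edges F k) := by rw [← he', h, card_edges hunif]
    rcases hproper with hp | hp
    · exact hp ((card_eq_iff_eq_univ W).1 h1)
    · exact hp (eq_of_subset_of_card_le hJ h2.ge)
  have h := hbal.2 F' hsub hne (by rw [hv']; exact hW)
  have hkv := hbal.1
  rw [hv', he', hv, ← card_edges hunif] at h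
  rw [hv] at hkv
  have hW' : (k : ℝ) + 1 ≤ #W := by exact_mod_cast hW
  have hkv' : (k : ℝ) + 1 ≤ Fintype.card F.vertexSet := by exact_mod_cast hkv
  rw [div_lt_div_iff₀ (by linarith) (by linarith)] at h
  unfold IsBalancedAt
  linarith

/-- A set of `k - 1` vertices of maximum degree. -/
lemma exists_card_neighbours_eq_maxDegree {F : Hypergraph α} [Fintype F.vertexSet]
    [DecidableEq F.vertexSet] (hk : 1 ≤ k) (hunif : F.IsUniform k)
    (hpos : 0 < F.maxDegree (k - 1)) :
    ∃ U₀ : Finset F.vertexSet, #U₀ + 1 = k ∧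
      #(neighbours (edges F k) U₀) = F.maxDegree (k - 1) := by
  classical
  have hfin : F.edgeSet.Finite :=
    (Set.toFinite F.vertexSet).finite_subsets.subset fun e he => F.subset_vertexSet_of_mem_edgeSet he
  obtain ⟨U, hUV, hU, hdeg⟩ := exists_degree_eq_maxDegree hfin hpos
  set U₀ : Finset F.vertexSet := (Subtype.val ⁻¹' U).toFinset
  have hU₀ : Subtype.val '' (U₀ : Set F.vertexSet) = U := by
    simp only [U₀, Set.coe_toFinset, Subtype.image_preimage_coe]
    exact Set.inter_eq_right.2 hUV
  have hcard : #U₀ + 1 = k := by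
    rw [← Set.ncard_coe_finset, ← Set.ncard_image_of_injective _ Subtype.val_injective, hU₀, hU]
    omega
  refine ⟨U₀, hcard, ?_⟩
  rw [← card_starAt hcard, ← hdeg, Hypergraph.degree, ← Set.ncard_coe_finset,
    ← Set.ncard_image_of_injective _ (injective_image_val F k)]
  congr 1
  ext f
  constructor
  · rintro ⟨e, he, rfl⟩
    obtain ⟨heF, hUe⟩ := mem_filter.1 (mem_coe.1 he)
    refine ⟨mem_edges.1 heF, ?_⟩
    rw [← hU₀]
    exact Set.image_mono (coe_subset.2 hUe)
  · rintro ⟨hf, hUf⟩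
    obtain ⟨e, he, rfl⟩ := exists_edges_of_mem hunif hf
    refine ⟨e, mem_coe.2 (mem_filter.2 ⟨he, ?_⟩), rfl⟩
    rw [← hU₀] at hUf
    exact coe_subset.1 ((Set.image_subset_image_iff Subtype.val_injective).1 hUf)

/-- If every pair of a `(k - 1)`-set and a set of `⌈t⌉` vertices admits a good copy, then the
maximum degree of the process is less than `t`. -/
lemma maxDegree_lt {F : Hypergraph α} [Fintype F.vertexSet] [DecidableEq F.vertexSet]
    (hne : F.vertexSet.Nonempty) (hunif : F.IsUniform k) (hF : F.edgeSet.Nonempty)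
    {U₀ : Finset F.vertexSet} (hU₀ : #U₀ + 1 = k) {b : Edge n k → unitInterval}
    {p : unitInterval} {t : ℝ} (ht : 0 < t)
    (hgood : ∀ U T : Finset (Fin n), #U = #U₀ → #T = ⌈t⌉₊ → Disjoint U T →
      ∃ φ, IsGoodCopy (edges F k) (edges F k \ starAt (edges F k) U₀) U₀
        (neighbours (edges F k) U₀) U T {e | b e ≤ p} φ)
    {R : Hypergraph (Fin n)} (hR : IsProcessAt F b 1 R) : (R.maxDegree (k - 1) : ℝ) < t := by
  classical
  obtain ⟨l, hl, rfl⟩ := hR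
  by_contra hlt
  push Not at hlt
  have hk : 1 ≤ k := by omega
  have hpos : 0 < (run F l).maxDegree (k - 1) := by
    have := ht.trans_le hlt
    exact_mod_cast this
  obtain ⟨U, -, hU, hdeg⟩ := exists_degree_eq_maxDegree (Set.toFinite _) hpos
  set U' := U.toFinset
  have hU' : (U' : Set (Fin n)) = U := Set.coe_toFinset U
  have hU'card : #U' = #U₀ := by
    rw [← Set.ncard_coe_finset, hU', hU]
    omega
  set N : Finset (Fin n) := {y | y ∉ U ∧ insert y U ∈ (run F l).edgeSet}
  have hN : (run F l).degree U ≤ #N := by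
    rw [← Set.ncard_coe_finset]
    refine le_trans (Set.ncard_le_ncard (t := (fun y => insert y U) '' (N : Set (Fin n))) ?_
      (Set.toFinite _)) (Set.ncard_image_le (Set.toFinite _))
    rintro f ⟨hf, hUf⟩
    obtain ⟨e, -, rfl⟩ := exists_mem_of_mem_edgeSet_run F l hf
    obtain ⟨y, hyU, hy⟩ := exists_insert_eq hk hU (by rw [Set.ncard_coe_finset]; exact e.2) hUf
    exact ⟨y, by simpa [N] using ⟨hyU, hy ▸ hf⟩, hy⟩
  have htN : ⌈t⌉₊ ≤ #N := by
    rw [Nat.ceil_le]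
    refine hlt.trans ?_
    rw [← hdeg]
    exact_mod_cast hN
  obtain ⟨T, hTN, hT⟩ := exists_subset_card_eq htN
  have hUT : Disjoint U' T := by
    rw [disjoint_left]
    intro y hy hyT
    have := hTN hyT
    simp only [N, mem_filter, mem_univ, true_and] at this
    exact this.1 (by simpa [U'] using hy)
  obtain ⟨φ, hφU, hφD, hφS, hφG⟩ := hgood U' T hU'card hT hUT
  refine not_containsCopy_run F hF l ((containsCopy_iff hne hunif (vertexSet_run F l)).2
    ⟨φ, fun e he => ?_⟩)
  -- Star hyperedges are present because `D` goes into the neighbourhood `T` of `U`; the others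
  -- because the process must have accepted them.
  by_cases hstar : e ∈ starAt (edges F k) U₀
  · obtain ⟨x, hx, hxe⟩ := exists_insert_eq_of_mem_starAt hU₀ hstar
    have h1 := hTN (hφD x hx)
    simp only [N, mem_filter, mem_univ, true_and] at h1
    have h2 : ((Set.powersetCard.map k φ e).val : Set (Fin n)) = insert (φ x) U := by
      rw [Set.powersetCard.val_map, ← hxe, map_insert, coe_insert, hφU, hU']
    rw [h2]
    exact h1.2
  · have hmem : Set.powersetCard.map k φ e ∈ copy φ (edges F k \ starAt (edges F k) U₀) :=
      mem_copy.2 ⟨e, mem_sdiff.2 ⟨he, hstar⟩, rfl⟩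
    have hbp := hφS hmem
    simp only [mem_filter, mem_univ, true_and] at hbp
    exact mem_edgeSet_run F hne hunif hF hl hbp
      fun G hG hGH => disjoint_left.1 (hφG G hG hGH) hmem

end GreedyFree

open GreedyFree RandomSubset Filter MeasureTheory in
theorem exists_bound_tendsto {α : Type*} (k v h d : ℕ) (hk : 2 ≤ k)
    (F : Hypergraph α) (hfin : F.vertexSet.Finite) (hunif : F.IsUniform k)
    (hbal : F.IsStrictlyBalanced k)
    (hv : F.vertexSet.ncard = v) (hh : F.edgeSet.ncard = h) (hvh : (v : ℤ) - k + 1 ≤ h)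
    (hd : F.maxDegree (k - 1) = d) (hd2 : 2 ≤ d) :
    ∃ c : ℝ, Tendsto (fun n : ℕ => volume {b : Edge n k → unitInterval |
        ∀ R : Hypergraph (Fin n), IsProcessAt F b 1 R →
          (R.maxDegree (k - 1) : ℝ) < bound k v h d c n}) atTop (nhds 1) := by
  classical
  have : Fintype F.vertexSet := hfin.fintype
  obtain ⟨U₀, hU₀, hD⟩ := exists_card_neighbours_eq_maxDegree (k := k) (by omega) hunif
    (by rw [hd]; omega)
  have hbal' := isBalanced_edges hunif hbal
  have hcardV : Fintype.card F.vertexSet = v := by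
    rw [← hv, ← Nat.card_coe_set_eq, Nat.card_eq_fintype_card]
  have hcardE : (edges F k).card = h := (card_edges hunif).trans hh
  have hkv : k + 1 ≤ v := hv ▸ hbal.1
  have hne : F.vertexSet.Nonempty := Set.nonempty_of_ncard_ne_zero (by omega)
  have hF : F.edgeSet.Nonempty := Set.nonempty_of_ncard_ne_zero (by omega)
  obtain ⟨c, C, hc⟩ := exists_const_eventually_prob_le_of_isBalanced hbal' (by omega) hU₀
    (by rw [hD, hd]; exact hd2) (by omega)
  rw [hcardV, hcardE, hD, hd] at hc
  refine ⟨c, ?_⟩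
  have hlim : Tendsto (fun n : ℕ => ENNReal.ofReal (1 - C / n)) atTop (nhds 1) := by
    have h1 : Tendsto (fun n : ℕ => 1 - C / (n : ℝ)) atTop (nhds (1 - 0)) :=
      tendsto_const_nhds.sub (tendsto_const_div_atTop_nhds_zero_nat C)
    rw [sub_zero] at h1
    simpa using ENNReal.tendsto_ofReal h1
  -- Measurability of the event about all outcomes is not needed: it contains the event given by
  -- good copies, which depends only on the set of birthtimes at most `p`.
  refine tendsto_of_tendsto_of_tendsto_of_le_of_le' hlim tendsto_const_nhds ?_
    (Eventually.of_forall fun n => prob_le_one)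
  filter_upwards [hc] with n hn
  obtain ⟨ht, p, hp0, hp1, hprob⟩ := hn
  set Q : Finset (Edge n k) → Prop := fun H => ∀ U T : Finset (Fin n), U.card = U₀.card →
    T.card = ⌈bound k v h d c n⌉₊ → Disjoint U T →
      ∃ φ, IsGoodCopy (edges F k) (edges F k \ starAt (edges F k) U₀) U₀
        (neighbours (edges F k) U₀) U T H φ
  have hQ : 1 - C / n ≤ prob p Q := by
    have := prob_not (p := p) Q
    linarith
  calc ENNReal.ofReal (1 - C / n) ≤ ENNReal.ofReal (prob p Q) := ENNReal.ofReal_le_ofReal hQ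
    _ = volume {b : Edge n k → unitInterval |
          Q (Finset.univ.filter fun e => b e ≤ (⟨p, hp0, hp1⟩ : unitInterval))} :=
        (volume_setOf_le ⟨p, hp0, hp1⟩ Q).symm
    _ ≤ volume {b : Edge n k → unitInterval | ∀ R : Hypergraph (Fin n), IsProcessAt F b 1 R →
          (R.maxDegree (k - 1) : ℝ) < bound k v h d c n} := by
        refine measure_mono fun b hb R hR => ?_
        exact maxDegree_lt hne hunif hF hU₀ ht hb hR

theorem theorem1 {α : Type*} (k v h d : ℕ) (hk : 2 ≤ k)
    (F : Hypergraph α) (hfin : F.vertexSet.Finite) (hunif : F.IsUniform k)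
    (hbal : F.IsStrictlyBalanced k)
    (hv : F.vertexSet.ncard = v) (hh : F.edgeSet.ncard = h) (hvh : (v : ℤ) - k + 1 ≤ h)
    (hd : F.maxDegree (k - 1) = d) (hd2 : 2 ≤ d) :
    ∃ c : ℝ,
      Filter.Tendsto
        (fun n : ℕ => MeasureTheory.volume
          {b : GreedyFree.Edge n k → unitInterval |
            ∀ R : Hypergraph (Fin n), GreedyFree.IsProcessAt F b 1 R →
              (R.maxDegree (k - 1) : ℝ) < GreedyFree.bound k v h d c n})
        Filter.atTop (nhds 1) ∧
      Filter.Tendsto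
        (fun n : ℕ => MeasureTheory.volume
          {b : GreedyFree.Edge n k → unitInterval |
            ∀ R : Hypergraph (Fin n), GreedyFree.IsProcessAt F b 1 R →
              (R.edgeSet.ncard : ℝ) ≤ GreedyFree.bound k v h d c n * (n : ℝ) ^ (k - 1)})
        Filter.atTop (nhds 1) := by
  obtain ⟨c, hc⟩ := exists_bound_tendsto k v h d hk F hfin hunif hbal hv hh hvh hd hd2
  refine ⟨c, hc, tendsto_of_tendsto_of_tendsto_of_le_of_le hc tendsto_const_nhds
    (fun n => MeasureTheory.measure_mono fun b hb R hR => ?_)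
    fun n => MeasureTheory.prob_le_one⟩
  have hlt := hb R hR
  obtain ⟨l, -, rfl⟩ := hR
  have hle := GreedyFree.ncard_edgeSet_le (k := k) (by omega) (GreedyFree.vertexSet_run F l) (by
    intro f hf
    obtain ⟨e, -, rfl⟩ := GreedyFree.exists_mem_of_mem_edgeSet_run F l hf
    rw [Set.ncard_coe_finset]
    exact e.2)
  calc ((GreedyFree.run F l).edgeSet.ncard : ℝ)
      ≤ ((n ^ (k - 1) * (GreedyFree.run F l).maxDegree (k - 1) : ℕ) : ℝ) := by exact_mod_cast hle
    _ = (GreedyFree.run F l).maxDegree (k - 1) * (n : ℝ) ^ (k - 1) := by push_cast; ring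
    _ ≤ GreedyFree.bound k v h d c n * (n : ℝ) ^ (k - 1) := by gcongr
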